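/- **Conventions.** Let $k,\ell,m$ be non-negative integers with $\ell\le m$, and let $1\le d\le k-1$. For a $k$-uniform hypergraph $H$, $e(H)$ is its number of edges and $\delta_d(H)$ is the minimum, over all $d$-element sets $S\subseteq V(H)$, of the number of edges of $H$ containing $S$. A hypergraph collection $\mathbf H=(H_1,\dots,H_M)$ on $V$ consists of (not necessarily distinct) hypergraphs with vertex set $V$; $|\mathbf H|=M$, and $\delta_d(\mathbf H)\ge x$ means $\delta_d(H_i)\ge x$ for all $i$. A hypergraph $F$ on $V$ is a transversal of $\mathbf H$ if there is a bijection $\phi:E(F)\to[M]$ with $e\in E(H_{\phi(e)})$ for every $e\in E(F)$. Ordered hypergraphs have linearly ordered vertex sets, and isomorphisms between them preserve the order. Copies and embeddings are given by injective maps of the vertices sending edges to edges (not necessarily induced); a copy of an ordered hypergraph carries the order given by the map. We write $(m-\ell)\mathbb N$ for the set of non-negative multiples of $m-\ell$. **Links, chains, cycles.** An $\ell$-link of order $m$ and uniformity $k$ is an ordered $k$-uniform hypergraph $\mathcal A$ on $v_1<\dots<v_m$ such that its start $\mathcal A_s=\mathcal A[\{v_1,\dots,v_\ell\}]$ and its end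 $\mathcal A[\{v_{m-\ell+1},\dots,v_m\}]$ are isomorphic as ordered hypergraphs. An $\mathcal A$-chain of length $t\ge1$ is an ordered $k$-uniform hypergraph on $v_1<\dots<v_N$, $N=(m-\ell)t+\ell$, such that for each $0\le q<t$ the subhypergraph induced on $\{v_{(m-\ell)q+1},\dots,v_{(m-\ell)q+m}\}$ is isomorphic to $\mathcal A$ as an ordered hypergraph, and every edge lies in one of these $t$ vertex sets. Its start and its end are the ordered hypergraphs induced on its first $\ell$ and on its last $\ell$ vertices. An $\mathcal A$-cycle is the unordered $k$-uniform hypergraph obtained from an $\mathcal A$-chain by identifying, for each $1\le i\le \ell$, the $i$-th vertex of the start with the $i$-th vertex of the end. A Hamilton $\mathcal A$-cycle on $V$ is an $\mathcal A$-cycle with vertex set $V$. **Threshold.** The uncoloured minimum $d$-degree threshold $\delta(\mathcal A,d)$ for a Hamilton $\mathcal A$-cycle is the smallest real $\delta$ such that for every $\alpha>0$ there is $n_0$ such that for every $n\in(m-\ell)\mathbb N$ with $n\ge n_0$, every $k$-uniform hypergraph $H$ on $n$ vertices with $\delta_d(H)\ge(\delta+\alpha)n^{k-d}$ contains a Hamilton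 $\mathcal A$-cycle. **Goodness.** $\mathcal A$ is $(\delta,d)$-good if the following three properties hold. * **Ab**: for every $\alpha>0$ there are $0<\tau,\eta\le\alpha$ and $n_0$ such that every $k$-uniform $H$ on $n\ge n_0$ vertices with $\delta_d(H)\ge(\delta+\alpha)n^{k-d}$ has a set $A\subseteq V(H)$ with $|A|\le\tau n$ such that, for every $L\subseteq V(H)\setminus A$ with $|L|\le\eta n$ and $|L|\in(m-\ell)\mathbb N$ (including $L=\emptyset$), there is an embedding of an $\mathcal A$-chain into $H$ with vertex set exactly $A\cup L$, and the embedding of the start and of the end of this chain does not depend on $L$. * **Con**: for every $\alpha>0$ there are a positive integer $c$ and $n_0$ such that for every $k$-uniform $H$ on $n\ge n_0$ vertices with $\delta_d(H)\ge(\delta+\alpha)n^{k-d}$ and every two vertex-disjoint copies $\mathcal S,\mathcal T$ of $\mathcal A_s$ in $H$, there is an embedding into $H$ of an $\mathcal A$-chain of length at most $c$ with start $\mathcal S$ and end $\mathcal T$. * **Fac**: for every $\alpha>0$ there are $\beta_0>0$ and $n_0$ such that for all $n\ge n_0$ and $\beta\le\beta_0$, every $k$-uniform collection $\mathbf H$ on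 $[n]$ with $|\mathbf H|\le\beta n$, $\delta_d(\mathbf H)\ge(\delta+\alpha)n^{k-d}$ and $e(\mathcal A)$ dividing $|\mathbf H|$ has a transversal consisting of $|\mathbf H|/e(\mathcal A)$ vertex-disjoint copies of $\mathcal A$. **Theorem 2.5 (Main theorem).** Let $\mathcal A$ be an $\ell$-link of order $m$ and uniformity $k$ and let $1\le d\le k-1$. Let $\delta=\delta(\mathcal A,d)$ be the uncoloured minimum $d$-degree threshold for a Hamilton $\mathcal A$-cycle, and suppose that $\mathcal A$ is $(\delta_0,d)$-good for some real $\delta_0\ge\delta$. Then for every $\alpha>0$ there exists $n_0$ such that for every $n\in(m-\ell)\mathbb N$ with $n\ge n_0$ the following holds. Let $\mathbf H$ be a $k$-uniform hypergraph collection on $[n]$ with $|\mathbf H|=\frac{e(\mathcal A)-e(\mathcal A_s)}{m-\ell}\,n$ and $\delta_d(\mathbf H)\ge(\delta_0+\alpha)n^{k-d}$. Then $\mathbf H$ contains a transversal Hamilton $\mathcal A$-cycle. -/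

import Mathlib

/-- A finite `k`-uniform hypergraph with vertex set (all of) `V`. -/
@[ext]
structure UniformHypergraph (k : ℕ) (V : Type) where
  /-- The edges. -/
  edges : Finset (Finset V)
  /-- Every edge has exactly `k` vertices. -/
  uniform : ∀ e ∈ edges, e.card = k

namespace UniformHypergraph

/-- The hypergraph induced by `H` on the image of the injection `f`, with each vertex `f v`
relabelled as `v`. -/
def comap {k : ℕ} {V W : Type} [Fintype V] [DecidableEq W] (f : V ↪ W)
    (H : UniformHypergraph k W) : UniformHypergraph k V where
  edges := Finset.univ.filter fun e => e.map f ∈ H.edges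
  uniform := by
    intro e he
    have h := H.uniform _ (Finset.mem_filter.mp he).2
    rwa [Finset.card_map] at h

/-- The injection `f` embeds `G` into `H` (as a not necessarily induced subhypergraph). -/
def IsEmbedding {k : ℕ} {V W : Type} (f : V ↪ W)
    (G : UniformHypergraph k V) (H : UniformHypergraph k W) : Prop :=
  ∀ e ∈ G.edges, e.map f ∈ H.edges

/-- The number of edges of `H` containing the vertex set `S`. -/
def degree {k : ℕ} {V : Type} [DecidableEq V] (H : UniformHypergraph k V) (S : Finset V) : ℕ :=
  (H.edges.filter fun e => S ⊆ e).card

/-- The minimum `d`-degree: the least number of edges containing a set of `d` vertices. -/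
noncomputable def minDegree {k : ℕ} {V : Type} [DecidableEq V]
    (H : UniformHypergraph k V) (d : ℕ) : ℕ :=
  sInf {r : ℕ | ∃ S : Finset V, S.card = d ∧ H.degree S = r}

/-- The hypergraph `F` is a transversal of the collection `H` (indexed by colours `Fin M`):
there is a bijection from the edges of `F` to the colours such that each edge of `F`
is an edge of the hypergraph of its colour. -/
def IsTransversal {k M : ℕ} {V : Type} (F : UniformHypergraph k V)
    (H : Fin M → UniformHypergraph k V) : Prop :=
  ∃ φ : {e // e ∈ F.edges} ≃ Fin M, ∀ e, e.1 ∈ (H (φ e)).edges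

end UniformHypergraph

/-- The `len` consecutive vertices `s, s + 1, …, s + len - 1` of an ordered hypergraph
with vertices `0, 1, …, N - 1`, in increasing order. -/
def interval (s len N : ℕ) (h : s + len ≤ N) : Fin len ↪ Fin N where
  toFun i := ⟨s + i.1, by have := i.2; omega⟩
  inj' := by
    intro i j hij
    have h1 : s + i.1 = s + j.1 := congrArg Fin.val hij
    exact Fin.ext (by omega)

/-- An `ℓ`-link of order `m` and uniformity `k`. An ordered hypergraph on `m` vertices is a
hypergraph on `Fin m` with the natural order; since an isomorphism of ordered hypergraphs has
to be the unique order isomorphism, two ordered hypergraphs on the same `Fin ℓ` are isomorphic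
exactly when they are equal. -/
structure Link (k ℓ m : ℕ) where
  /-- The underlying ordered hypergraph. -/
  graph : UniformHypergraph k (Fin m)
  le : ℓ ≤ m
  /-- The hypergraphs induced on the first `ℓ` and on the last `ℓ` vertices are isomorphic
  as ordered hypergraphs. -/
  start_eq_end : graph.comap (interval 0 ℓ m (by omega)) =
    graph.comap (interval (m - ℓ) ℓ m (by omega))

namespace Link

variable {k ℓ m : ℕ}

/-- The start of a link, the ordered hypergraph induced on its first `ℓ` vertices. -/
def start (A : Link k ℓ m) : UniformHypergraph k (Fin ℓ) :=
  A.graph.comap (interval 0 ℓ m (by have := A.le; omega))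

theorem chain_bound (A : Link k ℓ m) {t : ℕ} (q : Fin t) :
    (m - ℓ) * q.1 + m ≤ (m - ℓ) * t + ℓ := by
  have h1 : (m - ℓ) * (q.1 + 1) ≤ (m - ℓ) * t := Nat.mul_le_mul_left _ q.2
  have h2 := A.le
  rw [Nat.mul_add, Nat.mul_one] at h1
  omega

/-- The ordered hypergraph `P` is an `A`-chain of length `t`: for each `q < t` the hypergraph
induced on the `q`-th window of `m` consecutive vertices is isomorphic to `A` as an ordered
hypergraph, and every edge lies in one of these windows. -/
def IsChain (A : Link k ℓ m) (t : ℕ) (P : UniformHypergraph k (Fin ((m - ℓ) * t + ℓ))) : Prop :=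
  1 ≤ t ∧
  (∀ q : Fin t, P.comap (interval ((m - ℓ) * q.1) m _ (A.chain_bound q)) = A.graph) ∧
  ∀ e ∈ P.edges, ∃ q : Fin t, ∀ x ∈ e, (m - ℓ) * q.1 ≤ x.1 ∧ x.1 < (m - ℓ) * q.1 + m

/-- The injection `f` embeds an `A`-chain of length `t` into `H` so that the start and the end
of the chain (its first and last `ℓ` vertices, in order) are embedded by `a` and `b`. -/
def IsChainEmbedding (A : Link k ℓ m) {V : Type} (H : UniformHypergraph k V) (t : ℕ)
    (f : Fin ((m - ℓ) * t + ℓ) ↪ V) (a b : Fin ℓ → V) : Prop :=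
  ∃ P : UniformHypergraph k (Fin ((m - ℓ) * t + ℓ)),
    A.IsChain t P ∧ P.IsEmbedding f H ∧
    (∀ i, f (interval 0 ℓ _ (by omega) i) = a i) ∧
    (∀ i, f (interval ((m - ℓ) * t) ℓ _ le_rfl i) = b i)

/-- The hypergraph `F` with vertex set `V` is an `A`-cycle. The map `σ` is the quotient map that
glues the start of a chain of length `t` to its end: vertex `i` of the start is identified with
vertex `(m - ℓ) * t + i` of the end, so two vertices are identified exactly when they are
congruent modulo `(m - ℓ) * t`. -/
def IsCycle (A : Link k ℓ m) {V : Type} [DecidableEq V] (F : UniformHypergraph k V) : Prop :=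
  ∃ (t : ℕ) (P : UniformHypergraph k (Fin ((m - ℓ) * t + ℓ)))
    (σ : Fin ((m - ℓ) * t + ℓ) → V),
    A.IsChain t P ∧ Function.Surjective σ ∧
    (∀ x y, σ x = σ y ↔ x.1 ≡ y.1 [MOD (m - ℓ) * t]) ∧
    F.edges = P.edges.image (Finset.image σ)

/-- `δ` is an upper bound for the (normalised) minimum `d`-degree forcing a Hamilton `A`-cycle:
for every `α > 0`, every large `k`-uniform hypergraph on `n ∈ (m - ℓ)ℕ` vertices with minimum
`d`-degree at least `(δ + α) n ^ (k - d)` contains a spanning `A`-cycle. -/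
def ForcesHamiltonCycle (A : Link k ℓ m) (d : ℕ) (δ : ℝ) : Prop :=
  ∀ α : ℝ, 0 < α → ∃ n₀ : ℕ, ∀ n : ℕ, n₀ ≤ n → (m - ℓ) ∣ n →
    ∀ H : UniformHypergraph k (Fin n), (δ + α) * (n : ℝ) ^ (k - d) ≤ (H.minDegree d : ℝ) →
      ∃ F : UniformHypergraph k (Fin n), A.IsCycle F ∧ F.edges ⊆ H.edges

/-- `δ` is the uncoloured minimum `d`-degree threshold for a Hamilton `A`-cycle. -/
def IsHamiltonThreshold (A : Link k ℓ m) (d : ℕ) (δ : ℝ) : Prop :=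
  IsLeast {x : ℝ | A.ForcesHamiltonCycle d x} δ

/-- Property `Ab`: existence of an absorbing set `S`, whose chain ends `a`, `b` do not depend
on the absorbed set `L`. -/
def Ab (A : Link k ℓ m) (δ : ℝ) (d : ℕ) : Prop :=
  ∀ α : ℝ, 0 < α → ∃ (τ η : ℝ) (n₀ : ℕ), 0 < τ ∧ τ ≤ α ∧ 0 < η ∧ η ≤ α ∧
    ∀ n : ℕ, n₀ ≤ n → ∀ H : UniformHypergraph k (Fin n),
      (δ + α) * (n : ℝ) ^ (k - d) ≤ (H.minDegree d : ℝ) →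
      ∃ S : Finset (Fin n), (S.card : ℝ) ≤ τ * n ∧
        ∃ a b : Fin ℓ → Fin n, ∀ L : Finset (Fin n), Disjoint L S → (L.card : ℝ) ≤ η * n →
          (m - ℓ) ∣ L.card →
          ∃ (t : ℕ) (f : Fin ((m - ℓ) * t + ℓ) ↪ Fin n),
            A.IsChainEmbedding H t f a b ∧ Finset.univ.map f = S ∪ L

/-- Property `Con`: any two vertex-disjoint copies of the start of `A` are connected by a chain
of bounded length. -/
def Con (A : Link k ℓ m) (δ : ℝ) (d : ℕ) : Prop :=
  ∀ α : ℝ, 0 < α → ∃ c n₀ : ℕ, 0 < c ∧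
    ∀ n : ℕ, n₀ ≤ n → ∀ H : UniformHypergraph k (Fin n),
      (δ + α) * (n : ℝ) ^ (k - d) ≤ (H.minDegree d : ℝ) →
      ∀ a b : Fin ℓ ↪ Fin n, A.start.IsEmbedding a H → A.start.IsEmbedding b H →
        (∀ i j, a i ≠ b j) →
        ∃ (t : ℕ) (f : Fin ((m - ℓ) * t + ℓ) ↪ Fin n), t ≤ c ∧ A.IsChainEmbedding H t f a b

/-- Property `Fac`: small collections have a transversal consisting of vertex-disjoint copies
of `A`. -/
def Fac (A : Link k ℓ m) (δ : ℝ) (d : ℕ) : Prop :=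
  ∀ α : ℝ, 0 < α → ∃ (β₀ : ℝ) (n₀ : ℕ), 0 < β₀ ∧
    ∀ (n : ℕ) (β : ℝ), n₀ ≤ n → β ≤ β₀ →
      ∀ (M : ℕ) (H : Fin M → UniformHypergraph k (Fin n)), (M : ℝ) ≤ β * n →
        (∀ i, (δ + α) * (n : ℝ) ^ (k - d) ≤ ((H i).minDegree d : ℝ)) →
        A.graph.edges.card ∣ M →
        ∃ (g : Fin (M / A.graph.edges.card) → (Fin m ↪ Fin n)) (F : UniformHypergraph k (Fin n)),
          (∀ p q, p ≠ q → ∀ x y, g p x ≠ g q y) ∧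
          (F.edges = Finset.univ.biUnion fun p => A.graph.edges.image (Finset.map (g p))) ∧
          F.IsTransversal H

/-- `A` is `(δ, d)`-good. -/
def IsGood (A : Link k ℓ m) (δ : ℝ) (d : ℕ) : Prop :=
  A.Ab δ d ∧ A.Con δ d ∧ A.Fac δ d

end Link

/-! Only `ℓ < m` matters; write `w = m - ℓ`, `n = w * T`, and call an edge of `A` new if it is not
inside the first `ℓ` vertices. In a long enough cycle every edge is new in exactly one window, so a
Hamilton cycle has exactly `T * D` edges with `D = e(A) - e(A_s)`. This is also the number of
colours. Every colour must therefore be used exactly once and every vertex covered, and both demands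
are met by absorption.

Colours. The edges lying in a positive proportion of the hypergraphs form a hypergraph of almost the
same minimum degree (`richOn_popular`), so the uncoloured threshold yields a Hamilton cycle of
popular edges. Keep a short initial segment of it. In the bipartite graph between its edges and the
colours, `exists_absorber_core` finds a fixed colour set `B₀` and a flexible set `B₁` such that `B₀`
together with any `l` members of `B₁` can be matched bijectively to the edges of the segment. Let
`H'` consist of the edges popular within `B₁`. Edges of `H'` can be coloured greedily from `B₁`
until exactly `l` flexible colours remain, and the segment takes those. Hence `H'` can be treated as
a single uncoloured hypergraph.

Vertices. Property `Ab` for `H'` gives a vertex absorber `S`. A random set `R` of small linear size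
is a reservoir in which `H'` and all `H i` keep their relative degrees (`exists_linear_reservoir`).
The remaining vertices are cut into random blocks of bounded size. Most blocks inherit the degree
condition for most colours, and there are boundedly many hypergraphs on a block, so by pigeonhole
many colours induce the same one. Its Hamilton cycle contains a chain that any distinct colours of
this class may colour (`exists_rainbow_chain_cover`). In this way almost all colours outside `B₀`
and a suitable `B ⊆ B₁` are used up. The few remaining ones, padded from `B` to a multiple of
`e(A)`, are used exactly by disjoint copies of `A` in `R`, by `Fac`.

Assembly. Property `Con` for `H'` joins all pieces through `R`, the vertices still uncovered are
absorbed together with `S`, and the result closes up to a Hamilton cycle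
(`exists_transversal_of_pieces`). Outside the segment, its uncoloured edges all lie in `H'`, so the
colouring can be completed (`isTransversal_of_absorber`). The size of `B` balances the colours
against the vertices not covered by coloured chains. -/

theorem interval_val (s len N : ℕ) (h : s + len ≤ N) (i : Fin len) :
    (interval s len N h i).1 = s + i.1 := rfl

/-! ### Links and chains as sequences of vertices -/

namespace Link

variable {k ℓ m : ℕ}

theorem mem_start_edges (A : Link k ℓ m) (e : Finset (Fin ℓ)) :
    e ∈ A.start.edges ↔
      e.map (interval 0 ℓ m (by have := A.le; omega)) ∈ A.graph.edges := by
  simp [start, UniformHypergraph.comap]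

theorem mem_start_edges_end (A : Link k ℓ m) (e : Finset (Fin ℓ)) :
    e ∈ A.start.edges ↔
      e.map (interval (m - ℓ) ℓ m (by have := A.le; omega)) ∈ A.graph.edges := by
  unfold start
  rw [A.start_eq_end]
  simp [UniformHypergraph.comap]

/-- The edges of a link as sets of natural numbers. -/
def natEdges (A : Link k ℓ m) : Finset (Finset ℕ) :=
  A.graph.edges.image fun e => e.image Fin.val

theorem image_val_mem_natEdges (A : Link k ℓ m) (e : Finset (Fin m)) :
    e.image Fin.val ∈ A.natEdges ↔ e ∈ A.graph.edges := by
  unfold natEdges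
  rw [Finset.mem_image]
  constructor
  · rintro ⟨e', h, he⟩
    rwa [← Finset.image_injective Fin.val_injective he]
  · exact fun h => ⟨e, h, rfl⟩

theorem exists_image_val {N : ℕ} {s : Finset ℕ} (hs : ∀ x ∈ s, x < N) :
    ∃ e : Finset (Fin N), e.image Fin.val = s := by
  refine ⟨Finset.univ.filter fun i => i.1 ∈ s, ?_⟩
  ext x
  simp only [Finset.mem_image, Finset.mem_filter, Finset.mem_univ, true_and]
  constructor
  · rintro ⟨i, hi, rfl⟩
    exact hi
  · exact fun hx => ⟨⟨x, hs x hx⟩, hx, rfl⟩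

/-- This is the isomorphism of start and end in coordinates: on the first `ℓ` positions, being an
edge is invariant under translation by `m - ℓ`. Sets of naturals are used so that translations can
be composed. -/
theorem natEdges_shift_one (A : Link k ℓ m) {s : Finset ℕ} (hs : ∀ x ∈ s, x < ℓ) :
    s ∈ A.natEdges ↔ s.image (fun x => (m - ℓ) + x) ∈ A.natEdges := by
  obtain ⟨e, rfl⟩ := exists_image_val hs
  have h1 := A.mem_start_edges e
  have h2 := A.mem_start_edges_end e
  rw [← image_val_mem_natEdges] at h1 h2
  have e1 : (e.map (interval 0 ℓ m (by have := A.le; omega))).image Fin.val =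
      e.image Fin.val := by
    rw [Finset.map_eq_image, Finset.image_image]
    refine Finset.image_congr fun i _ => ?_
    simp [interval_val]
  have e2 : (e.map (interval (m - ℓ) ℓ m (by have := A.le; omega))).image Fin.val =
      (e.image Fin.val).image (fun x => (m - ℓ) + x) := by
    rw [Finset.map_eq_image, Finset.image_image, Finset.image_image]
    refine Finset.image_congr fun i _ => ?_
    simp [interval_val]
  rw [e1] at h1
  rw [e2] at h2
  exact h1.symm.trans h2

/-- The one-step translation can be iterated: if the last translate stays below `m`, all earlier
ones stay below `ℓ`. -/
theorem natEdges_shift (A : Link k ℓ m) (j : ℕ) {s : Finset ℕ}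
    (hs : ∀ x ∈ s, (m - ℓ) * j + x < m) :
    s ∈ A.natEdges ↔ s.image (fun x => (m - ℓ) * j + x) ∈ A.natEdges := by
  have hle := A.le
  induction j with
  | zero => simp
  | succ j ih =>
    have h1 := ih (fun x hx => by have := hs x hx; rw [Nat.mul_succ] at this; omega)
    refine h1.trans ?_
    rw [natEdges_shift_one, Finset.image_image]
    · have : (fun x => m - ℓ + x) ∘ (fun x => (m - ℓ) * j + x) =
          fun x => (m - ℓ) * (j + 1) + x := by
        funext x
        simp only [Function.comp, Nat.mul_succ]
        omega
      rw [this]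
    · intro x hx
      obtain ⟨y, hy, rfl⟩ := Finset.mem_image.mp hx
      have := hs y hy
      rw [Nat.mul_succ] at this
      omega

/-- Consistency of overlapping windows: a vertex set inside two windows is declared an edge by both
or by neither. Without this, a union of copies of `A` along a sequence could induce more than `A` on
some window. -/
theorem mem_edges_of_shift_eq (A : Link k ℓ m) {q q' : ℕ} {e e' : Finset (Fin m)}
    (h : (e.image fun i => (m - ℓ) * q + i.1) = e'.image fun i => (m - ℓ) * q' + i.1) :
    e ∈ A.graph.edges ↔ e' ∈ A.graph.edges := by
  wlog hq : q ≤ q' generalizing q q' e e'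
  · exact (this h.symm (by omega)).symm
  obtain ⟨j, rfl⟩ := Nat.exists_eq_add_of_le hq
  have h' : e.image Fin.val = (e'.image Fin.val).image (fun x => (m - ℓ) * j + x) := by
    have hinj : Function.Injective fun x : ℕ => (m - ℓ) * q + x := fun x y hxy => by
      simpa using hxy
    apply Finset.image_injective hinj
    simp only [Finset.image_image]
    refine h.trans (Finset.image_congr fun i _ => ?_)
    show (m - ℓ) * (q + j) + i.1 = (m - ℓ) * q + ((m - ℓ) * j + i.1)
    ring
  rw [← image_val_mem_natEdges, ← image_val_mem_natEdges, h', ← natEdges_shift]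
  intro x hx
  have : (m - ℓ) * j + x ∈ e.image Fin.val := by
    rw [h']
    exact Finset.mem_image_of_mem _ hx
  obtain ⟨i, _, hi⟩ := Finset.mem_image.mp this
  rw [← hi]
  exact i.2

/-- The edges of the `A`-chain of length `t` whose vertices, in order, are
`f 0, f 1, …, f ((m - ℓ) * t + ℓ - 1)`. -/
def chainEdges (A : Link k ℓ m) {V : Type} [DecidableEq V] (f : ℕ → V) (t : ℕ) :
    Finset (Finset V) :=
  (Finset.range t).biUnion fun q =>
    A.graph.edges.image fun e => e.image fun i => f ((m - ℓ) * q + i.1)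

/-- The vertices of the `A`-chain of length `t` given by `f`. -/
def chainVerts (_ : Link k ℓ m) {V : Type} [DecidableEq V] (f : ℕ → V) (t : ℕ) : Finset V :=
  (Finset.range ((m - ℓ) * t + ℓ)).image f

/-- The edges of the copy of the start of `A` given by `a`. -/
def startEdges (A : Link k ℓ m) {V : Type} [DecidableEq V] (a : ℕ → V) : Finset (Finset V) :=
  A.start.edges.image fun e => e.image fun i => a i.1

section chains

variable {V : Type} [DecidableEq V]

theorem mem_chainEdges (A : Link k ℓ m) {f : ℕ → V} {t : ℕ} {s : Finset V} :
    s ∈ A.chainEdges f t ↔ ∃ q < t, ∃ e ∈ A.graph.edges,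
      (e.image fun i => f ((m - ℓ) * q + i.1)) = s := by
  simp [chainEdges]

theorem mem_chainVerts (A : Link k ℓ m) {f : ℕ → V} {t : ℕ} {v : V} :
    v ∈ A.chainVerts f t ↔ ∃ i < (m - ℓ) * t + ℓ, f i = v := by
  simp [chainVerts]

theorem window_lt (A : Link k ℓ m) {q t : ℕ} (hq : q < t) (i : Fin m) :
    (m - ℓ) * q + i.1 < (m - ℓ) * t + ℓ := by
  have := A.chain_bound (⟨q, hq⟩ : Fin t)
  have h := i.2
  simp only at this
  omega

theorem chainEdges_congr (A : Link k ℓ m) {f g : ℕ → V} {t : ℕ}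
    (h : ∀ i < (m - ℓ) * t + ℓ, f i = g i) : A.chainEdges f t = A.chainEdges g t := by
  refine Finset.biUnion_congr rfl fun q hq => Finset.image_congr fun e _ =>
    Finset.image_congr fun i _ => h _ (A.window_lt (Finset.mem_range.mp hq) i)

theorem subset_chainVerts (A : Link k ℓ m) {f : ℕ → V} {t : ℕ} {s : Finset V}
    (hs : s ∈ A.chainEdges f t) : s ⊆ A.chainVerts f t := by
  obtain ⟨q, hq, e, _, rfl⟩ := A.mem_chainEdges.mp hs
  intro v hv
  obtain ⟨i, _, rfl⟩ := Finset.mem_image.mp hv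
  exact A.mem_chainVerts.mpr ⟨_, A.window_lt hq i, rfl⟩

theorem card_of_mem_chainEdges (A : Link k ℓ m) {f : ℕ → V} {t : ℕ} {s : Finset V}
    (hf : Set.InjOn f (Set.Iio ((m - ℓ) * t + ℓ)))
    (hs : s ∈ A.chainEdges f t) : s.card = k := by
  obtain ⟨q, hq, e, he, rfl⟩ := A.mem_chainEdges.mp hs
  rw [Finset.card_image_of_injOn, A.graph.uniform e he]
  intro i _ j _ hij
  have := hf (A.window_lt hq i) (A.window_lt hq j) hij
  exact Fin.ext (by omega)

theorem card_chainVerts (A : Link k ℓ m) {f : ℕ → V} {t : ℕ}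
    (hf : Set.InjOn f (Set.Iio ((m - ℓ) * t + ℓ))) :
    (A.chainVerts f t).card = (m - ℓ) * t + ℓ := by
  rw [chainVerts, Finset.card_image_of_injOn, Finset.card_range]
  simpa using hf

theorem chainEdges_mono (A : Link k ℓ m) (f : ℕ → V) {t u : ℕ} (h : t ≤ u) :
    A.chainEdges f t ⊆ A.chainEdges f u := by
  intro s hs
  obtain ⟨q, hq, e, he, rfl⟩ := A.mem_chainEdges.mp hs
  exact A.mem_chainEdges.mpr ⟨q, by omega, e, he, rfl⟩

theorem startEdges_subset (A : Link k ℓ m) (f : ℕ → V) {t : ℕ} (ht : 1 ≤ t) :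
    A.startEdges f ⊆ A.chainEdges f t := by
  intro s hs
  obtain ⟨e, he, rfl⟩ := Finset.mem_image.mp hs
  refine A.mem_chainEdges.mpr ⟨0, ht, _, (A.mem_start_edges e).mp he, ?_⟩
  rw [Finset.map_eq_image, Finset.image_image]
  refine Finset.image_congr fun i _ => ?_
  simp [interval_val]

theorem endEdges_subset (A : Link k ℓ m) (f : ℕ → V) {t : ℕ} (ht : 1 ≤ t) :
    A.startEdges (fun i => f ((m - ℓ) * t + i)) ⊆ A.chainEdges f t := by
  intro s hs
  obtain ⟨e, he, rfl⟩ := Finset.mem_image.mp hs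
  refine A.mem_chainEdges.mpr ⟨t - 1, by omega, _, (A.mem_start_edges_end e).mp he, ?_⟩
  rw [Finset.map_eq_image, Finset.image_image]
  refine Finset.image_congr fun i _ => ?_
  obtain ⟨u, rfl⟩ := Nat.exists_eq_add_of_le' ht
  simp [interval_val, Nat.mul_succ, add_assoc]

/-- Following `f` for `N` steps and then `g`. -/
def splice (f g : ℕ → V) (N : ℕ) : ℕ → V := fun i => if i < N then f i else g (i - N)

omit [DecidableEq V] in
theorem splice_of_lt (f g : ℕ → V) {N i : ℕ} (h : i < N) : splice f g N i = f i := if_pos h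

omit [DecidableEq V] in
theorem splice_add (f g : ℕ → V) (N i : ℕ) : splice f g N (N + i) = g i := by
  simp [splice]

omit [DecidableEq V] in
-- The two sequences agree on an overlap of `ℓ` positions, so there the spliced sequence can be read
-- either way.
theorem splice_left {f g : ℕ → V} {N : ℕ} (h : ∀ i < ℓ, f (N + i) = g i) {i : ℕ}
    (hi : i < N + ℓ) : splice f g N i = f i := by
  by_cases h1 : i < N
  · exact splice_of_lt f g h1
  · obtain ⟨j, rfl⟩ := Nat.exists_eq_add_of_le (not_lt.mp h1)
    rw [splice_add, h j (by omega)]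

theorem chainEdges_splice (A : Link k ℓ m) {f g : ℕ → V} {t : ℕ} (u : ℕ)
    (h : ∀ i < ℓ, f ((m - ℓ) * t + i) = g i) :
    A.chainEdges (splice f g ((m - ℓ) * t)) (t + u) = A.chainEdges f t ∪ A.chainEdges g u := by
  have h1 : A.chainEdges (splice f g ((m - ℓ) * t)) t = A.chainEdges f t :=
    A.chainEdges_congr fun i hi => splice_left h hi
  have key : ∀ (j : ℕ) (e : Finset (Fin m)),
      (e.image fun i => splice f g ((m - ℓ) * t) ((m - ℓ) * (t + j) + i.1)) =
      e.image fun i => g ((m - ℓ) * j + i.1) := fun j e =>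
    Finset.image_congr fun i _ => by
      have h2 : (m - ℓ) * (t + j) + i.1 = (m - ℓ) * t + ((m - ℓ) * j + i.1) := by ring
      simp only [h2, splice_add]
  rw [← h1]
  ext s
  rw [Finset.mem_union, mem_chainEdges, mem_chainEdges, mem_chainEdges]
  constructor
  · rintro ⟨q, hq, e, he, rfl⟩
    by_cases hqt : q < t
    · exact Or.inl ⟨q, hqt, e, he, rfl⟩
    · obtain ⟨j, rfl⟩ := Nat.exists_eq_add_of_le (not_lt.mp hqt)
      exact Or.inr ⟨j, by omega, e, he, (key j e).symm⟩
  · rintro (⟨q, hq, e, he, rfl⟩ | ⟨q, hq, e, he, rfl⟩)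
    · exact ⟨q, by omega, e, he, rfl⟩
    · exact ⟨t + q, by omega, e, he, key q e⟩

theorem chainVerts_splice (A : Link k ℓ m) {f g : ℕ → V} {t : ℕ} (u : ℕ)
    (h : ∀ i < ℓ, f ((m - ℓ) * t + i) = g i) :
    A.chainVerts (splice f g ((m - ℓ) * t)) (t + u) = A.chainVerts f t ∪ A.chainVerts g u := by
  ext v
  rw [Finset.mem_union, mem_chainVerts, mem_chainVerts, mem_chainVerts, Nat.mul_add]
  constructor
  · rintro ⟨i, hi, rfl⟩
    by_cases hit : i < (m - ℓ) * t
    · exact Or.inl ⟨i, by omega, (splice_of_lt f g hit).symm⟩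
    · obtain ⟨j, rfl⟩ := Nat.exists_eq_add_of_le (not_lt.mp hit)
      exact Or.inr ⟨j, by omega, (splice_add f g _ _).symm⟩
  · rintro (⟨i, hi, rfl⟩ | ⟨i, hi, rfl⟩)
    · exact ⟨i, by omega, splice_left h hi⟩
    · exact ⟨(m - ℓ) * t + i, by omega, splice_add f g _ _⟩

omit [DecidableEq V] in
theorem injOn_splice {f g : ℕ → V} {N N' : ℕ} (h : ∀ i < ℓ, f (N + i) = g i)
    (hf : Set.InjOn f (Set.Iio (N + ℓ))) (hg : Set.InjOn g (Set.Iio N'))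
    (hd : ∀ i < N + ℓ, ∀ j, ℓ ≤ j → j < N' → f i ≠ g j) :
    Set.InjOn (splice f g N) (Set.Iio (N + N')) := by
  have main : ∀ x < N + N', ∀ y < N + N', x < N → splice f g N x = splice f g N y → x = y := by
    intro x hx y hy hxN hxy
    rw [splice_of_lt f g hxN] at hxy
    by_cases hyN : y < N + ℓ
    · rw [splice_left h hyN] at hxy
      exact hf (Set.mem_Iio.mpr (by omega)) hyN hxy
    · obtain ⟨j, rfl⟩ := Nat.exists_eq_add_of_le (show N ≤ y by omega)
      rw [splice_add] at hxy
      exact absurd hxy (hd x (by omega) j (by omega) (by omega))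
  intro x hx y hy hxy
  rw [Set.mem_Iio] at hx hy
  by_cases hxN : x < N
  · exact main x hx y hy hxN hxy
  by_cases hyN : y < N
  · exact (main y hy x hx hyN hxy.symm).symm
  obtain ⟨i, rfl⟩ := Nat.exists_eq_add_of_le (not_lt.mp hxN)
  obtain ⟨j, rfl⟩ := Nat.exists_eq_add_of_le (not_lt.mp hyN)
  rw [splice_add, splice_add] at hxy
  rw [hg (Set.mem_Iio.mpr (by omega)) (Set.mem_Iio.mpr (by omega)) hxy]

/-- The edges of a link that are not edges of its start. -/
def newEdges (A : Link k ℓ m) : Finset (Finset (Fin m)) :=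
  A.graph.edges.filter fun e => ∃ x ∈ e, ℓ ≤ x.1

/-- The edges without a vertex at a position `≥ ℓ` are exactly those of the start. So the number of
new edges is `e(A) - e(A_s)`, the cost in colours of one more window. -/
theorem card_newEdges (A : Link k ℓ m) :
    A.newEdges.card + A.start.edges.card = A.graph.edges.card := by
  have h : A.start.edges.card = (A.graph.edges.filter fun e => ¬ ∃ x ∈ e, ℓ ≤ x.1).card := by
    refine Finset.card_bij (fun e _ => e.map (interval 0 ℓ m (by have := A.le; omega))) ?_ ?_ ?_
    · intro e he
      rw [Finset.mem_filter]
      refine ⟨(A.mem_start_edges e).mp he, ?_⟩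
      rintro ⟨x, hx, hlx⟩
      obtain ⟨i, _, rfl⟩ := Finset.mem_map.mp hx
      have := i.2
      simp [interval_val] at hlx
      omega
    · intro e _ e' _ h
      exact Finset.map_injective _ h
    · intro e he
      obtain ⟨he1, he2⟩ := Finset.mem_filter.mp he
      push Not at he2
      have hmap : (Finset.univ.filter fun i : Fin ℓ =>
          interval 0 ℓ m (by have := A.le; omega) i ∈ e).map
          (interval 0 ℓ m (by have := A.le; omega)) = e := by
        ext x
        simp only [Finset.mem_map, Finset.mem_filter, Finset.mem_univ, true_and]
        constructor
        · rintro ⟨i, hi, rfl⟩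
          exact hi
        · intro hx
          have hxl := he2 x hx
          have : interval 0 ℓ m (by have := A.le; omega) ⟨x.1, hxl⟩ = x :=
            Fin.ext (by simp [interval_val])
          exact ⟨⟨x.1, hxl⟩, by rwa [this], this⟩
      refine ⟨_, ?_, hmap⟩
      rw [mem_start_edges, hmap]
      exact he1
  rw [h]
  exact Finset.card_filter_add_card_filter_not _

/-- If every edge lay in the start, its translate by `m - ℓ > 0` would again be an edge and hence
again lie in the start. Repeating this pushes a vertex beyond position `ℓ`. -/
theorem newEdges_nonempty (A : Link k ℓ m) (hlm : ℓ < m) (hk : 0 < k)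
    (hA : A.graph.edges.Nonempty) : A.newEdges.Nonempty := by
  by_contra hne
  rw [Finset.not_nonempty_iff_eq_empty] at hne
  have hall : ∀ s ∈ A.natEdges, ∀ x ∈ s, x < ℓ := by
    intro s hs x hx
    obtain ⟨e, he, rfl⟩ := Finset.mem_image.mp hs
    obtain ⟨i, hi, rfl⟩ := Finset.mem_image.mp hx
    by_contra hlx
    have : e ∈ A.newEdges := Finset.mem_filter.mpr ⟨he, i, hi, by omega⟩
    rw [hne] at this
    exact absurd this (Finset.notMem_empty _)
  have hstep : ∀ s ∈ A.natEdges, s.image (fun x => (m - ℓ) + x) ∈ A.natEdges := fun s hs =>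
    (A.natEdges_shift_one (hall s hs)).mp hs
  obtain ⟨e, he⟩ := hA
  have hpos : 0 < e.card := by rw [A.graph.uniform e he]; exact hk
  obtain ⟨x, hx⟩ := Finset.card_pos.mp hpos
  have hiter : ∀ j : ℕ, ∃ s ∈ A.natEdges, ∃ y ∈ s, j ≤ y := by
    intro j
    induction j with
    | zero =>
      exact ⟨_, (A.image_val_mem_natEdges e).mpr he, x.1, Finset.mem_image_of_mem _ hx, by omega⟩
    | succ j ih =>
      obtain ⟨s, hs, y, hy, hjy⟩ := ih
      exact ⟨_, hstep s hs, (m - ℓ) + y, Finset.mem_image_of_mem _ hy, by omega⟩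
  obtain ⟨s, hs, y, hy, hly⟩ := hiter ℓ
  exact absurd (hall s hs y hy) (by omega)

theorem start_edge_shift (A : Link k ℓ m) {e : Finset (Fin m)} (he : e ∈ A.graph.edges)
    (hs : ∀ x ∈ e, x.1 < ℓ) : ∃ e' ∈ A.graph.edges,
      (e.image Fin.val).image (fun x => (m - ℓ) + x) = e'.image Fin.val := by
  have h := (A.natEdges_shift_one (s := e.image Fin.val) (by
    intro x hx
    obtain ⟨i, hi, rfl⟩ := Finset.mem_image.mp hx
    exact hs i hi)).mp ((A.image_val_mem_natEdges e).mpr he)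
  obtain ⟨e', he', h'⟩ := Finset.mem_image.mp h
  exact ⟨e', he', h'.symm⟩

/-- An old edge of a window is also an edge of the preceding window, at positions larger by `m - ℓ`.
This growth of positions makes repeated backward steps terminate at a new edge. -/
theorem start_edge_pred (A : Link k ℓ m) (f : ℕ → V) {e : Finset (Fin m)}
    (he : e ∈ A.graph.edges) (hs : ∀ x ∈ e, x.1 < ℓ) (q : ℕ) : ∃ e' ∈ A.graph.edges,
      (e'.image fun i => f ((m - ℓ) * q + i.1)) =
        (e.image fun i => f ((m - ℓ) * (q + 1) + i.1)) ∧
      ∀ x ∈ e, ∃ x' ∈ e', x'.1 = (m - ℓ) + x.1 := by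
  obtain ⟨e', he', h⟩ := A.start_edge_shift he hs
  refine ⟨e', he', ?_, ?_⟩
  swap
  · intro x hx
    have : (m - ℓ) + x.1 ∈ e'.image Fin.val := by
      rw [← h]
      exact Finset.mem_image_of_mem _ (Finset.mem_image_of_mem _ hx)
    obtain ⟨x', hx', hxx⟩ := Finset.mem_image.mp this
    exact ⟨x', hx', hxx⟩
  have h1 : (e'.image fun i => f ((m - ℓ) * q + i.1)) =
      (e'.image Fin.val).image fun x => f ((m - ℓ) * q + x) := by
    rw [Finset.image_image]; rfl
  rw [h1, ← h, Finset.image_image, Finset.image_image]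
  refine Finset.image_congr fun i _ => ?_
  simp only [Function.comp, Nat.mul_succ, add_assoc]

/-- Two new edges in two windows of a cyclic sequence agree only if they coincide. -/
theorem new_window_eq (hlm : ℓ < m) {T q q' : ℕ} {e e' : Finset (Fin m)}
    (hT : 2 * m ≤ (m - ℓ) * T) (hq : q < T) (hq' : q' < T) {x₀ x₁ : Fin m}
    (hx₀ : x₀ ∈ e) (hlx₀ : ℓ ≤ x₀.1) (hx₁ : x₁ ∈ e') (hlx₁ : ℓ ≤ x₁.1)
    (h₁ : ∀ x ∈ e, ∃ y ∈ e', (m - ℓ) * q + x.1 ≡ (m - ℓ) * q' + y.1 [MOD (m - ℓ) * T])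
    (h₂ : ∀ y ∈ e', ∃ x ∈ e, (m - ℓ) * q + x.1 ≡ (m - ℓ) * q' + y.1 [MOD (m - ℓ) * T]) :
    q = q' ∧ e = e' := by
  -- Positions are below `m`, so the differences formed below are smaller than `2 * m` in absolute
  -- value and hence smaller than the modulus; divisibility forces them to vanish.
  have hsmall : ∀ z : ℤ, (((m - ℓ) * T : ℕ) : ℤ) ∣ z → |z| < 2 * m → z = 0 := by
    intro z hz hlt
    refine Int.eq_zero_of_abs_lt_dvd hz (lt_of_lt_of_le hlt ?_)
    exact_mod_cast hT
  have hmod : ∀ {x y : ℕ}, (m - ℓ) * q + x ≡ (m - ℓ) * q' + y [MOD (m - ℓ) * T] →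
      (((m - ℓ) * T : ℕ) : ℤ) ∣ (((m - ℓ) * q' + y : ℕ) : ℤ) - (((m - ℓ) * q + x : ℕ) : ℤ) :=
    fun h => (Nat.modEq_iff_dvd.mp h)
  -- Compare the last vertices `a` and `b`. If `a` matches `y ≤ b` and `b` matches `x ≤ a`, then `(y
  -- - b) + (x - a)` is divisible by the modulus, hence zero, and `a` matches `b`. Both lie in `[ℓ,
  -- m)` and agree modulo `m - ℓ`, so they are equal, and then so are the windows.
  obtain ⟨a, ha, hamax⟩ := e.exists_max_image id ⟨x₀, hx₀⟩
  obtain ⟨b, hb, hbmax⟩ := e'.exists_max_image id ⟨x₁, hx₁⟩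
  have hla : ℓ ≤ a.1 := hlx₀.trans (hamax x₀ hx₀)
  have hlb : ℓ ≤ b.1 := hlx₁.trans (hbmax x₁ hx₁)
  obtain ⟨y, hy, hay⟩ := h₁ a ha
  obtain ⟨x, hx, hbx⟩ := h₂ b hb
  have hyb : y.1 ≤ b.1 := hbmax y hy
  have hxa : x.1 ≤ a.1 := hamax x hx
  have hdvd := dvd_sub (hmod hay) (hmod hbx)
  have hz := hsmall _ hdvd (by
    have := a.2; have := b.2
    rw [abs_lt]
    push_cast
    constructor <;> omega)
  have hyb' : y.1 = b.1 := by push_cast at hz; omega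
  have hab := hmod hay
  rw [hyb'] at hab
  have hw : ((m - ℓ : ℕ) : ℤ) ∣ (b.1 : ℤ) - a.1 := by
    have h1 : ((m - ℓ : ℕ) : ℤ) ∣ (((m - ℓ) * q' + b.1 : ℕ) : ℤ) - (((m - ℓ) * q + a.1 : ℕ) : ℤ) :=
      (Dvd.intro _ (by push_cast; rfl)).trans hab
    have h2 : (b.1 : ℤ) - a.1 = ((((m - ℓ) * q' + b.1 : ℕ) : ℤ) -
        (((m - ℓ) * q + a.1 : ℕ) : ℤ)) - ((m - ℓ : ℕ) : ℤ) * ((q' : ℤ) - q) := by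
      push_cast; ring
    rw [h2]
    exact dvd_sub h1 (Dvd.intro _ rfl)
  have hba : (b.1 : ℤ) - a.1 = 0 := by
    refine Int.eq_zero_of_abs_lt_dvd hw ?_
    have := a.2; have := b.2
    rw [abs_lt]
    constructor <;> omega
  have hqq : (q' : ℤ) - q = 0 := by
    have h1 : (((m - ℓ) * T : ℕ) : ℤ) ∣ ((m - ℓ : ℕ) : ℤ) * ((q' : ℤ) - q) := by
      have h2 : ((m - ℓ : ℕ) : ℤ) * ((q' : ℤ) - q) =
          (((m - ℓ) * q' + b.1 : ℕ) : ℤ) - (((m - ℓ) * q + a.1 : ℕ) : ℤ) := by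
        push_cast
        linear_combination (-1 : ℤ) * hba
      rw [h2]; exact hab
    push_cast at h1
    have h3 : ((m - ℓ : ℕ) : ℤ) ≠ 0 := by omega
    have h4 := (mul_dvd_mul_iff_left h3).mp h1
    refine Int.eq_zero_of_abs_lt_dvd h4 ?_
    rw [abs_lt]
    constructor <;> omega
  have hqq' : q = q' := by omega
  subst hqq'
  refine ⟨rfl, ?_⟩
  have hsame : ∀ x y : Fin m, (m - ℓ) * q + x.1 ≡ (m - ℓ) * q + y.1 [MOD (m - ℓ) * T] →
      x = y := by
    intro x y hxy
    have := hsmall _ (hmod hxy) (by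
      have := x.2; have := y.2
      rw [abs_lt]; push_cast
      constructor <;> omega)
    push_cast at this
    exact Fin.ext (by omega)
  ext z
  constructor
  · intro hz
    obtain ⟨y, hy, hzy⟩ := h₁ z hz
    rwa [hsame _ _ hzy]
  · intro hz
    obtain ⟨x, hx, hxz⟩ := h₂ z hz
    rwa [← hsame _ _ hxz]

end chains

end Link

/-! ### Edge counts, and passage between sequences and chains or cycles -/

namespace Link

variable {k ℓ m : ℕ} {V : Type} [DecidableEq V]

/-- The new edges of the first `t` windows. -/
def newChainEdges (A : Link k ℓ m) (f : ℕ → V) (t : ℕ) : Finset (Finset V) :=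
  (Finset.range t ×ˢ A.newEdges).image fun p => p.2.image fun i => f ((m - ℓ) * p.1 + i.1)

theorem mem_newEdges (A : Link k ℓ m) {e : Finset (Fin m)} :
    e ∈ A.newEdges ↔ e ∈ A.graph.edges ∧ ∃ x ∈ e, ℓ ≤ x.1 := by
  simp [newEdges]

theorem mem_newChainEdges (A : Link k ℓ m) {f : ℕ → V} {t : ℕ} {s : Finset V} :
    s ∈ A.newChainEdges f t ↔ ∃ q < t, ∃ e ∈ A.newEdges,
      (e.image fun i => f ((m - ℓ) * q + i.1)) = s := by
  simp only [newChainEdges, Finset.mem_image, Finset.mem_product, Finset.mem_range, Prod.exists]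
  constructor
  · rintro ⟨q, e, ⟨hq, he⟩, rfl⟩
    exact ⟨q, hq, e, he, rfl⟩
  · rintro ⟨q, hq, e, he, rfl⟩
    exact ⟨q, e, ⟨hq, he⟩, rfl⟩

theorem newChainEdges_subset (A : Link k ℓ m) (f : ℕ → V) (t : ℕ) :
    A.newChainEdges f t ⊆ A.chainEdges f t := by
  intro s hs
  obtain ⟨q, hq, e, he, rfl⟩ := A.mem_newChainEdges.mp hs
  exact A.mem_chainEdges.mpr ⟨q, hq, e, (A.mem_newEdges.mp he).1, rfl⟩

/-- Different pairs of a window and a new edge give different edges. Injectivity is required only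
modulo `(m - ℓ) * T`, so that the count serves both chains and closed cycles. -/
theorem card_newChainEdges (A : Link k ℓ m) (hlm : ℓ < m) {f : ℕ → V} {t T : ℕ}
    (hT : 2 * m ≤ (m - ℓ) * T) (htT : t ≤ T)
    (hf : ∀ a < (m - ℓ) * t + ℓ, ∀ b < (m - ℓ) * t + ℓ, f a = f b → a ≡ b [MOD (m - ℓ) * T]) :
    (A.newChainEdges f t).card = t * A.newEdges.card := by
  rw [newChainEdges, Finset.card_image_of_injOn, Finset.card_product, Finset.card_range]
  rintro ⟨q, e⟩ hqe ⟨q', e'⟩ hqe' heq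
  simp only [Finset.coe_product, Set.mem_prod, Finset.mem_coe, Finset.mem_range] at hqe hqe'
  obtain ⟨he, x₀, hx₀, hlx₀⟩ := A.mem_newEdges.mp hqe.2
  obtain ⟨he', x₁, hx₁, hlx₁⟩ := A.mem_newEdges.mp hqe'.2
  simp only at heq
  have := new_window_eq hlm hT (hqe.1.trans_le htT) (hqe'.1.trans_le htT) hx₀ hlx₀ hx₁ hlx₁
    (fun x hx => by
      have h1 : f ((m - ℓ) * q + x.1) ∈ e'.image fun i => f ((m - ℓ) * q' + i.1) := by
        rw [← heq]
        exact Finset.mem_image_of_mem (fun i : Fin m => f ((m - ℓ) * q + i.1)) hx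
      obtain ⟨y, hy, hyx⟩ := Finset.mem_image.mp h1
      exact ⟨y, hy, hf _ (A.window_lt hqe.1 x) _ (A.window_lt hqe'.1 y) hyx.symm⟩)
    (fun y hy => by
      have h1 : f ((m - ℓ) * q' + y.1) ∈ e.image fun i => f ((m - ℓ) * q + i.1) := by
        rw [heq]
        exact Finset.mem_image_of_mem (fun i : Fin m => f ((m - ℓ) * q' + i.1)) hy
      obtain ⟨x, hx, hyx⟩ := Finset.mem_image.mp h1
      exact ⟨x, hx, hf _ (A.window_lt hqe.1 x) _ (A.window_lt hqe'.1 y) hyx⟩)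
  rw [Prod.mk.injEq]
  exact this

/-- Moving an old edge back window by window ends either at a new edge or, in window `0`, at an edge
of the start. -/
theorem chainEdges_eq (A : Link k ℓ m) (f : ℕ → V) {t : ℕ} (ht : 1 ≤ t) :
    A.chainEdges f t = A.newChainEdges f t ∪ A.startEdges f := by
  apply Finset.Subset.antisymm
  · intro s hs
    obtain ⟨q, hq, e, he, rfl⟩ := A.mem_chainEdges.mp hs
    clear hs
    rw [Finset.mem_union]
    induction q generalizing e with
    | zero =>
      by_cases hnew : e ∈ A.newEdges
      · exact Or.inl (A.mem_newChainEdges.mpr ⟨0, hq, e, hnew, rfl⟩)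
      · right
        have hlt : ∀ x ∈ e, x.1 < ℓ := by
          intro x hx
          by_contra hlx
          exact hnew (A.mem_newEdges.mpr ⟨he, x, hx, by omega⟩)
        obtain ⟨e', he'⟩ := exists_image_val (N := ℓ) (s := e.image Fin.val) (by
          intro x hx
          obtain ⟨i, hi, rfl⟩ := Finset.mem_image.mp hx
          exact hlt i hi)
        refine Finset.mem_image.mpr ⟨e', ?_, ?_⟩
        · rw [mem_start_edges, ← image_val_mem_natEdges]
          have : (e'.map (interval 0 ℓ m (by have := A.le; omega))).image Fin.val =
              e'.image Fin.val := by
            rw [Finset.map_eq_image, Finset.image_image]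
            exact Finset.image_congr fun i _ => by simp [interval_val]
          rw [this, he', image_val_mem_natEdges]
          exact he
        · have h1 : (e'.image fun i => f i.1) = (e'.image Fin.val).image f := by
            rw [Finset.image_image]; rfl
          rw [h1, he', Finset.image_image]
          exact Finset.image_congr fun i _ => by simp
    | succ q ih =>
      by_cases hnew : e ∈ A.newEdges
      · exact Or.inl (A.mem_newChainEdges.mpr ⟨q + 1, hq, e, hnew, rfl⟩)
      · have hlt : ∀ x ∈ e, x.1 < ℓ := by
          intro x hx
          by_contra hlx
          exact hnew (A.mem_newEdges.mpr ⟨he, x, hx, by omega⟩)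
        obtain ⟨e', he', h, _⟩ := A.start_edge_pred f he hlt q
        rw [← h]
        exact ih (by omega) e' he'
  · exact Finset.union_subset (A.newChainEdges_subset f t) (A.startEdges_subset f ht)

theorem card_startEdges (A : Link k ℓ m) {f : ℕ → V} (hf : Set.InjOn f (Set.Iio ℓ)) :
    (A.startEdges f).card = A.start.edges.card := by
  rw [startEdges, Finset.card_image_of_injective]
  apply Finset.image_injective
  intro i j hij
  exact Fin.ext (hf i.2 j.2 hij)

theorem card_chainEdges (A : Link k ℓ m) (hlm : ℓ < m) {f : ℕ → V} {t : ℕ} (ht : 1 ≤ t)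
    (hf : Set.InjOn f (Set.Iio ((m - ℓ) * t + ℓ))) :
    (A.chainEdges f t).card = t * A.newEdges.card + A.start.edges.card := by
  have hw : 1 ≤ m - ℓ := by omega
  -- The modulus is auxiliary: an injective sequence meets the congruence condition for every `T`,
  -- and `t + 2 * m` is large enough.
  rw [A.chainEdges_eq f ht, Finset.card_union_of_disjoint,
    A.card_newChainEdges hlm (T := t + 2 * m), A.card_startEdges]
  · exact hf.mono (Set.Iio_subset_Iio (by omega))
  · nlinarith
  · omega
  · intro a ha b hb hab
    rw [hf ha hb hab]
  · rw [Finset.disjoint_left]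
    intro s hs hs'
    obtain ⟨q, hq, e, he, rfl⟩ := A.mem_newChainEdges.mp hs
    obtain ⟨e', _, heq⟩ := Finset.mem_image.mp hs'
    obtain ⟨he, x₀, hx₀, hlx₀⟩ := A.mem_newEdges.mp he
    have h1 : f ((m - ℓ) * q + x₀.1) ∈ e'.image fun i => f i.1 := by
      rw [heq]
      exact Finset.mem_image_of_mem (fun i : Fin m => f ((m - ℓ) * q + i.1)) hx₀
    obtain ⟨i, _, hi⟩ := Finset.mem_image.mp h1
    have h2 := hf (show i.1 < _ by have := i.2; omega) (A.window_lt hq x₀) hi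
    have := i.2
    omega

omit [DecidableEq V] in
theorem modEq_of_periodic {f : ℕ → V} {N : ℕ} (hN : ℓ ≤ N)
    (hf : Set.InjOn f (Set.Iio N)) (hper : ∀ i < ℓ, f (N + i) = f i) :
    ∀ a < N + ℓ, ∀ b < N + ℓ, f a = f b → a ≡ b [MOD N] := by
  have hmod : ∀ a < N + ℓ, f a = f (a % N) := by
    intro a ha
    by_cases haN : a < N
    · rw [Nat.mod_eq_of_lt haN]
    · obtain ⟨i, rfl⟩ := Nat.exists_eq_add_of_le (not_lt.mp haN)
      rw [hper i (by omega), Nat.add_mod_left, Nat.mod_eq_of_lt (by omega)]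
  intro a ha b hb hab
  have hpos : 0 < N := by omega
  rw [hmod a ha, hmod b hb] at hab
  exact hf (Nat.mod_lt _ hpos) (Nat.mod_lt _ hpos) hab

omit [DecidableEq V] in
theorem eq_of_modEq_of_periodic {f : ℕ → V} {N : ℕ} (hN : ℓ ≤ N)
    (hper : ∀ i < ℓ, f (N + i) = f i) {a b : ℕ} (ha : a < N + ℓ) (hb : b < N + ℓ)
    (hab : a ≡ b [MOD N]) : f a = f b := by
  have hmod : ∀ a < N + ℓ, f a = f (a % N) := by
    intro a ha
    by_cases haN : a < N
    · rw [Nat.mod_eq_of_lt haN]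
    · obtain ⟨i, rfl⟩ := Nat.exists_eq_add_of_le (not_lt.mp haN)
      rw [hper i (by omega), Nat.add_mod_left, Nat.mod_eq_of_lt (by omega)]
  rw [hmod a ha, hmod b hb, hab]

/-- In a closed sequence an old edge of window `0` is, by periodicity, an edge of the last window,
so backward steps are always possible. Each raises all positions, so at most `ℓ` of them lead to a
new edge; no separate contribution of the start remains. -/
theorem chainEdges_eq_of_periodic (A : Link k ℓ m) (hlm : ℓ < m) (hk : 0 < k) {f : ℕ → V}
    {T : ℕ} (hT : 1 ≤ T) (hper : ∀ i < ℓ, f ((m - ℓ) * T + i) = f i) :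
    A.chainEdges f T = A.newChainEdges f T := by
  refine Finset.Subset.antisymm ?_ (A.newChainEdges_subset f T)
  have key : ∀ j q, q < T → ∀ e ∈ A.graph.edges, (∃ x ∈ e, ℓ ≤ j + x.1) →
      (e.image fun i => f ((m - ℓ) * q + i.1)) ∈ A.newChainEdges f T := by
    intro j
    induction j with
    | zero =>
      rintro q hq e he ⟨x, hx, hlx⟩
      exact A.mem_newChainEdges.mpr
        ⟨q, hq, e, A.mem_newEdges.mpr ⟨he, x, hx, by omega⟩, rfl⟩
    | succ j ih =>
      rintro q hq e he ⟨x, hx, hlx⟩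
      by_cases hnew : e ∈ A.newEdges
      · exact A.mem_newChainEdges.mpr ⟨q, hq, e, hnew, rfl⟩
      · have hlt : ∀ x ∈ e, x.1 < ℓ := by
          intro x hx
          by_contra hlx
          exact hnew (A.mem_newEdges.mpr ⟨he, x, hx, by omega⟩)
        rcases q with _ | q
        · obtain ⟨u, rfl⟩ := Nat.exists_eq_add_of_le' hT
          obtain ⟨e', he', h, hsh⟩ := A.start_edge_pred f he hlt u
          obtain ⟨x', hx', hxx'⟩ := hsh x hx
          have h0 : (e.image fun i => f ((m - ℓ) * 0 + i.1)) =
              e.image fun i => f ((m - ℓ) * (u + 1) + i.1) :=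
            Finset.image_congr fun i hi => by
              simp only [Nat.mul_zero, Nat.zero_add]
              exact (hper i.1 (hlt i hi)).symm
          rw [h0, ← h]
          exact ih u (by omega) e' he' ⟨x', hx', by omega⟩
        · obtain ⟨e', he', h, hsh⟩ := A.start_edge_pred f he hlt q
          obtain ⟨x', hx', hxx'⟩ := hsh x hx
          rw [← h]
          exact ih q (by omega) e' he' ⟨x', hx', by omega⟩
  intro s hs
  obtain ⟨q, hq, e, he, rfl⟩ := A.mem_chainEdges.mp hs
  have hpos : 0 < e.card := by rw [A.graph.uniform e he]; exact hk
  obtain ⟨x, hx⟩ := Finset.card_pos.mp hpos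
  exact key ℓ q hq e he ⟨x, hx, by omega⟩

/-- The ordered hypergraph underlying every `A`-chain of length `t`. -/
def chainGraph (A : Link k ℓ m) (t : ℕ) : UniformHypergraph k (Fin ((m - ℓ) * t + ℓ)) where
  edges := Finset.univ.filter fun e => ∃ q < t, ∃ e₀ ∈ A.graph.edges,
    e.image Fin.val = e₀.image fun i => (m - ℓ) * q + i.1
  uniform := by
    intro e he
    obtain ⟨q, _, e₀, he₀, h⟩ := (Finset.mem_filter.mp he).2
    rw [← A.graph.uniform e₀ he₀, ← Finset.card_image_of_injective e Fin.val_injective, h,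
      Finset.card_image_of_injective]
    intro i j hij
    exact Fin.ext (by simpa using hij)

theorem isChain_chainGraph (A : Link k ℓ m) {t : ℕ} (ht : 1 ≤ t) :
    A.IsChain t (A.chainGraph t) := by
  refine ⟨ht, fun q => ?_, fun e he => ?_⟩
  · ext e
    have himg : (e.map (interval ((m - ℓ) * q.1) m _ (A.chain_bound q))).image Fin.val =
        e.image fun i => (m - ℓ) * q.1 + i.1 := by
      rw [Finset.map_eq_image, Finset.image_image]
      exact Finset.image_congr fun i _ => by simp [interval_val]
    simp only [UniformHypergraph.comap, chainGraph, Finset.mem_filter, Finset.mem_univ, true_and,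
      himg]
    constructor
    · rintro ⟨q', _, e₀, he₀, h⟩
      exact (A.mem_edges_of_shift_eq h).mpr he₀
    · exact fun he => ⟨q.1, q.2, e, he, rfl⟩
  · obtain ⟨q, hq, e₀, he₀, h⟩ := (Finset.mem_filter.mp he).2
    refine ⟨⟨q, hq⟩, fun x hx => ?_⟩
    have : x.1 ∈ e₀.image fun i => (m - ℓ) * q + i.1 := by
      rw [← h]
      exact Finset.mem_image_of_mem _ hx
    obtain ⟨i, _, hi⟩ := Finset.mem_image.mp this
    have := i.2
    simp only
    omega

theorem image_chainGraph (A : Link k ℓ m) (f : ℕ → V) (t : ℕ) :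
    (A.chainGraph t).edges.image (Finset.image fun i => f i.1) = A.chainEdges f t := by
  ext s
  rw [mem_chainEdges, Finset.mem_image]
  have hval : ∀ e : Finset (Fin ((m - ℓ) * t + ℓ)),
      (e.image fun i => f i.1) = (e.image Fin.val).image f := by
    intro e
    rw [Finset.image_image]; rfl
  have hval' : ∀ (q : ℕ) (e : Finset (Fin m)),
      (e.image fun i => f ((m - ℓ) * q + i.1)) =
      (e.image fun i => (m - ℓ) * q + i.1).image f := by
    intro q e
    rw [Finset.image_image]; rfl
  constructor
  · rintro ⟨e, he, rfl⟩
    obtain ⟨q, hq, e₀, he₀, h⟩ := (Finset.mem_filter.mp he).2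
    exact ⟨q, hq, e₀, he₀, by rw [hval, h, hval']⟩
  · rintro ⟨q, hq, e₀, he₀, rfl⟩
    obtain ⟨e, he⟩ := exists_image_val (N := (m - ℓ) * t + ℓ)
      (s := e₀.image fun i => (m - ℓ) * q + i.1) (by
        intro x hx
        obtain ⟨i, _, rfl⟩ := Finset.mem_image.mp hx
        exact A.window_lt hq i)
    exact ⟨e, Finset.mem_filter.mpr ⟨Finset.mem_univ _, q, hq, e₀, he₀, he⟩,
      by rw [hval, he, hval']⟩

/-- Only an inclusion is needed: a chain induces `A` on every window, so it contains all edges the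
windows prescribe. -/
theorem chainEdges_eq_image (A : Link k ℓ m) {t : ℕ}
    {P : UniformHypergraph k (Fin ((m - ℓ) * t + ℓ))} (hP : A.IsChain t P) (f : ℕ → V) :
    A.chainEdges f t ⊆ P.edges.image (Finset.image fun i => f i.1) := by
  intro s hs
  obtain ⟨q, hq, e, he, rfl⟩ := A.mem_chainEdges.mp hs
  have h := hP.2.1 ⟨q, hq⟩
  rw [← h] at he
  refine Finset.mem_image.mpr ⟨_, (Finset.mem_filter.mp he).2, ?_⟩
  rw [Finset.map_eq_image, Finset.image_image]
  exact Finset.image_congr fun i _ => by simp [interval_val]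

/-- Cycles are built as sequences that repeat their first `ℓ` values after `(m - ℓ) * T` steps.
Spanning follows from injectivity and `hcard`; the bound `2 * m ≤ (m - ℓ) * T` makes the windows
injective and the edge count exact. -/
theorem exists_isCycle [Fintype V] (A : Link k ℓ m) (hlm : ℓ < m) (hk : 0 < k) {f : ℕ → V}
    {T : ℕ} (hT : 2 * m ≤ (m - ℓ) * T) (hcard : Fintype.card V = (m - ℓ) * T)
    (hf : Set.InjOn f (Set.Iio ((m - ℓ) * T)))
    (hper : ∀ i < ℓ, f ((m - ℓ) * T + i) = f i) :
    ∃ F : UniformHypergraph k V, A.IsCycle F ∧ F.edges = A.chainEdges f T ∧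
      F.edges.card = T * A.newEdges.card := by
  have hT1 : 1 ≤ T := by
    rcases T with _ | T
    · simp at hT; omega
    · omega
  have hℓ : ℓ ≤ (m - ℓ) * T := by omega
  have hmod := modEq_of_periodic hℓ hf hper
  refine ⟨⟨A.chainEdges f T, ?_⟩, ⟨T, A.chainGraph T, fun i => f i.1,
    A.isChain_chainGraph hT1, ?_, ?_, ?_⟩, rfl, ?_⟩
  · intro s hs
    obtain ⟨q, hq, e, he, rfl⟩ := A.mem_chainEdges.mp hs
    rw [Finset.card_image_of_injOn, A.graph.uniform e he]
    intro i _ j _ hij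
    have h := hmod _ (A.window_lt hq i) _ (A.window_lt hq j) hij
    have h2 := Nat.ModEq.add_left_cancel' _ h
    have := i.2; have := j.2
    rw [Nat.ModEq, Nat.mod_eq_of_lt (by omega), Nat.mod_eq_of_lt (by omega)] at h2
    exact Fin.ext h2
  · have hsurj : Function.Surjective fun i : Fin ((m - ℓ) * T) => f i.1 := by
      have hinj : Function.Injective fun i : Fin ((m - ℓ) * T) => f i.1 :=
        fun i j hij => Fin.ext (hf i.2 j.2 hij)
      exact ((Fintype.bijective_iff_injective_and_card _).mpr ⟨hinj, by simp [hcard]⟩).2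
    intro v
    obtain ⟨i, hi⟩ := hsurj v
    exact ⟨⟨i.1, by have := i.2; omega⟩, hi⟩
  · intro x y
    exact ⟨fun h => hmod _ x.2 _ y.2 h, fun h => eq_of_modEq_of_periodic hℓ hper x.2 y.2 h⟩
  · exact (A.image_chainGraph f T).symm
  · show (A.chainEdges f T).card = _
    rw [A.chainEdges_eq_of_periodic hlm hk hT1 hper,
      A.card_newChainEdges hlm hT le_rfl hmod]

/-- A given cycle serves only as a supply of long chains, so its unwound sequence is all that is
kept. -/
theorem exists_of_isCycle [Fintype V] (A : Link k ℓ m) (hlm : ℓ < m)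
    {F : UniformHypergraph k V} (hF : A.IsCycle F) :
    ∃ (f : ℕ → V) (T : ℕ), 1 ≤ T ∧ Fintype.card V = (m - ℓ) * T ∧
      Set.InjOn f (Set.Iio ((m - ℓ) * T)) ∧ A.chainEdges f T ⊆ F.edges := by
  obtain ⟨T, P, σ, hP, hsurj, hσ, hE⟩ := hF
  have hT1 := hP.1
  have hpos : 0 < (m - ℓ) * T := Nat.mul_pos (by omega) hT1
  let v : V := σ ⟨0, by omega⟩
  let f : ℕ → V := fun i => if h : i < (m - ℓ) * T + ℓ then σ ⟨i, h⟩ else v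
  have hfσ : ∀ i : Fin ((m - ℓ) * T + ℓ), f i.1 = σ i := fun i => dif_pos i.2
  have hinj : Set.InjOn f (Set.Iio ((m - ℓ) * T)) := by
    intro i hi j hj hij
    rw [Set.mem_Iio] at hi hj
    have h1 := hfσ ⟨i, by omega⟩
    have h2 := hfσ ⟨j, by omega⟩
    simp only at h1 h2
    rw [h1, h2, hσ, Nat.ModEq, Nat.mod_eq_of_lt hi, Nat.mod_eq_of_lt hj] at hij
    exact hij
  refine ⟨f, T, hT1, ?_, hinj, ?_⟩
  · have hbij : Function.Bijective fun i : Fin ((m - ℓ) * T) => f i.1 := by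
      refine ⟨fun i j hij => Fin.ext (hinj i.2 j.2 hij), fun u => ?_⟩
      obtain ⟨x, rfl⟩ := hsurj u
      refine ⟨⟨x.1 % ((m - ℓ) * T), Nat.mod_lt _ hpos⟩, ?_⟩
      have h1 := hfσ ⟨x.1 % ((m - ℓ) * T), by have := Nat.mod_lt x.1 hpos; omega⟩
      simp only at h1 ⊢
      rw [h1, hσ]
      exact Nat.mod_modEq _ _
    rw [← Fintype.card_of_bijective hbij, Fintype.card_fin]
  · rw [hE]
    refine (A.chainEdges_eq_image hP f).trans ?_
    simp only [hfσ]
    rfl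

theorem exists_of_isChainEmbedding [Fintype V] (A : Link k ℓ m) (hlm : ℓ < m)
    {H : UniformHypergraph k V}
    {t : ℕ} {f : Fin ((m - ℓ) * t + ℓ) ↪ V} {a b : Fin ℓ → V}
    (h : A.IsChainEmbedding H t f a b) :
    1 ≤ t ∧ ∃ g : ℕ → V, Set.InjOn g (Set.Iio ((m - ℓ) * t + ℓ)) ∧ A.chainEdges g t ⊆ H.edges ∧
      A.chainVerts g t = Finset.univ.map f ∧ (∀ i : Fin ℓ, g i.1 = a i) ∧
      (∀ i : Fin ℓ, g ((m - ℓ) * t + i.1) = b i) := by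
  obtain ⟨P, hP, hPH, ha, hb⟩ := h
  have hpos : 0 < (m - ℓ) * t := Nat.mul_pos (by omega) hP.1
  let g : ℕ → V := fun i => if h : i < (m - ℓ) * t + ℓ then f ⟨i, h⟩ else f ⟨0, by omega⟩
  have hgf : ∀ i : Fin ((m - ℓ) * t + ℓ), g i.1 = f i := fun i => dif_pos i.2
  refine ⟨hP.1, g, ?_, ?_, ?_, ?_, ?_⟩
  · intro i hi j hj hij
    have h1 := hgf ⟨i, hi⟩
    have h2 := hgf ⟨j, hj⟩
    simp only at h1 h2
    rw [h1, h2] at hij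
    exact congrArg Fin.val (f.injective hij)
  · refine (A.chainEdges_eq_image hP g).trans ?_
    intro s hs
    obtain ⟨e, he, rfl⟩ := Finset.mem_image.mp hs
    have := hPH e he
    rw [Finset.map_eq_image] at this
    simpa only [hgf] using this
  · ext v
    rw [mem_chainVerts, Finset.mem_map]
    constructor
    · rintro ⟨i, hi, rfl⟩
      exact ⟨⟨i, hi⟩, Finset.mem_univ _, (hgf ⟨i, hi⟩).symm⟩
    · rintro ⟨i, _, rfl⟩
      exact ⟨i.1, i.2, hgf i⟩
  · intro i
    rw [← ha i, ← hgf]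
    simp [interval_val]
  · intro i
    rw [← hb i, ← hgf]
    simp [interval_val]

end Link

/-! ### Concentration for random samples -/

section sampling

open Finset

/-- Permutations act transitively on embeddings, so a uniformly random permutation turns any fixed
embedding into a uniformly random one. -/
theorem exists_perm_trans {κ ι : Type} [Fintype κ] [Fintype ι] [DecidableEq ι] (j j' : κ ↪ ι) :
    ∃ τ : Equiv.Perm ι, j.trans τ.toEmbedding = j' := by
  classical
  let e : {x // x ∈ Set.range j} ≃ {x // x ∈ Set.range j'} :=
    (Equiv.ofInjective j j.injective).symm.trans (Equiv.ofInjective j' j'.injective)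
  refine ⟨e.extendSubtype, ?_⟩
  ext x
  have h := e.extendSubtype_apply_of_mem (j x) ⟨x, rfl⟩
  simp only [Function.Embedding.trans_apply, Equiv.coe_toEmbedding, h, e, Equiv.trans_apply]
  have h2 : (⟨j x, ⟨x, rfl⟩⟩ : {x // x ∈ Set.range j}) = Equiv.ofInjective j j.injective x := rfl
  rw [h2, Equiv.symm_apply_apply]
  rfl

/-- Averaging a function of an embedding over all permutations of the target. -/
theorem sum_perm_trans {κ ι : Type} [Fintype κ] [Fintype ι] [DecidableEq κ] [DecidableEq ι]
    (φ : (κ ↪ ι) → ℝ) (j₀ : κ ↪ ι) :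
    (∑ σ : Equiv.Perm ι, φ (j₀.trans σ.toEmbedding)) * Fintype.card (κ ↪ ι) =
      Fintype.card (Equiv.Perm ι) * ∑ j, φ j := by
  have h1 : ∀ j : κ ↪ ι, ∑ σ : Equiv.Perm ι, φ (j.trans σ.toEmbedding) =
      ∑ σ : Equiv.Perm ι, φ (j₀.trans σ.toEmbedding) := by
    intro j
    obtain ⟨τ, rfl⟩ := exists_perm_trans j₀ j
    refine Fintype.sum_equiv (Equiv.mulRight τ) _ _ fun σ => ?_
    congr 1
  have h2 : ∑ j : κ ↪ ι, ∑ σ : Equiv.Perm ι, φ (j.trans σ.toEmbedding) =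
      Fintype.card (κ ↪ ι) * ∑ σ : Equiv.Perm ι, φ (j₀.trans σ.toEmbedding) := by
    rw [Finset.sum_congr rfl fun j _ => h1 j, sum_const, card_univ, nsmul_eq_mul]
  have h3 : ∀ σ : Equiv.Perm ι, ∑ j : κ ↪ ι, φ (j.trans σ.toEmbedding) = ∑ j, φ j := by
    intro σ
    refine Fintype.sum_equiv
      ⟨fun j => j.trans σ.toEmbedding, fun j => j.trans σ.symm.toEmbedding, ?_, ?_⟩ _ _ ?_
    · intro j; ext; simp
    · intro j; ext; simp
    · intro j; rfl
  rw [sum_comm, Finset.sum_congr rfl fun σ _ => h3 σ, sum_const, card_univ, nsmul_eq_mul] at h2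
  rw [h2, mul_comm]

/-- Summing a function of the restriction to some coordinates over all assignments. -/
theorem sum_comp_embedding {κ ι Ω : Type} [Fintype κ] [Fintype ι] [Fintype Ω] [DecidableEq κ]
    [DecidableEq ι] (B : κ ↪ ι) (G : (κ → Ω) → ℝ) :
    (∑ x : ι → Ω, G (x ∘ B)) * (Fintype.card Ω : ℝ) ^ Fintype.card κ =
      (Fintype.card Ω : ℝ) ^ Fintype.card ι * ∑ z : κ → Ω, G z := by
  classical
  let C : Type := {x // x ∈ (Set.range B)ᶜ}
  let e : κ ⊕ C ≃ ι :=
    ((Equiv.ofInjective B B.injective).sumCongr (Equiv.refl _)).trans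
      (Equiv.Set.sumCompl (Set.range B))
  have hcard : Fintype.card κ + Fintype.card C = Fintype.card ι := by
    rw [← Fintype.card_sum, Fintype.card_congr e]
  let E : (ι → Ω) ≃ (κ → Ω) × (C → Ω) :=
    (Equiv.arrowCongr e.symm (Equiv.refl Ω)).trans (Equiv.sumArrowEquivProdArrow κ C Ω)
  have h1 : ∑ x : ι → Ω, G (x ∘ B) = ∑ p : (κ → Ω) × (C → Ω), G p.1 :=
    Fintype.sum_equiv E _ _ fun x => rfl
  rw [h1, Fintype.sum_prod_type, ← hcard, pow_add]
  simp only [sum_const, card_univ, Fintype.card_fun, nsmul_eq_mul]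
  rw [← Finset.mul_sum]
  push_cast
  ring

theorem sum_pi_prod {κ Ω : Type} [Fintype κ] [DecidableEq κ] [Fintype Ω] (h : κ → Ω → ℝ) :
    ∑ x : κ → Ω, ∏ a, h a (x a) = ∏ a, ∑ ω, h a ω := by
  classical
  rw [Finset.prod_univ_sum, Fintype.piFinset_univ]

/-- The product `(1 - ε + ε²/2)(1 + ε + ε²/2)` equals `1 + ε⁴/4`. -/
theorem exp_neg_le_quadratic {ε : ℝ} (hε : 0 ≤ ε) : Real.exp (-ε) ≤ 1 - ε + ε ^ 2 / 2 := by
  have h := Real.quadratic_le_exp_of_nonneg hε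
  rw [Real.exp_neg, inv_le_iff_one_le_mul₀ (Real.exp_pos _)]
  have h2 : 0 ≤ 1 - ε + ε ^ 2 / 2 := by nlinarith [sq_nonneg (ε - 1)]
  calc (1 : ℝ) ≤ (1 - ε + ε ^ 2 / 2) * (1 + ε + ε ^ 2 / 2) := by nlinarith [sq_nonneg (ε ^ 2)]
    _ ≤ _ := mul_le_mul_of_nonneg_left h h2

theorem sum_exp_indicator {Y : Type} [Fintype Y] (Q : Y → Prop) [DecidablePred Q] (μ : ℝ) :
    ∑ y, Real.exp (-μ * if Q y then 1 else 0) =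
      Fintype.card Y - (univ.filter Q).card * (1 - Real.exp (-μ)) := by
  have h : ∀ y, Real.exp (-μ * if Q y then 1 else 0) =
      1 - (if Q y then 1 else 0) * (1 - Real.exp (-μ)) := by
    intro y
    split_ifs <;> simp
  rw [Finset.sum_congr rfl fun y _ => h y, sum_sub_distrib, ← Finset.sum_mul, sum_boole]
  simp

/-- Concentration of a `U`-statistic with a `0`-`1` valued kernel, for sampling with
replacement. -/
theorem card_ustatistic_le {ι Ω : Type} [Fintype ι] [DecidableEq ι] [Fintype Ω] [Nonempty Ω]
    {K b : ℕ} (B : Fin b × Fin K ↪ ι) (Q : (Fin K → Ω) → Prop) [DecidablePred Q]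
    {ε p : ℝ} (hε : 0 ≤ ε)
    (hp : ((univ.filter Q).card : ℝ) = p * (Fintype.card Ω : ℝ) ^ K) :
    ((univ.filter fun x : ι → Ω => ((univ.filter fun j : Fin K ↪ ι => Q (x ∘ j)).card : ℝ) ≤
      (p - ε) * Fintype.card (Fin K ↪ ι)).card : ℝ) ≤
      (Fintype.card Ω : ℝ) ^ Fintype.card ι * Real.exp (-(b * ε ^ 2 / 2)) := by
  classical
  set N : ℝ := (Fintype.card Ω : ℝ) with hN
  have hNpos : 0 < N := by rw [hN]; exact_mod_cast Fintype.card_pos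
  set I : ℝ := (Fintype.card (Fin K ↪ ι) : ℝ) with hI
  set U : (ι → Ω) → ℝ := fun x => ((univ.filter fun j : Fin K ↪ ι => Q (x ∘ j)).card : ℝ) with hU
  let B' : Fin b → (Fin K ↪ ι) := fun a =>
    ⟨fun i => B (a, i), fun i i' h => by simpa using B.injective h⟩
  -- Hoeffding's device: the statistic over overlapping tuples is an average over permutations, and
  -- for each fixed permutation the `b` blocks are disjoint, so `W σ` is a sum of independent
  -- indicators.
  let W : Equiv.Perm ι → (ι → Ω) → ℝ := fun σ x =>
    ∑ a : Fin b, if Q (x ∘ ((B' a).trans σ.toEmbedding)) then 1 else 0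
  set S : ℝ := (Fintype.card (Equiv.Perm ι) : ℝ) with hS
  have hSpos : 0 < S := by rw [hS]; exact_mod_cast Fintype.card_pos
  have hp1 : p ≤ 1 := by
    have h1 : ((univ.filter Q).card : ℝ) ≤ N ^ K := by
      have : (univ.filter Q).card ≤ Fintype.card (Fin K → Ω) := Finset.card_le_univ _
      rw [Fintype.card_fun, Fintype.card_fin] at this
      rw [hN]; exact_mod_cast this
    rw [hp] at h1
    have : 0 < N ^ K := by positivity
    exact le_of_mul_le_mul_right (by linarith) this
  have hp0 : 0 ≤ p := by
    have : 0 < N ^ K := by positivity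
    exact nonneg_of_mul_nonneg_left (by rw [← hp]; positivity) this
  have havg : ∀ x, (∑ σ, W σ x) * I = S * (b * U x) := by
    intro x
    rw [Finset.sum_comm, Finset.sum_mul]
    have h1 : ∀ a : Fin b, (∑ σ : Equiv.Perm ι,
        if Q (x ∘ ((B' a).trans σ.toEmbedding)) then (1 : ℝ) else 0) * I = S * U x := by
      intro a
      have := sum_perm_trans (fun j : Fin K ↪ ι => if Q (x ∘ j) then (1 : ℝ) else 0) (B' a)
      rw [this, sum_boole]
    rw [Finset.sum_congr rfl fun a _ => h1 a]
    simp
    ring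
  have hsum : ∀ σ : Equiv.Perm ι, ∑ x, Real.exp (-ε * W σ x) ≤
      N ^ Fintype.card ι * Real.exp (-(b * (p * (1 - Real.exp (-ε))))) := by
    intro σ
    let G : (Fin b × Fin K → Ω) → ℝ := fun z =>
      ∏ a : Fin b, Real.exp (-ε * if Q (fun i => z (a, i)) then 1 else 0)
    have h1 : ∀ x : ι → Ω, Real.exp (-ε * W σ x) = G (x ∘ (B.trans σ.toEmbedding)) := by
      intro x
      simp only [W, Finset.mul_sum, Real.exp_sum]
      rfl
    have h2 : ∑ z, G z = (N ^ K * (1 - p * (1 - Real.exp (-ε)))) ^ b := by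
      have h3 : ∑ z, G z = ∑ y : Fin b → (Fin K → Ω),
          ∏ a, Real.exp (-ε * if Q (y a) then 1 else 0) :=
        Fintype.sum_equiv (Equiv.curry _ _ _) _ _ fun z => rfl
      rw [h3, sum_pi_prod (fun _ y => Real.exp (-ε * if Q y then 1 else 0))]
      simp only [prod_const, card_univ, Fintype.card_fin]
      rw [sum_exp_indicator, hp, Fintype.card_fun, Fintype.card_fin]
      push_cast
      rw [← hN]
      congr 1
      ring
    have h4 := sum_comp_embedding (B.trans σ.toEmbedding) G
    rw [h2, Fintype.card_prod, Fintype.card_fin, Fintype.card_fin, ← hN, mul_pow, ← pow_mul,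
      mul_comm K b] at h4
    have h5 : 0 < N ^ (b * K) := by positivity
    have h6 : ∑ x, Real.exp (-ε * W σ x) =
        N ^ Fintype.card ι * (1 - p * (1 - Real.exp (-ε))) ^ b := by
      simp only [h1]
      apply mul_right_cancel₀ h5.ne'
      rw [h4]
      ring
    rw [h6]
    apply mul_le_mul_of_nonneg_left _ (by positivity)
    have h7 : 0 ≤ 1 - p * (1 - Real.exp (-ε)) := by
      have : Real.exp (-ε) ≤ 1 := Real.exp_le_one_iff.mpr (by linarith)
      nlinarith [Real.exp_pos (-ε)]
    calc (1 - p * (1 - Real.exp (-ε))) ^ b ≤ (Real.exp (-(p * (1 - Real.exp (-ε))))) ^ b :=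
          pow_le_pow_left₀ h7 (Real.one_sub_le_exp_neg _) b
      _ = _ := by rw [← Real.exp_nat_mul]; congr 1; ring
  -- Convexity of `exp` passes from the average over permutations to a single permutation, whose
  -- exponential moment is controlled by independence.
  have hjensen : ∀ x, Real.exp (-ε * (b * (U x / I))) ≤ S⁻¹ * ∑ σ, Real.exp (-ε * W σ x) := by
    intro x
    have h1 := convexOn_exp.map_sum_le (t := (univ : Finset (Equiv.Perm ι))) (w := fun _ => S⁻¹)
      (p := fun σ => -ε * W σ x) (fun _ _ => by positivity)
      (by rw [sum_const, card_univ, nsmul_eq_mul]; exact mul_inv_cancel₀ hSpos.ne')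
      (fun _ _ => Set.mem_univ _)
    simp only [smul_eq_mul] at h1
    rw [← Finset.mul_sum, ← Finset.mul_sum, ← Finset.mul_sum] at h1
    refine le_trans (le_of_eq ?_) h1
    congr 1
    rcases Nat.eq_zero_or_pos b with rfl | hb
    · simp [W]
    · have hIpos : 0 < I := by
        rw [hI]
        have : Nonempty (Fin K ↪ ι) := ⟨B' ⟨0, hb⟩⟩
        exact_mod_cast Fintype.card_pos
      have := havg x
      field_simp
      rw [mul_assoc ε I, mul_comm I, this]
      ring
  have htotal : ∑ x, Real.exp (-ε * (b * (U x / I))) ≤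
      N ^ Fintype.card ι * Real.exp (-(b * (p * (1 - Real.exp (-ε))))) := by
    calc _ ≤ ∑ x, S⁻¹ * ∑ σ, Real.exp (-ε * W σ x) := Finset.sum_le_sum fun x _ => hjensen x
      _ = S⁻¹ * ∑ σ, ∑ x, Real.exp (-ε * W σ x) := by rw [← Finset.mul_sum, Finset.sum_comm]
      _ ≤ S⁻¹ * ∑ σ : Equiv.Perm ι,
          N ^ Fintype.card ι * Real.exp (-(b * (p * (1 - Real.exp (-ε))))) :=
        mul_le_mul_of_nonneg_left (Finset.sum_le_sum fun σ _ => hsum σ) (by positivity)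
      _ = _ := by
        rw [sum_const, card_univ, nsmul_eq_mul, ← hS, ← mul_assoc, inv_mul_cancel₀ hSpos.ne',
          one_mul]
  set bad := univ.filter fun x : ι → Ω => U x ≤ (p - ε) * I with hbad
  have hmarkov : (bad.card : ℝ) * Real.exp (-ε * (b * (p - ε))) ≤
      ∑ x, Real.exp (-ε * (b * (U x / I))) := by
    calc (bad.card : ℝ) * Real.exp (-ε * (b * (p - ε)))
        = ∑ x ∈ bad, Real.exp (-ε * (b * (p - ε))) := by rw [sum_const, nsmul_eq_mul]
      _ ≤ ∑ x ∈ bad, Real.exp (-ε * (b * (U x / I))) := by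
        refine Finset.sum_le_sum fun x hx => Real.exp_le_exp.mpr ?_
        rcases Nat.eq_zero_or_pos b with rfl | hb
        · simp
        · have hIpos : 0 < I := by
            rw [hI]
            have : Nonempty (Fin K ↪ ι) := ⟨B' ⟨0, hb⟩⟩
            exact_mod_cast Fintype.card_pos
          have h1 : U x / I ≤ p - ε := (div_le_iff₀ hIpos).mpr (Finset.mem_filter.mp hx).2
          have h2 : (b : ℝ) * (U x / I) ≤ b * (p - ε) :=
            mul_le_mul_of_nonneg_left h1 (by positivity)
          nlinarith
      _ ≤ _ := Finset.sum_le_sum_of_subset_of_nonneg (Finset.filter_subset _ _)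
        fun x _ _ => (Real.exp_pos _).le
  have hfin := hmarkov.trans htotal
  have hexp : (bad.card : ℝ) ≤ N ^ Fintype.card ι *
      (Real.exp (-(b * (p * (1 - Real.exp (-ε))))) * Real.exp (ε * (b * (p - ε)))) := by
    have h1 : Real.exp (-ε * (b * (p - ε))) * Real.exp (ε * (b * (p - ε))) = 1 := by
      rw [← Real.exp_add]; simp
    calc (bad.card : ℝ) = bad.card * Real.exp (-ε * (b * (p - ε))) *
          Real.exp (ε * (b * (p - ε))) := by rw [mul_assoc, h1, mul_one]
      _ ≤ _ := by
        rw [← mul_assoc (N ^ Fintype.card ι)]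
        exact mul_le_mul_of_nonneg_right hfin (Real.exp_pos _).le
  refine hexp.trans (mul_le_mul_of_nonneg_left ?_ (by positivity))
  rw [← Real.exp_add]
  apply Real.exp_le_exp.mpr
  have hq := exp_neg_le_quadratic hε
  have hb : (0 : ℝ) ≤ b := by positivity
  have h1 : p * (1 - Real.exp (-ε)) ≥ p * (ε - ε ^ 2 / 2) :=
    mul_le_mul_of_nonneg_left (by linarith) hp0
  have h2 : p * (ε ^ 2 / 2) ≤ 1 * (ε ^ 2 / 2) := mul_le_mul_of_nonneg_right hp1 (by positivity)
  -- Since `1 - exp (-ε) ≥ ε - ε²/2` and `p ≤ 1`, half of the gain `ε²` survives.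
  have h3 : ε * (p - ε) - p * (1 - Real.exp (-ε)) ≤ -(ε ^ 2 / 2) := by nlinarith
  nlinarith [mul_le_mul_of_nonneg_left h3 hb]

/-- A lower tail bound for the number of successes in independent trials. -/
theorem card_chernoff_le {κ Ω : Type} [Fintype κ] [DecidableEq κ] [Fintype Ω] [Nonempty Ω]
    (P : κ → Finset Ω) [∀ a, DecidablePred (· ∈ P a)] {μ : ℝ}
    (hμ : μ * Fintype.card Ω ≤ ∑ a, ((P a).card : ℝ)) :
    ((univ.filter fun g : κ → Ω =>
      ((univ.filter fun a => g a ∈ P a).card : ℝ) ≤ μ / 2).card : ℝ) ≤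
      (Fintype.card Ω : ℝ) ^ Fintype.card κ * Real.exp (-(μ / 8)) := by
  classical
  set N : ℝ := (Fintype.card Ω : ℝ) with hN
  have hNpos : 0 < N := by rw [hN]; exact_mod_cast Fintype.card_pos
  set X : (κ → Ω) → ℝ := fun g => ((univ.filter fun a => g a ∈ P a).card : ℝ) with hX
  -- The exponential moment is taken at parameter `1/2`. As `1 - exp (-1/2) ≥ 3/8`, the final
  -- exponent is `-3μ/8 + μ/4 = -μ/8`.
  have hq : Real.exp (-(1 / 2)) ≤ 5 / 8 := by
    have := exp_neg_le_quadratic (ε := 1 / 2) (by norm_num)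
    norm_num at this ⊢
    exact this
  have htotal : ∑ g, Real.exp (-(1 / 2) * X g) ≤ N ^ Fintype.card κ * Real.exp (-(3 / 8 * μ)) := by
    have h1 : ∀ g, Real.exp (-(1 / 2) * X g) =
        ∏ a, Real.exp (-(1 / 2) * if g a ∈ P a then 1 else 0) := by
      intro g
      rw [← Real.exp_sum, ← Finset.mul_sum, sum_boole]
    simp only [h1]
    rw [sum_pi_prod (fun a ω => Real.exp (-(1 / 2) * if ω ∈ P a then 1 else 0))]
    calc ∏ a, ∑ ω, Real.exp (-(1 / 2) * if ω ∈ P a then 1 else 0)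
        ≤ ∏ a, N * Real.exp (-(3 / 8 * ((P a).card / N))) := by
          refine Finset.prod_le_prod (fun a _ => Finset.sum_nonneg fun _ _ => (Real.exp_pos _).le)
            fun a _ => ?_
          rw [sum_exp_indicator]
          have h2 : (univ.filter fun ω => ω ∈ P a) = P a := by ext; simp
          rw [h2]
          have h3 := Real.one_sub_le_exp_neg (3 / 8 * ((P a).card / N))
          have h4 : N * (1 - 3 / 8 * ((P a).card / N)) = N - 3 / 8 * (P a).card := by
            field_simp
          have h5 : (0 : ℝ) ≤ (P a).card := by positivity
          calc N - (P a).card * (1 - Real.exp (-(1 / 2))) ≤ N - 3 / 8 * (P a).card := by nlinarith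
            _ = N * (1 - 3 / 8 * ((P a).card / N)) := h4.symm
            _ ≤ _ := mul_le_mul_of_nonneg_left h3 hNpos.le
      _ = N ^ Fintype.card κ * Real.exp (-(3 / 8 * ((∑ a, ((P a).card : ℝ)) / N))) := by
          rw [Finset.prod_mul_distrib, prod_const, card_univ, ← Real.exp_sum,
            Finset.sum_neg_distrib, ← Finset.mul_sum, ← Finset.sum_div]
      _ ≤ _ := by
          apply mul_le_mul_of_nonneg_left _ (by positivity)
          apply Real.exp_le_exp.mpr
          have : μ ≤ (∑ a, ((P a).card : ℝ)) / N := (le_div_iff₀ hNpos).mpr hμ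
          linarith
  set bad := univ.filter fun g : κ → Ω => X g ≤ μ / 2 with hbad
  have hmarkov : (bad.card : ℝ) * Real.exp (-(μ / 4)) ≤ ∑ g, Real.exp (-(1 / 2) * X g) := by
    calc (bad.card : ℝ) * Real.exp (-(μ / 4)) = ∑ g ∈ bad, Real.exp (-(μ / 4)) := by
          rw [sum_const, nsmul_eq_mul]
      _ ≤ ∑ g ∈ bad, Real.exp (-(1 / 2) * X g) := by
        refine Finset.sum_le_sum fun x hx => Real.exp_le_exp.mpr ?_
        have := (Finset.mem_filter.mp hx).2
        linarith
      _ ≤ _ := Finset.sum_le_sum_of_subset_of_nonneg (Finset.filter_subset _ _)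
        fun x _ _ => (Real.exp_pos _).le
  have hfin := hmarkov.trans htotal
  have h1 : Real.exp (-(μ / 4)) * Real.exp (μ / 4) = 1 := by rw [← Real.exp_add]; simp
  calc (bad.card : ℝ) = bad.card * Real.exp (-(μ / 4)) * Real.exp (μ / 4) := by
        rw [mul_assoc, h1, mul_one]
    _ ≤ N ^ Fintype.card κ * Real.exp (-(3 / 8 * μ)) * Real.exp (μ / 4) :=
      mul_le_mul_of_nonneg_right hfin (Real.exp_pos _).le
    _ = _ := by
      rw [mul_assoc, ← Real.exp_add]
      congr 2
      ring

end sampling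

/-! ### Relative degrees and popular edges -/

namespace UniformHypergraph

open Finset

variable {k : ℕ} {V : Type} [DecidableEq V]

/-- The number of edges consisting of `T` and further vertices from `W`. -/
def relDegree (H : UniformHypergraph k V) (T W : Finset V) : ℕ :=
  (H.edges.filter fun e => T ⊆ e ∧ e \ T ⊆ W).card

/-- Every set of `d` vertices has relative degree at least `x` into `W`. -/
def RichOn (H : UniformHypergraph k V) (d : ℕ) (W : Finset V) (x : ℝ) : Prop :=
  ∀ T : Finset V, T.card = d → x ≤ (H.relDegree T W : ℝ)

theorem relDegree_mono (H : UniformHypergraph k V) (T : Finset V) {W W' : Finset V}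
    (h : W ⊆ W') : H.relDegree T W ≤ H.relDegree T W' :=
  Finset.card_le_card fun e he => by
    rw [Finset.mem_filter] at he ⊢
    exact ⟨he.1, he.2.1, he.2.2.trans h⟩

theorem RichOn.mono {H : UniformHypergraph k V} {d : ℕ} {W W' : Finset V} {x y : ℝ}
    (h : H.RichOn d W x) (hW : W ⊆ W') (hy : y ≤ x) : H.RichOn d W' y := fun T hT =>
  hy.trans ((h T hT).trans (by exact_mod_cast H.relDegree_mono T hW))

theorem RichOn.mono_edges {H H' : UniformHypergraph k V} {d : ℕ} {W : Finset V} {x : ℝ}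
    (h : H.RichOn d W x) (hH : H.edges ⊆ H'.edges) : H'.RichOn d W x := fun T hT =>
  (h T hT).trans (by
    exact_mod_cast Finset.card_le_card (Finset.filter_subset_filter _ hH))

theorem richOn_univ_of_le_minDegree [Fintype V] {H : UniformHypergraph k V} {d : ℕ} {x : ℝ}
    (h : x ≤ H.minDegree d) : H.RichOn d univ x := by
  intro T hT
  refine h.trans ?_
  have h1 : H.minDegree d ≤ H.degree T := Nat.sInf_le ⟨T, hT, rfl⟩
  have h2 : H.degree T = H.relDegree T univ := by
    simp [degree, relDegree]
  rw [← h2]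
  exact_mod_cast h1

theorem degree_comap {W : Type} [Fintype W] [DecidableEq W] (ι : W ↪ V)
    (H : UniformHypergraph k V) (S : Finset W) :
    H.relDegree (S.map ι) (univ.map ι) = (H.comap ι).degree S := by
  symm
  unfold degree relDegree
  refine Finset.card_bij (fun e _ => e.map ι) ?_ ?_ ?_
  · intro e he
    obtain ⟨he, hS⟩ := Finset.mem_filter.mp he
    rw [Finset.mem_filter]
    exact ⟨(Finset.mem_filter.mp he).2, Finset.map_subset_map.mpr hS,
      Finset.sdiff_subset.trans (Finset.map_subset_map.mpr (Finset.subset_univ _))⟩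
  · intro e _ e' _ h
    exact Finset.map_injective _ h
  · intro e he
    obtain ⟨he, hS, hW⟩ := Finset.mem_filter.mp he
    have hsub : e ⊆ univ.map ι := by
      intro v hv
      by_cases hvS : v ∈ S.map ι
      · exact Finset.map_subset_map.mpr (Finset.subset_univ _) hvS
      · exact hW (Finset.mem_sdiff.mpr ⟨hv, hvS⟩)
    obtain ⟨e', _, rfl⟩ := Finset.subset_map_iff.mp hsub
    refine ⟨e', ?_, rfl⟩
    rw [Finset.mem_filter]
    exact ⟨Finset.mem_filter.mpr ⟨Finset.mem_univ _, he⟩, Finset.map_subset_map.mp hS⟩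

/-- `RichOn` lets `T` lie anywhere in `V`, so the bound survives when arbitrary vertices are added
to `R`. This allows a reservoir to be combined with chain ends lying outside it. -/
theorem le_minDegree_comap {n : ℕ} (ι : Fin n ↪ V)
    {H : UniformHypergraph k V} {d : ℕ} {R : Finset V} {x : ℝ} (h : H.RichOn d R x)
    (hR : R ⊆ univ.map ι) (hd : d ≤ n) : x ≤ (H.comap ι).minDegree d := by
  have hne : {r : ℕ | ∃ S : Finset (Fin n), S.card = d ∧ (H.comap ι).degree S = r}.Nonempty := by
    obtain ⟨S, _, hS⟩ := Finset.exists_subset_card_eq (s := (univ : Finset (Fin n))) (n := d)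
      (by simpa using hd)
    exact ⟨_, S, hS, rfl⟩
  obtain ⟨S, hS, hdeg⟩ := Nat.sInf_mem hne
  unfold minDegree
  rw [← hdeg, ← degree_comap]
  refine (h (S.map ι) (by rw [Finset.card_map, hS])).trans ?_
  exact_mod_cast H.relDegree_mono _ hR

/-- A member containing `T` is determined by its other `k - |T|` vertices. -/
theorem card_supersets_le [Fintype V] {𝓕 : Finset (Finset V)} {T : Finset V}
    (h : ∀ e ∈ 𝓕, T ⊆ e ∧ e.card = k) :
    𝓕.card ≤ Fintype.card V ^ (k - T.card) := by
  calc 𝓕.card = (𝓕.image fun e => e \ T).card := by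
        rw [Finset.card_image_of_injOn]
        intro e he e' he' hee
        rw [← Finset.sdiff_union_of_subset (h e he).1, ← Finset.sdiff_union_of_subset (h e' he').1]
        simp only at hee
        rw [hee]
    _ ≤ (powersetCard (k - T.card) (univ : Finset V)).card := by
        refine Finset.card_le_card fun s hs => ?_
        obtain ⟨e, he, rfl⟩ := Finset.mem_image.mp hs
        rw [Finset.mem_powersetCard]
        exact ⟨Finset.subset_univ _, by rw [Finset.card_sdiff_of_subset (h e he).1, (h e he).2]⟩
    _ ≤ _ := by
        rw [Finset.card_powersetCard, Finset.card_univ]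
        exact Nat.choose_le_pow _ _

/-- A deleted vertex `y ∉ T` destroys only edges containing `insert y T`, of which there are at most
`|V| ^ (k - d - 1)`. -/
theorem RichOn.sdiff [Fintype V] {H : UniformHypergraph k V} {d : ℕ} {W : Finset V} {x : ℝ}
    (h : H.RichOn d W x) (Y : Finset V) :
    H.RichOn d (W \ Y) (x - Y.card * (Fintype.card V : ℝ) ^ (k - d - 1)) := by
  intro T hT
  have h1 := h T hT
  have h2 : H.relDegree T W ≤ H.relDegree T (W \ Y) +
      Y.card * Fintype.card V ^ (k - d - 1) := by
    have hsub : (H.edges.filter fun e => T ⊆ e ∧ e \ T ⊆ W) ⊆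
        (H.edges.filter fun e => T ⊆ e ∧ e \ T ⊆ W \ Y) ∪
        Y.biUnion fun y => H.edges.filter fun e => T ⊆ e ∧ y ∈ e \ T := by
      intro e he
      obtain ⟨he, hTe, heW⟩ := Finset.mem_filter.mp he
      rw [Finset.mem_union]
      by_cases hy : ∃ y ∈ Y, y ∈ e \ T
      · obtain ⟨y, hyY, hy⟩ := hy
        exact Or.inr (Finset.mem_biUnion.mpr ⟨y, hyY, Finset.mem_filter.mpr ⟨he, hTe, hy⟩⟩)
      · push Not at hy
        refine Or.inl (Finset.mem_filter.mpr ⟨he, hTe, fun v hv => ?_⟩)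
        exact Finset.mem_sdiff.mpr ⟨heW hv, fun hvY => hy v hvY hv⟩
    refine (Finset.card_le_card hsub).trans ((Finset.card_union_le _ _).trans ?_)
    refine Nat.add_le_add_left (Finset.card_biUnion_le_card_mul _ _ _ fun y _ => ?_) _
    by_cases hyT : y ∈ T
    · have : (H.edges.filter fun e => T ⊆ e ∧ y ∈ e \ T) = ∅ := by
        refine Finset.filter_eq_empty_iff.mpr fun e _ h => ?_
        exact (Finset.mem_sdiff.mp h.2).2 hyT
      rw [this]
      simp
    · have h3 := card_supersets_le (k := k) (T := insert y T)
        (𝓕 := H.edges.filter fun e => T ⊆ e ∧ y ∈ e \ T) (fun e he => by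
          obtain ⟨he, hTe, hy⟩ := Finset.mem_filter.mp he
          exact ⟨Finset.insert_subset (Finset.mem_sdiff.mp hy).1 hTe, H.uniform e he⟩)
      rwa [Finset.card_insert_of_notMem hyT, hT, ← Nat.sub_sub] at h3
  have h3 : (H.relDegree T W : ℝ) ≤ H.relDegree T (W \ Y) +
      Y.card * (Fintype.card V : ℝ) ^ (k - d - 1) := by exact_mod_cast h2
  linarith

/-- The hypergraph of all edges that belong to at least `c` of the hypergraphs with
indices in `B`. -/
noncomputable def popular {M : ℕ} [Fintype V] (H : Fin M → UniformHypergraph k V)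
    (B : Finset (Fin M)) (c : ℝ) :
    UniformHypergraph k V := by
  classical
  exact
  { edges := univ.filter fun e => e.card = k ∧ c ≤ ((B.filter fun i => e ∈ (H i).edges).card : ℝ)
    uniform := fun e he => (Finset.mem_filter.mp he).2.1 }

theorem mem_popular {M : ℕ} [Fintype V] {H : Fin M → UniformHypergraph k V} {B : Finset (Fin M)}
    {c : ℝ} {e : Finset V} : e ∈ (popular H B c).edges ↔
      e.card = k ∧ c ≤ ((B.filter fun i => e ∈ (H i).edges).card : ℝ) := by
  classical
  simp [popular]

/-- Count pairs of an edge at `T` and a colour of `B`. An unpopular edge accounts for less than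
`γ|B|` pairs, and there are at most `|V| ^ (k - d)` candidates; a popular one accounts for at most
`|B|`. Dividing by `|B|` gives the stated loss. -/
theorem richOn_popular {M : ℕ} [Fintype V] {H : Fin M → UniformHypergraph k V}
    {B : Finset (Fin M)} (hB : B.Nonempty) {d : ℕ} {W : Finset V} {x γ : ℝ} (hγ : 0 ≤ γ)
    (h : ∀ i ∈ B, (H i).RichOn d W x) :
    (popular H B (γ * B.card)).RichOn d W (x - γ * (Fintype.card V : ℝ) ^ (k - d)) := by
  classical
  intro T hT
  have hBpos : (0 : ℝ) < B.card := by exact_mod_cast hB.card_pos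
  set E : Finset (Finset V) := univ.filter fun e => (T ⊆ e ∧ e \ T ⊆ W) ∧ e.card = k with hE
  set E' := (popular H B (γ * B.card)).edges.filter fun e => T ⊆ e ∧ e \ T ⊆ W with hE'
  let c : Finset V → ℝ := fun e => ((B.filter fun i => e ∈ (H i).edges).card : ℝ)
  have h1 : ∑ i ∈ B, ((H i).relDegree T W : ℝ) = ∑ e ∈ E, c e := by
    have h2 : ∀ i ∈ B, ((H i).relDegree T W : ℝ) =
        ∑ e ∈ E, if e ∈ (H i).edges then (1 : ℝ) else 0 := by
      intro i _
      rw [Finset.sum_boole]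
      unfold relDegree
      congr 2
      ext e
      simp only [hE, Finset.mem_filter, Finset.mem_univ, true_and]
      constructor
      · exact fun h => ⟨⟨h.2, (H i).uniform e h.1⟩, h.1⟩
      · exact fun h => ⟨h.2, h.1.1⟩
    rw [Finset.sum_congr rfl h2, Finset.sum_comm]
    refine Finset.sum_congr rfl fun e _ => ?_
    rw [Finset.sum_boole]
  have h2 : ∑ e ∈ E, c e ≤ ∑ e ∈ E, ((if e ∈ E' then (B.card : ℝ) else 0) + γ * B.card) := by
    refine Finset.sum_le_sum fun e he => ?_
    split_ifs with hee
    · have : c e ≤ B.card := Nat.cast_le.mpr (Finset.card_filter_le _ _)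
      have : 0 ≤ γ * B.card := by positivity
      linarith
    · rw [zero_add]
      by_contra hlt
      push Not at hlt
      refine hee (Finset.mem_filter.mpr ⟨mem_popular.mpr ⟨(Finset.mem_filter.mp he).2.2, hlt.le⟩,
        (Finset.mem_filter.mp he).2.1⟩)
  have h3 : ∑ e ∈ E, (if e ∈ E' then (B.card : ℝ) else 0) ≤ B.card * E'.card := by
    rw [← Finset.sum_filter, Finset.sum_const, nsmul_eq_mul, mul_comm]
    refine mul_le_mul_of_nonneg_left ?_ hBpos.le
    exact_mod_cast Finset.card_le_card fun e he => (Finset.mem_filter.mp he).2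
  have h4 : (E.card : ℝ) ≤ (Fintype.card V : ℝ) ^ (k - d) := by
    have := card_supersets_le (k := k) (T := T) (𝓕 := E) (fun e he =>
      ⟨(Finset.mem_filter.mp he).2.1.1, (Finset.mem_filter.mp he).2.2⟩)
    rw [hT] at this
    exact_mod_cast this
  have h5 : (B.card : ℝ) * x ≤ ∑ i ∈ B, ((H i).relDegree T W : ℝ) := by
    have := Finset.card_nsmul_le_sum B (fun i => ((H i).relDegree T W : ℝ)) x
      fun i hi => h i hi T hT
    rwa [nsmul_eq_mul] at this
  rw [Finset.sum_add_distrib, Finset.sum_const, nsmul_eq_mul] at h2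
  have h6 : (E.card : ℝ) * (γ * B.card) ≤ (Fintype.card V : ℝ) ^ (k - d) * (γ * B.card) :=
    mul_le_mul_of_nonneg_right h4 (by positivity)
  have h7 : (B.card : ℝ) * (x - γ * (Fintype.card V : ℝ) ^ (k - d)) ≤ B.card * E'.card := by
    rw [h1] at h5
    nlinarith
  exact le_of_mul_le_mul_left h7 hBpos

/-- The sets completing `T` to an edge by vertices from `W`. -/
def linkSets (H : UniformHypergraph k V) (T W : Finset V) : Finset (Finset V) :=
  (H.edges.filter fun e => T ⊆ e ∧ e \ T ⊆ W).image fun e => e \ T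

theorem card_linkSets (H : UniformHypergraph k V) (T W : Finset V) :
    (H.linkSets T W).card = H.relDegree T W := by
  unfold linkSets relDegree
  rw [Finset.card_image_of_injOn]
  intro e he e' he' hee
  simp only [Finset.coe_filter, Set.mem_ofPred_eq] at he he' hee
  rw [← Finset.sdiff_union_of_subset he.2.1, ← Finset.sdiff_union_of_subset he'.2.1, hee]

theorem mem_linkSets (H : UniformHypergraph k V) {T W L : Finset V} (h : L ∈ H.linkSets T W) :
    L.card = k - T.card ∧ L ⊆ W := by
  obtain ⟨e, he, rfl⟩ := Finset.mem_image.mp h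
  obtain ⟨he, hT, hW⟩ := Finset.mem_filter.mp he
  exact ⟨by rw [Finset.card_sdiff_of_subset hT, H.uniform e he], hW⟩

theorem card_linkSets_filter_le (H : UniformHypergraph k V) (T W R : Finset V) :
    ((H.linkSets T W).filter fun L => L ⊆ R).card ≤ H.relDegree T R := by
  rw [← card_linkSets]
  refine Finset.card_le_card fun L hL => ?_
  obtain ⟨hL, hR⟩ := Finset.mem_filter.mp hL
  obtain ⟨e, he, rfl⟩ := Finset.mem_image.mp hL
  obtain ⟨he, hT, hW⟩ := Finset.mem_filter.mp he
  exact Finset.mem_image.mpr ⟨e, Finset.mem_filter.mpr ⟨he, hT, hR⟩, rfl⟩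

end UniformHypergraph

/-! ### Degrees in random vertex subsets -/

section sampling

open Finset

variable {V Ω : Type} [DecidableEq V] [Fintype Ω]

/-- A `K`-tuple with image a `K`-set is injective, so the tuples counted are the orderings of `L`.
-/
theorem card_image_eq_factorial (φ : Ω ↪ V) {L : Finset V} {K : ℕ} (hL : L.card = K)
    (hφ : L ⊆ univ.map φ) :
    (univ.filter fun y : Fin K → Ω => univ.image (φ ∘ y) = L).card = K.factorial := by
  classical
  have hg : ∀ l : L, ∃ ω, φ ω = l.1 := fun l => by
    obtain ⟨ω, _, h⟩ := Finset.mem_map.mp (hφ l.2)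
    exact ⟨ω, h⟩
  choose g hg using hg
  have hginj : Function.Injective g := fun l l' h => Subtype.ext (by rw [← hg, ← hg, h])
  have h1 : (univ.filter fun y : Fin K → Ω => univ.image (φ ∘ y) = L) =
      univ.image fun j : Fin K ↪ L => g ∘ j := by
    ext y
    simp only [Finset.mem_filter, Finset.mem_univ, true_and, Finset.mem_image]
    constructor
    · intro hy
      have hmem : ∀ i, φ (y i) ∈ L := fun i => by
        rw [← hy]
        exact Finset.mem_image_of_mem (φ ∘ y) (Finset.mem_univ i)
      have hinj : Function.Injective (φ ∘ y) := by
        rw [← Set.injOn_univ, ← Finset.coe_univ, ← Finset.card_image_iff, hy, hL]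
        simp
      refine ⟨⟨fun i => ⟨φ (y i), hmem i⟩, fun i j hij => hinj (congrArg Subtype.val hij)⟩, ?_⟩
      funext i
      exact φ.injective (hg _)
    · rintro ⟨j, rfl⟩
      have hj : φ ∘ (g ∘ j) = Subtype.val ∘ j := funext fun i => hg _
      have hbij : Function.Bijective j :=
        (Fintype.bijective_iff_injective_and_card j).mpr ⟨j.injective, by simp [hL]⟩
      rw [hj, ← Finset.image_image, Finset.image_univ_of_surjective hbij.2]
      simp
  have h2 : Function.Injective fun j : Fin K ↪ L => g ∘ j := fun j j' h => by
    ext i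
    exact congrArg Subtype.val (hginj (congrFun h i))
  rw [h1, Finset.card_image_of_injective _ h2, Finset.card_univ, Fintype.card_embedding_eq]
  simp [hL, Nat.descFactorial_self]

theorem card_image_mem (φ : Ω ↪ V) {𝓛 : Finset (Finset V)} {K : ℕ}
    (h𝓛 : ∀ L ∈ 𝓛, L.card = K ∧ L ⊆ univ.map φ) :
    (univ.filter fun y : Fin K → Ω => univ.image (φ ∘ y) ∈ 𝓛).card = K.factorial * 𝓛.card := by
  classical
  rw [Finset.card_eq_sum_card_fiberwise (f := fun y : Fin K → Ω => univ.image (φ ∘ y)) (t := 𝓛)]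
  · rw [mul_comm, ← smul_eq_mul, ← Finset.sum_const]
    refine Finset.sum_congr rfl fun L hL => ?_
    rw [← card_image_eq_factorial φ (h𝓛 L hL).1 (h𝓛 L hL).2, Finset.filter_filter]
    congr 1
    ext y
    simp only [Finset.mem_filter, Finset.mem_univ, true_and]
    exact ⟨fun h => h.2, fun h => ⟨by rw [h]; exact hL, h⟩⟩
  · intro y hy
    exact (Finset.mem_filter.mp hy).2

open Classical in
/-- Few injective samples contain far fewer members of a set family than expected. -/
theorem card_sample_le [Nonempty Ω] {ι : Type} [Fintype ι] [DecidableEq ι] (φ : Ω ↪ V)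
    {𝓛 : Finset (Finset V)} {K b : ℕ} (h𝓛 : ∀ L ∈ 𝓛, L.card = K ∧ L ⊆ univ.map φ)
    (hb : b * K ≤ Fintype.card ι) {q ε : ℝ} (hε : 0 ≤ ε)
    (hq : q * (Fintype.card Ω : ℝ) ^ K ≤ 𝓛.card) :
    ((univ.filter fun x : ι → Ω => Function.Injective x ∧
      ((𝓛.filter fun L => L ⊆ univ.image (φ ∘ x)).card : ℝ) ≤
        (q - ε) * Fintype.card (Fin K ↪ ι)).card : ℝ) ≤
      (Fintype.card Ω : ℝ) ^ Fintype.card ι * Real.exp (-(b * ε ^ 2 / 2)) := by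
  classical
  obtain ⟨B⟩ : Nonempty (Fin b × Fin K ↪ ι) :=
    Function.Embedding.nonempty_of_card_le (by simpa using hb)
  have hN : (0 : ℝ) < Fintype.card Ω := by exact_mod_cast Fintype.card_pos
  set c : ℝ := (K.factorial : ℝ) with hc
  have hc1 : 1 ≤ c := by rw [hc]; exact_mod_cast Nat.one_le_iff_ne_zero.mpr (Nat.factorial_ne_zero K)
  set q' : ℝ := 𝓛.card / (Fintype.card Ω : ℝ) ^ K with hq'
  have hqq : q ≤ q' := (le_div_iff₀ (by positivity)).mpr hq
  -- Tuples replace sets: a random `K`-tuple hits `𝓛` with probability `K! * q'`, so density and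
  -- error are both scaled by `K!`. In an injective sample each set is hit by at most `K!` tuples,
  -- which undoes the scaling.
  have h1 := card_ustatistic_le B (fun y : Fin K → Ω => univ.image (φ ∘ y) ∈ 𝓛)
    (ε := c * ε) (p := c * q') (by positivity) (by
      rw [card_image_mem φ h𝓛, hq']
      push_cast
      rw [hc]
      field_simp)
  refine le_trans ?_ (h1.trans ?_)
  · refine Nat.cast_le.mpr (Finset.card_le_card fun x hx => ?_)
    obtain ⟨-, hinj, hx⟩ := Finset.mem_filter.mp hx
    rw [Finset.mem_filter]
    refine ⟨Finset.mem_univ _, ?_⟩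
    have hU : (univ.filter fun j : Fin K ↪ ι => univ.image (φ ∘ (x ∘ j)) ∈ 𝓛).card ≤
        K.factorial * (𝓛.filter fun L => L ⊆ univ.image (φ ∘ x)).card := by
      let ψ : ι ↪ V := ⟨φ ∘ x, φ.injective.comp hinj⟩
      have h2 := card_image_mem ψ (𝓛 := 𝓛.filter fun L => L ⊆ univ.image (φ ∘ x)) (K := K)
        (fun L hL => by
          obtain ⟨hL, hs⟩ := Finset.mem_filter.mp hL
          refine ⟨(h𝓛 L hL).1, ?_⟩
          rw [Finset.map_eq_image]
          exact hs)
      rw [← h2]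
      refine Finset.card_le_card_of_injOn (fun j => (j : Fin K → ι)) ?_
        (fun j _ j' _ h => DFunLike.coe_injective h)
      intro j hj
      have hj := (Finset.mem_filter.mp hj).2
      refine Finset.mem_filter.mpr ⟨Finset.mem_univ _, Finset.mem_filter.mpr ⟨hj, ?_⟩⟩
      intro v hv
      obtain ⟨i, _, rfl⟩ := Finset.mem_image.mp hv
      exact Finset.mem_image_of_mem (φ ∘ x) (Finset.mem_univ (j i))
    have hU' : ((univ.filter fun j : Fin K ↪ ι => univ.image (φ ∘ (x ∘ j)) ∈ 𝓛).card : ℝ) ≤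
        c * (𝓛.filter fun L => L ⊆ univ.image (φ ∘ x)).card := by
      rw [hc]; exact_mod_cast hU
    have hI : (0 : ℝ) ≤ Fintype.card (Fin K ↪ ι) := by positivity
    calc _ ≤ _ := hU'
      _ ≤ c * ((q - ε) * Fintype.card (Fin K ↪ ι)) := mul_le_mul_of_nonneg_left hx (by linarith)
      _ ≤ c * ((q' - ε) * Fintype.card (Fin K ↪ ι)) := by
        refine mul_le_mul_of_nonneg_left (mul_le_mul_of_nonneg_right (by linarith) hI)
          (by linarith)
      _ = _ := by ring
  · refine mul_le_mul_of_nonneg_left (Real.exp_le_exp.mpr ?_) (by positivity)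
    have : ε ^ 2 ≤ (c * ε) ^ 2 := pow_le_pow_left₀ hε (by nlinarith) 2
    have hb' : (0 : ℝ) ≤ b := by positivity
    nlinarith [mul_le_mul_of_nonneg_left this hb']

end sampling

namespace UniformHypergraph

open Finset

/-- A set of prescribed size into which all given hypergraphs have large relative degrees. -/
theorem exists_reservoir {I V : Type} [Fintype I] [Fintype V] [DecidableEq V] {k d r b : ℕ}
    (H : I → UniformHypergraph k V) {W : Finset V} (hW : W.Nonempty) {q ε : ℝ} (hε : 0 ≤ ε)
    (hrich : ∀ i, (H i).RichOn d W (q * (W.card : ℝ) ^ (k - d)))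
    (hb : b * (k - d) ≤ r) (hr : r ≤ W.card)
    (hnum : Fintype.card I * (Fintype.card V : ℝ) ^ d *
      ((W.card : ℝ) ^ r * Real.exp (-(b * ε ^ 2 / 2))) < ((W.card : ℝ) - r) ^ r) :
    ∃ R ⊆ W, R.card = r ∧
      ∀ i, (H i).RichOn d R ((q - ε) * (r.descFactorial (k - d) : ℝ)) := by
  classical
  have hne : Nonempty W := hW.to_subtype
  let φ : W ↪ V := Function.Embedding.subtype _
  have hφ : univ.map φ = W := by
    ext v
    simp [φ]
  -- Samples are drawn with replacement, where concentration is available, but only injective ones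
  -- are recorded as bad. The union bound runs over all hypergraphs and all `d`-sets, and `hnum`
  -- makes the total smaller than the number of injective samples, which is at least `(|W| - r) ^
  -- r`.
  let bad : I × Finset V → Finset (Fin r → W) := fun p =>
    univ.filter fun x : Fin r → W => Function.Injective x ∧
      ((((H p.1).linkSets p.2 W).filter fun L => L ⊆ univ.image (φ ∘ x)).card : ℝ) ≤
        (q - ε) * Fintype.card (Fin (k - d) ↪ Fin r)
  have hbad : ∀ i, ∀ T : Finset V, T.card = d → ((bad (i, T)).card : ℝ) ≤
      (W.card : ℝ) ^ r * Real.exp (-(b * ε ^ 2 / 2)) := by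
    intro i T hT
    have h := card_sample_le (ι := Fin r) φ (𝓛 := (H i).linkSets T W) (K := k - d) (b := b)
      (fun L hL => by
        have := (H i).mem_linkSets hL
        rw [hT] at this
        rwa [hφ])
      (by simpa using hb) hε (q := q) (by
        rw [card_linkSets, Fintype.card_coe]
        exact hrich i T hT)
    rw [Fintype.card_coe, Fintype.card_fin] at h
    convert h
  by_contra hcon
  have hall : (univ.filter fun x : Fin r → W => Function.Injective x) ⊆
      ((univ : Finset I) ×ˢ powersetCard d (univ : Finset V)).biUnion bad := by
    intro x hx
    have hinj := (Finset.mem_filter.mp hx).2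
    by_contra hxb
    refine hcon ⟨univ.image (φ ∘ x), ?_, ?_, ?_⟩
    · intro v hv
      obtain ⟨j, _, rfl⟩ := Finset.mem_image.mp hv
      exact (x j).2
    · rw [Finset.card_image_of_injective _ (φ.injective.comp hinj), Finset.card_univ,
        Fintype.card_fin]
    · intro i T hT
      by_contra hlt
      push Not at hlt
      refine hxb (Finset.mem_biUnion.mpr ⟨(i, T), ?_, ?_⟩)
      · rw [Finset.mem_product, Finset.mem_powersetCard]
        exact ⟨Finset.mem_univ _, Finset.subset_univ _, hT⟩
      · refine Finset.mem_filter.mpr ⟨Finset.mem_univ _, hinj, ?_⟩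
        rw [Fintype.card_embedding_eq, Fintype.card_fin, Fintype.card_fin]
        refine le_trans ?_ hlt.le
        exact_mod_cast (H i).card_linkSets_filter_le T W _
  have h1 : ((univ.filter fun x : Fin r → W => Function.Injective x).card : ℝ) ≤
      Fintype.card I * (Fintype.card V : ℝ) ^ d *
      ((W.card : ℝ) ^ r * Real.exp (-(b * ε ^ 2 / 2))) := by
    calc ((univ.filter fun x : Fin r → W => Function.Injective x).card : ℝ)
        ≤ (((univ : Finset I) ×ˢ powersetCard d (univ : Finset V)).biUnion bad).card :=
          Nat.cast_le.mpr (Finset.card_le_card hall)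
      _ ≤ ∑ p ∈ (univ : Finset I) ×ˢ powersetCard d (univ : Finset V), ((bad p).card : ℝ) := by
          exact_mod_cast Finset.card_biUnion_le
      _ ≤ ∑ p ∈ (univ : Finset I) ×ˢ powersetCard d (univ : Finset V),
          ((W.card : ℝ) ^ r * Real.exp (-(b * ε ^ 2 / 2))) := by
          refine Finset.sum_le_sum fun p hp => hbad p.1 p.2 ?_
          exact (Finset.mem_powersetCard.mp (Finset.mem_product.mp hp).2).2
      _ ≤ _ := by
          rw [Finset.sum_const, nsmul_eq_mul, Finset.card_product, Finset.card_powersetCard,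
            Finset.card_univ, Finset.card_univ]
          refine mul_le_mul_of_nonneg_right ?_ (by positivity)
          exact_mod_cast Nat.mul_le_mul_left _ (Nat.choose_le_pow _ _)
  have h2 : ((W.card : ℝ) - r) ^ r ≤
      ((univ.filter fun x : Fin r → W => Function.Injective x).card : ℝ) := by
    have h3 : (univ.filter fun x : Fin r → W => Function.Injective x).card =
        W.card.descFactorial r := by
      rw [← Fintype.card_subtype, Fintype.card_congr (Equiv.subtypeInjectiveEquivEmbedding _ _),
        Fintype.card_embedding_eq, Fintype.card_coe, Fintype.card_fin]
    rw [h3]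
    have h4 : (W.card - r) ^ r ≤ W.card.descFactorial r :=
      (Nat.pow_le_pow_left (by omega) r).trans (Nat.pow_sub_le_descFactorial _ _)
    calc ((W.card : ℝ) - r) ^ r = (((W.card - r) ^ r : ℕ) : ℝ) := by
          rw [Nat.cast_pow, Nat.cast_sub hr]
      _ ≤ _ := by exact_mod_cast h4
  linarith

open Classical in
/-- Most injections of a small set induce hypergraphs of large minimum degree. -/
theorem card_poor_injections_le {k d N s b : ℕ} (hN : 0 < N) (H : UniformHypergraph k (Fin N))
    {q ε : ℝ} (hε : 0 ≤ ε) (hrich : H.RichOn d univ (q * (N : ℝ) ^ (k - d)))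
    (hd : d ≤ s) (hb : b * (k - d) ≤ s - d) :
    ((univ.filter fun x : Fin s ↪ Fin N =>
      ¬ (q - ε) * ((s - d).descFactorial (k - d) : ℝ) ≤ (H.comap x).minDegree d).card : ℝ) ≤
      (s : ℝ) ^ d * ((N : ℝ) ^ s * Real.exp (-(b * ε ^ 2 / 2))) := by
  have hne : Nonempty (Fin N) := ⟨⟨0, hN⟩⟩
  set c : ℝ := (q - ε) * ((s - d).descFactorial (k - d) : ℝ) with hc
  let poor : Finset (Fin s) → Finset (Fin s ↪ Fin N) := fun I =>
    univ.filter fun x => ((H.comap x).degree I : ℝ) < c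
  have hpoor : ∀ I : Finset (Fin s), I.card = d → ((poor I).card : ℝ) ≤
      (N : ℝ) ^ s * Real.exp (-(b * ε ^ 2 / 2)) := by
    intro I hI
    have hcI : Fintype.card {x // x ∉ I} = s - d := by
      rw [Fintype.card_subtype_compl]
      simp [hI]
    -- An injection splits into its restriction `u` to `I`, which determines the `d`-set, and its
    -- values elsewhere. For fixed `u` the latter form a sample of `s - d` points, to which
    -- concentration for the link of `u(I)` applies.
    let bad : (I → Fin N) → Finset ({x // x ∉ I} → Fin N) := fun u =>
      univ.filter fun v => Function.Injective v ∧
        (((H.linkSets (univ.image u) univ).filter fun L =>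
          L ⊆ univ.image (Function.Embedding.refl (Fin N) ∘ v)).card : ℝ) ≤
        (q - ε) * Fintype.card (Fin (k - d) ↪ {x // x ∉ I})
    have hbad : ∀ u : I → Fin N, Function.Injective u → ((bad u).card : ℝ) ≤
        (N : ℝ) ^ (s - d) * Real.exp (-(b * ε ^ 2 / 2)) := by
      intro u hu
      have hT : (univ.image u).card = d := by
        rw [Finset.card_image_of_injective _ hu, Finset.card_univ, Fintype.card_coe, hI]
      have h := card_sample_le (ι := {x // x ∉ I}) (Function.Embedding.refl (Fin N))
        (𝓛 := H.linkSets (univ.image u) univ) (K := k - d) (b := b)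
        (fun L hL => by
          have := H.mem_linkSets hL
          rw [hT] at this
          exact ⟨this.1, by simp⟩)
        (by rw [hcI]; exact hb) hε (q := q) (by
          rw [card_linkSets, Fintype.card_fin]
          exact hrich _ hT)
      rw [hcI, Fintype.card_fin] at h
      convert h
    have hmap : (poor I).card ≤ ((univ.filter fun u : I → Fin N =>
        Function.Injective u).sigma bad).card := by
      refine Finset.card_le_card_of_injOn (fun x => ⟨fun i => x i.1, fun i => x i.1⟩) ?_ ?_
      · intro x hx
        have hx := (Finset.mem_filter.mp hx).2
        rw [Finset.mem_coe, Finset.mem_sigma]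
        refine ⟨Finset.mem_filter.mpr ⟨Finset.mem_univ _,
          fun i j hij => Subtype.ext (x.injective hij)⟩, Finset.mem_filter.mpr
          ⟨Finset.mem_univ _, fun i j hij => Subtype.ext (x.injective hij), ?_⟩⟩
        rw [Fintype.card_embedding_eq, Fintype.card_fin, hcI]
        refine le_trans ?_ hx.le
        refine Nat.cast_le.mpr ((H.card_linkSets_filter_le _ _ _).trans ?_)
        rw [← degree_comap]
        have h1 : univ.image (fun i : I => x i.1) = I.map x := by
          ext v
          simp
        rw [h1]
        refine H.relDegree_mono _ fun v hv => ?_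
        obtain ⟨i, _, rfl⟩ := Finset.mem_image.mp hv
        exact Finset.mem_map_of_mem _ (Finset.mem_univ _)
      · intro x _ y _ hxy
        simp only [Sigma.mk.injEq, heq_eq_eq] at hxy
        ext i
        by_cases hi : i ∈ I
        · exact congrArg Fin.val (congrFun hxy.1 ⟨i, hi⟩)
        · exact congrArg Fin.val (congrFun hxy.2 ⟨i, hi⟩)
    calc ((poor I).card : ℝ) ≤ ∑ u ∈ univ.filter fun u : I → Fin N => Function.Injective u,
          ((bad u).card : ℝ) := by
          rw [Finset.card_sigma] at hmap
          exact_mod_cast hmap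
      _ ≤ ∑ u ∈ univ.filter fun u : I → Fin N => Function.Injective u,
          (N : ℝ) ^ (s - d) * Real.exp (-(b * ε ^ 2 / 2)) :=
          Finset.sum_le_sum fun u hu => hbad u (Finset.mem_filter.mp hu).2
      _ ≤ (N : ℝ) ^ d * ((N : ℝ) ^ (s - d) * Real.exp (-(b * ε ^ 2 / 2))) := by
          rw [Finset.sum_const, nsmul_eq_mul]
          refine mul_le_mul_of_nonneg_right ?_ (by positivity)
          have : (univ.filter fun u : I → Fin N => Function.Injective u).card ≤ N ^ d := by
            refine (Finset.card_le_univ _).trans ?_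
            simp [hI]
          exact_mod_cast this
      _ = _ := by
          rw [← mul_assoc, ← pow_add, Nat.add_sub_cancel' hd]
  have hsub : (univ.filter fun x : Fin s ↪ Fin N => ¬ c ≤ (H.comap x).minDegree d) ⊆
      (powersetCard d (univ : Finset (Fin s))).biUnion poor := by
    intro x hx
    have hx := (Finset.mem_filter.mp hx).2
    push Not at hx
    have hne : {r : ℕ | ∃ S : Finset (Fin s), S.card = d ∧
        (H.comap x).degree S = r}.Nonempty := by
      obtain ⟨S, _, hS⟩ := Finset.exists_subset_card_eq (s := (univ : Finset (Fin s))) (n := d)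
        (by simpa using hd)
      exact ⟨_, S, hS, rfl⟩
    obtain ⟨S, hS, hdeg⟩ := Nat.sInf_mem hne
    refine Finset.mem_biUnion.mpr ⟨S, Finset.mem_powersetCard.mpr ⟨Finset.subset_univ _, hS⟩,
      Finset.mem_filter.mpr ⟨Finset.mem_univ _, ?_⟩⟩
    rw [hdeg]
    exact hx
  calc _ ≤ (((powersetCard d (univ : Finset (Fin s))).biUnion poor).card : ℝ) :=
        Nat.cast_le.mpr (Finset.card_le_card hsub)
    _ ≤ ∑ I ∈ powersetCard d (univ : Finset (Fin s)), ((poor I).card : ℝ) := by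
        exact_mod_cast Finset.card_biUnion_le
    _ ≤ ∑ I ∈ powersetCard d (univ : Finset (Fin s)),
        (N : ℝ) ^ s * Real.exp (-(b * ε ^ 2 / 2)) :=
        Finset.sum_le_sum fun I hI => hpoor I (Finset.mem_powersetCard.mp hI).2
    _ ≤ _ := by
        rw [Finset.sum_const, nsmul_eq_mul, Finset.card_powersetCard, Finset.card_univ,
          Fintype.card_fin]
        refine mul_le_mul_of_nonneg_right ?_ (by positivity)
        exact_mod_cast Nat.choose_le_pow _ _

end UniformHypergraph

/-! ### Absorption in bipartite graphs -/

section absorber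

open Finset

/-- Greedy choice of distinct representatives. -/
theorem exists_injOn_choice {α β : Type} [DecidableEq β] (S : Finset α)
    (O : α → Finset β) (h : ∀ a ∈ S, S.card ≤ (O a).card) [Nonempty β] :
    ∃ s : α → β, Set.InjOn s S ∧ ∀ a ∈ S, s a ∈ O a := by
  classical
  -- Hall's condition is immediate because each single `O a` is at least as large as all of `S`.
  have hall : ∀ T : Finset S, T.card ≤ (T.biUnion fun a => O a.1).card := by
    intro T
    rcases T.eq_empty_or_nonempty with rfl | ⟨a, ha⟩
    · simp
    · calc T.card ≤ (univ : Finset S).card := Finset.card_le_univ _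
        _ = S.card := by simp
        _ ≤ (O a.1).card := h a.1 a.2
        _ ≤ _ := Finset.card_le_card (Finset.subset_biUnion_of_mem (fun a : S => O a.1) ha)
  obtain ⟨f, hinj, hf⟩ := (Finset.all_card_le_biUnion_card_iff_exists_injective _).mp hall
  refine ⟨fun a => if ha : a ∈ S then f ⟨a, ha⟩ else Classical.arbitrary β, ?_, ?_⟩
  · intro a ha b hb hab
    simp only [dif_pos (Finset.mem_coe.mp ha), dif_pos (Finset.mem_coe.mp hb)] at hab
    exact congrArg Subtype.val (hinj hab)
  · intro a ha
    simp only [dif_pos ha]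
    exact hf ⟨a, ha⟩

open Classical in
/-- In a dense bipartite graph there are large vertex sets on both sides such that all pairs are
joined by many paths of length three. -/
theorem exists_many_paths {A C : Type} [Fintype A] [Fintype C] (R : A → C → Prop) {γ : ℝ}
    (hγ : 0 < γ) (hA : 0 < Fintype.card A) (hC : 0 < Fintype.card C)
    (hdeg : ∀ a, γ * Fintype.card C ≤ ((univ.filter fun c => R a c).card : ℝ)) :
    ∃ (A₀ : Finset A) (B : Finset C), γ * Fintype.card A / 4 ≤ A₀.card ∧
      γ * Fintype.card C / 2 ≤ B.card ∧ ∀ u ∈ B, ∀ z ∈ A₀,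
        γ ^ 2 * Fintype.card A / 8 ≤ ((univ.filter fun a => R a u ∧
          γ ^ 3 / 16 * Fintype.card C ≤ ((univ.filter fun c => R a c ∧ R z c).card : ℝ)).card : ℝ) := by
  set m : ℝ := (Fintype.card A : ℝ) with hm
  set n : ℝ := (Fintype.card C : ℝ) with hn
  have hm0 : 0 < m := by rw [hm]; exact_mod_cast hA
  have hn0 : 0 < n := by rw [hn]; exact_mod_cast hC
  set ε : ℝ := γ ^ 3 / 16 with hε
  have hε0 : 0 < ε := by positivity
  let nb : C → Finset A := fun c => univ.filter fun a => R a c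
  let co : A → A → ℝ := fun a z => ((univ.filter fun c => R a c ∧ R z c).card : ℝ)
  let bad : C → Finset (A × A) := fun c =>
    (nb c ×ˢ nb c).filter fun p => co p.1 p.2 < ε * n
  have hsum1 : γ * n * m ≤ ∑ c, ((nb c).card : ℝ) := by
    have h1 : ∑ c, ((nb c).card : ℝ) = ∑ a, ((univ.filter fun c => R a c).card : ℝ) := by
      have : ∀ c, ((nb c).card : ℝ) = ∑ a, if R a c then (1 : ℝ) else 0 := fun c => by
        rw [Finset.sum_boole]
      rw [Finset.sum_congr rfl fun c _ => this c, Finset.sum_comm]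
      exact Finset.sum_congr rfl fun a _ => by rw [Finset.sum_boole]
    rw [h1]
    have := Finset.card_nsmul_le_sum (univ : Finset A)
      (fun a => ((univ.filter fun c => R a c).card : ℝ)) (γ * n) fun a _ => hdeg a
    rw [nsmul_eq_mul, Finset.card_univ, ← hm] at this
    linarith
  have hsum2 : γ ^ 2 * n * m ^ 2 ≤ ∑ c, ((nb c).card : ℝ) ^ 2 := by
    have h1 := sq_sum_le_card_mul_sum_sq (s := (univ : Finset C))
      (f := fun c => ((nb c).card : ℝ))
    rw [Finset.card_univ, ← hn] at h1
    have h2 : (γ * n * m) ^ 2 ≤ (∑ c, ((nb c).card : ℝ)) ^ 2 :=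
      pow_le_pow_left₀ (by positivity) hsum1 2
    have h3 : n * (γ ^ 2 * n * m ^ 2) ≤ n * ∑ c, ((nb c).card : ℝ) ^ 2 := by
      calc n * (γ ^ 2 * n * m ^ 2) = (γ * n * m) ^ 2 := by ring
        _ ≤ _ := h2.trans h1
    exact le_of_mul_le_mul_left h3 hn0
  have hbad : ∑ c, ((bad c).card : ℝ) ≤ m ^ 2 * (ε * n) := by
    have h1 : ∀ c, ((bad c).card : ℝ) = ∑ p : A × A,
        if co p.1 p.2 < ε * n then (if R p.1 c ∧ R p.2 c then (1 : ℝ) else 0) else 0 := by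
      intro c
      rw [← Finset.sum_filter, Finset.sum_boole]
      congr 2
      ext p
      simp only [bad, nb, Finset.mem_filter, Finset.mem_product, Finset.mem_univ, true_and]
      tauto
    rw [Finset.sum_congr rfl fun c _ => h1 c, Finset.sum_comm]
    calc _ ≤ ∑ p : A × A, ε * n := by
          refine Finset.sum_le_sum fun p _ => ?_
          by_cases hp : co p.1 p.2 < ε * n
          · simp only [if_pos hp]
            rw [Finset.sum_boole]
            exact hp.le
          · simp only [if_neg hp, Finset.sum_const_zero]
            positivity
      _ = _ := by
          rw [Finset.sum_const, nsmul_eq_mul, Finset.card_univ, Fintype.card_prod]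
          push_cast
          ring
  -- Dependent random choice: the mean of the squared degree is at least `γ²m²`, and with weight
  -- `γ²/(2ε)` the bad pairs cost on average at most half of that. So some neighbourhood is large
  -- and contains few pairs of small codegree.
  obtain ⟨c₀, hc₀⟩ : ∃ c, γ ^ 2 * m ^ 2 / 2 + γ ^ 2 / (2 * ε) * (bad c).card ≤
      ((nb c).card : ℝ) ^ 2 := by
    by_contra hcon
    push Not at hcon
    have hne : (univ : Finset C).Nonempty := Finset.card_pos.mp (by rwa [Finset.card_univ])
    have h1 := Finset.sum_lt_sum_of_nonempty hne fun c _ => hcon c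
    rw [Finset.sum_add_distrib, Finset.sum_const, nsmul_eq_mul, Finset.card_univ, ← hn,
      ← Finset.mul_sum] at h1
    have h2 : γ ^ 2 / (2 * ε) * ∑ c, ((bad c).card : ℝ) ≤ γ ^ 2 / (2 * ε) * (m ^ 2 * (ε * n)) :=
      mul_le_mul_of_nonneg_left hbad (by positivity)
    have h3 : γ ^ 2 / (2 * ε) * (m ^ 2 * (ε * n)) = γ ^ 2 * n * m ^ 2 / 2 := by
      field_simp
    nlinarith
  set N := nb c₀ with hN
  set h : ℝ := (N.card : ℝ) with hh
  have hh0 : γ * m / 2 ≤ h := by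
    have h1 : 0 ≤ γ ^ 2 / (2 * ε) * ((bad c₀).card : ℝ) := by positivity
    have h2 : (γ * m / 2) ^ 2 ≤ h ^ 2 := by nlinarith [sq_nonneg (γ * m)]
    exact le_of_sq_le_sq h2 (by positivity)
  have hhpos : 0 < h := lt_of_lt_of_le (by positivity) hh0
  -- The choice `ε = γ³/16` bounds the proportion of bad pairs in `N` by `γ/8`; hence at least half
  -- of the vertices of `N` have at most `γh/4` bad partners.
  have hbadc : ((bad c₀).card : ℝ) ≤ γ / 8 * h ^ 2 := by
    have h1 : γ ^ 2 / (2 * ε) * ((bad c₀).card : ℝ) ≤ h ^ 2 := by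
      have : 0 ≤ γ ^ 2 * m ^ 2 / 2 := by positivity
      linarith
    have h2 : γ ^ 2 / (2 * ε) = 8 / γ := by
      rw [hε]; field_simp; norm_num
    rw [h2, div_mul_eq_mul_div, div_le_iff₀ hγ] at h1
    linarith
  let nbad : A → Finset A := fun z => N.filter fun a => co a z < ε * n
  set A₀ := N.filter fun z => ((nbad z).card : ℝ) ≤ γ / 4 * h with hA₀
  have hA₀card : h / 2 ≤ A₀.card := by
    have h1 : ((bad c₀).card : ℝ) = ∑ z ∈ N, ((nbad z).card : ℝ) := by
      have h2 : (bad c₀).card = ∑ z ∈ N, (nbad z).card := by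
        rw [Finset.card_eq_sum_card_fiberwise (f := Prod.snd) (t := N)]
        · refine Finset.sum_congr rfl fun z hz => ?_
          refine Finset.card_bij (fun p _ => p.1) ?_ ?_ ?_
          · intro p hp
            simp only [bad, nbad, Finset.mem_filter, Finset.mem_product] at hp ⊢
            obtain ⟨⟨⟨h1, h2⟩, h3⟩, rfl⟩ := hp
            exact ⟨h1, h3⟩
          · intro p hp p' hp' hpp
            exact Prod.ext hpp ((Finset.mem_filter.mp hp).2.trans (Finset.mem_filter.mp hp').2.symm)
          · intro a ha
            obtain ⟨h1, h2⟩ := Finset.mem_filter.mp ha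
            refine ⟨(a, z), ?_, rfl⟩
            simp only [bad, Finset.mem_filter, Finset.mem_product]
            exact ⟨⟨⟨h1, hz⟩, h2⟩, trivial⟩
        · intro p hp
          exact (Finset.mem_product.mp (Finset.mem_filter.mp hp).1).2
      rw [h2]
      push_cast
      rfl
    have h2 : ((N.filter fun z => ¬ ((nbad z).card : ℝ) ≤ γ / 4 * h).card : ℝ) * (γ / 4 * h) ≤
        ∑ z ∈ N, ((nbad z).card : ℝ) := by
      calc _ ≤ ∑ z ∈ N.filter fun z => ¬ ((nbad z).card : ℝ) ≤ γ / 4 * h, ((nbad z).card : ℝ) := by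
            rw [← nsmul_eq_mul]
            refine Finset.card_nsmul_le_sum _ _ _ fun z hz => ?_
            exact (not_le.mp (Finset.mem_filter.mp hz).2).le
        _ ≤ _ := Finset.sum_le_sum_of_subset_of_nonneg (Finset.filter_subset _ _)
            fun _ _ _ => by positivity
    have h3 : A₀.card + (N.filter fun z => ¬ ((nbad z).card : ℝ) ≤ γ / 4 * h).card = N.card :=
      Finset.card_filter_add_card_filter_not _
    have h4 : (A₀.card : ℝ) + (N.filter fun z => ¬ ((nbad z).card : ℝ) ≤ γ / 4 * h).card = h := by
      rw [hh]; exact_mod_cast h3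
    have h5 : ((N.filter fun z => ¬ ((nbad z).card : ℝ) ≤ γ / 4 * h).card : ℝ) * (γ / 4 * h) ≤
        h / 2 * (γ / 4 * h) := by
      rw [← h1] at h2
      nlinarith
    have h6 := le_of_mul_le_mul_right h5 (by positivity)
    linarith
  set B : Finset C := univ.filter fun c => γ / 2 * h ≤ ((N.filter fun a => R a c).card : ℝ) with hB
  have hBcard : γ * n / 2 ≤ B.card := by
    have h1 : γ * n * h ≤ ∑ c, ((N.filter fun a => R a c).card : ℝ) := by
      have h2 : ∑ c, ((N.filter fun a => R a c).card : ℝ) =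
          ∑ a ∈ N, ((univ.filter fun c => R a c).card : ℝ) := by
        have : ∀ c, ((N.filter fun a => R a c).card : ℝ) =
            ∑ a ∈ N, if R a c then (1 : ℝ) else 0 := fun c => by rw [Finset.sum_boole]
        rw [Finset.sum_congr rfl fun c _ => this c, Finset.sum_comm]
        exact Finset.sum_congr rfl fun a _ => by rw [Finset.sum_boole]
      rw [h2]
      have := Finset.card_nsmul_le_sum N
        (fun a => ((univ.filter fun c => R a c).card : ℝ)) (γ * n) fun a _ => hdeg a
      rw [nsmul_eq_mul] at this
      linarith
    have h2 : ∑ c, ((N.filter fun a => R a c).card : ℝ) ≤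
        ∑ c, ((if c ∈ B then h else 0) + γ / 2 * h) := by
      refine Finset.sum_le_sum fun c _ => ?_
      split_ifs with hc
      · have : ((N.filter fun a => R a c).card : ℝ) ≤ h :=
          Nat.cast_le.mpr (Finset.card_filter_le _ _)
        have : 0 ≤ γ / 2 * h := by positivity
        linarith
      · rw [zero_add]
        by_contra hlt
        exact hc (Finset.mem_filter.mpr ⟨Finset.mem_univ _, (not_le.mp hlt).le⟩)
    rw [Finset.sum_add_distrib, ← Finset.sum_filter, Finset.sum_const, Finset.sum_const,
      nsmul_eq_mul, nsmul_eq_mul, Finset.card_univ, ← hn, Finset.filter_univ_mem] at h2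
    have h3 : γ * n / 2 * h ≤ B.card * h := by linarith
    exact le_of_mul_le_mul_right h3 hhpos
  refine ⟨A₀, B, by linarith, hBcard, ?_⟩
  intro u hu z hz
  have hu := (Finset.mem_filter.mp hu).2
  have hz := (Finset.mem_filter.mp hz).2
  -- Of the at least `γh/2` neighbours of `u` in `N`, at most `γh/4` have small codegree with `z`.
  have hsub : (N.filter fun a => R a u) ⊆
      (univ.filter fun a => R a u ∧ ε * n ≤ co a z) ∪ nbad z := by
    intro a ha
    obtain ⟨haN, hau⟩ := Finset.mem_filter.mp ha
    rw [Finset.mem_union]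
    by_cases hc : co a z < ε * n
    · exact Or.inr (Finset.mem_filter.mpr ⟨haN, hc⟩)
    · exact Or.inl (Finset.mem_filter.mpr ⟨Finset.mem_univ _, hau, not_lt.mp hc⟩)
  have h1 : ((N.filter fun a => R a u).card : ℝ) ≤
      (univ.filter fun a => R a u ∧ ε * n ≤ co a z).card + (nbad z).card := by
    exact_mod_cast (Finset.card_le_card hsub).trans (Finset.card_union_le _ _)
  have h2 : γ / 4 * (γ * m / 2) ≤ γ / 4 * h := mul_le_mul_of_nonneg_left hh0 (by positivity)
  have h3 : γ ^ 2 * m / 8 ≤ ((univ.filter fun a => R a u ∧ ε * n ≤ co a z).card : ℝ) := by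
    linarith
  exact h3

end absorber

section absorber

open Finset

/-- The number of functions agreeing on two given arguments. -/
theorem card_collision {A C : Type} [Fintype A] [Fintype C] [DecidableEq A] [DecidableEq C]
    {a a' : A} (h : a ≠ a') :
    ((univ.filter fun g : A → C => g a = g a').card : ℝ) * (Fintype.card C : ℝ) ^ 2 =
      (Fintype.card C : ℝ) ^ Fintype.card A * Fintype.card C := by
  let B : Bool ↪ A := ⟨fun b => if b then a else a', by
    intro b b' hb
    cases b <;> cases b' <;> simp_all [eq_comm]⟩
  have h1 := sum_comp_embedding (Ω := C) B
    (fun z => if z true = z false then (1 : ℝ) else 0)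
  rw [Finset.sum_boole, Finset.sum_boole, Fintype.card_bool] at h1
  have h2 : (univ.filter fun z : Bool → C => z true = z false).card = Fintype.card C := by
    rw [← Finset.card_univ]
    symm
    refine Finset.card_bij (fun c _ _ => c) ?_ ?_ ?_
    · intro c _
      simp
    · intro c _ c' _ hcc
      exact congrFun hcc true
    · intro z hz
      refine ⟨z true, Finset.mem_univ _, ?_⟩
      funext b
      cases b
      · exact (Finset.mem_filter.mp hz).2
      · rfl
  rw [h2] at h1
  exact h1

open Classical in
/-- Some function has few collisions and many successes for every one of a small family of
systems of large target sets. -/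
theorem exists_good_function {A C I : Type} [Fintype A] [Fintype C] [Fintype I] {μ : ℝ}
    (P : I → A → Finset C) (hC : 0 < Fintype.card C) (hA : 0 < Fintype.card A)
    (hP : ∀ i, μ * Fintype.card C ≤ ∑ a, ((P i a).card : ℝ))
    (hI : Fintype.card I * Real.exp (-(μ / 8)) < 1 / 2) :
    ∃ g : A → C, (∀ i, μ / 2 < ((univ.filter fun a => g a ∈ P i a).card : ℝ)) ∧
      ((univ.filter fun a => ∃ a', a' ≠ a ∧ g a' = g a).card : ℝ) ≤
        2 * (Fintype.card A : ℝ) ^ 2 / Fintype.card C := by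
  have hne : Nonempty C := Fintype.card_pos_iff.mp hC
  set m : ℝ := (Fintype.card A : ℝ) with hm
  set n : ℝ := (Fintype.card C : ℝ) with hn
  have hm0 : 0 < m := by rw [hm]; exact_mod_cast hA
  have hn0 : 0 < n := by rw [hn]; exact_mod_cast hC
  set tot : ℝ := n ^ Fintype.card A with htot
  have htot0 : 0 < tot := by positivity
  let bad : I → Finset (A → C) := fun i => univ.filter fun g =>
    ((univ.filter fun a => g a ∈ P i a).card : ℝ) ≤ μ / 2
  let Z : (A → C) → ℝ := fun g => ((univ.filter fun a => ∃ a', a' ≠ a ∧ g a' = g a).card : ℝ)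
  let col : Finset (A → C) := univ.filter fun g => 2 * m ^ 2 / n < Z g
  have hbad : ∀ i, ((bad i).card : ℝ) ≤ tot * Real.exp (-(μ / 8)) := by
    intro i
    have := card_chernoff_le (P i) (hP i)
    convert this
  have hZ : ∑ g, Z g ≤ tot * (m ^ 2 / n) := by
    have h1 : ∀ g, Z g ≤ ∑ p : A × A, if p.1 ≠ p.2 ∧ g p.1 = g p.2 then (1 : ℝ) else 0 := by
      intro g
      rw [Finset.sum_boole]
      refine Nat.cast_le.mpr ?_
      calc _ ≤ ((univ.filter fun p : A × A => p.1 ≠ p.2 ∧ g p.1 = g p.2).image Prod.snd).card := by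
            refine Finset.card_le_card fun a ha => ?_
            obtain ⟨a', h1, h2⟩ := (Finset.mem_filter.mp ha).2
            exact Finset.mem_image.mpr ⟨(a', a), by simp [h1, h2], rfl⟩
        _ ≤ _ := Finset.card_image_le
    calc ∑ g, Z g ≤ ∑ g : A → C, ∑ p : A × A,
          if p.1 ≠ p.2 ∧ g p.1 = g p.2 then (1 : ℝ) else 0 := Finset.sum_le_sum fun g _ => h1 g
      _ = ∑ p : A × A, ∑ g : A → C, if p.1 ≠ p.2 ∧ g p.1 = g p.2 then (1 : ℝ) else 0 :=
          Finset.sum_comm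
      _ ≤ ∑ p : A × A, tot / n := by
          refine Finset.sum_le_sum fun p _ => ?_
          by_cases hp : p.1 = p.2
          · simp only [hp, ne_eq, not_true_eq_false, false_and, if_false, Finset.sum_const_zero]
            positivity
          · simp only [ne_eq, hp, not_false_eq_true, true_and]
            rw [Finset.sum_boole]
            have := card_collision (C := C) hp
            rw [le_div_iff₀ hn0]
            refine le_of_mul_le_mul_right ?_ hn0
            have e1 : ((univ.filter fun g : A → C => g p.1 = g p.2).card : ℝ) * n * n =
                tot * n := by
              rw [← hn] at this
              rw [← this]; ring
            exact e1.le
      _ = _ := by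
          rw [Finset.sum_const, nsmul_eq_mul, Finset.card_univ, Fintype.card_prod]
          push_cast
          rw [← hm]
          field_simp
  have hcol : (col.card : ℝ) ≤ tot / 2 := by
    have h1 : (col.card : ℝ) * (2 * m ^ 2 / n) ≤ ∑ g, Z g := by
      calc _ ≤ ∑ g ∈ col, Z g := by
            rw [← nsmul_eq_mul]
            exact Finset.card_nsmul_le_sum _ _ _ fun g hg => (Finset.mem_filter.mp hg).2.le
        _ ≤ _ := Finset.sum_le_sum_of_subset_of_nonneg (Finset.filter_subset _ _)
            fun _ _ _ => by positivity
    have h2 : (col.card : ℝ) * (2 * m ^ 2 / n) ≤ tot / 2 * (2 * m ^ 2 / n) := by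
      calc _ ≤ _ := h1.trans hZ
        _ = _ := by ring
    exact le_of_mul_le_mul_right h2 (by positivity)
  by_contra hcon
  push Not at hcon
  -- Fewer than half of all functions fail some target system, by the Chernoff bound and `hI`, and
  -- at most half have too many collisions, by Markov's inequality.
  have hcover : (univ : Finset (A → C)) ⊆ (univ.biUnion bad) ∪ col := by
    intro g _
    rw [Finset.mem_union]
    by_cases hg : ∀ i, μ / 2 < ((univ.filter fun a => g a ∈ P i a).card : ℝ)
    · exact Or.inr (Finset.mem_filter.mpr ⟨Finset.mem_univ _, hcon g hg⟩)
    · push Not at hg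
      obtain ⟨i, hi⟩ := hg
      exact Or.inl (Finset.mem_biUnion.mpr ⟨i, Finset.mem_univ _,
        Finset.mem_filter.mpr ⟨Finset.mem_univ _, hi⟩⟩)
  have h1 : tot ≤ (univ.biUnion bad).card + col.card := by
    have h2 := (Finset.card_le_card hcover).trans (Finset.card_union_le _ _)
    rw [Finset.card_univ, Fintype.card_fun] at h2
    rw [htot, hn]
    exact_mod_cast h2
  have h2 : ((univ.biUnion bad).card : ℝ) ≤ Fintype.card I * (tot * Real.exp (-(μ / 8))) := by
    calc ((univ.biUnion bad).card : ℝ) ≤ ∑ i, ((bad i).card : ℝ) := by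
          exact_mod_cast Finset.card_biUnion_le
      _ ≤ ∑ i : I, tot * Real.exp (-(μ / 8)) := Finset.sum_le_sum fun i _ => hbad i
      _ = _ := by rw [Finset.sum_const, nsmul_eq_mul, Finset.card_univ]
  have h3 : Fintype.card I * (tot * Real.exp (-(μ / 8))) < tot * (1 / 2) := by
    calc _ = tot * (Fintype.card I * Real.exp (-(μ / 8))) := by ring
      _ < _ := mul_lt_mul_of_pos_left hI htot0
  linarith

open Classical in
-- Reserve `l` elements `Z` of `A` and match the others injectively to colours outside `B₁`; the
-- image of this matching is `B₀`. Given `U`, pair each `z ∈ Z` with some `u ∈ U` and choose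
-- distinct matched elements `a` with `R a u` and `R z (g a)`: moving `a` to `u` frees the colour `g
-- a` for `z`. Dependent random choice provides many such paths for every pair `(u, z)`, and a
-- random function `g` realises many of them simultaneously.
theorem exists_absorber_core {A C : Type} [Fintype A] [Fintype C] (R : A → C → Prop) {γ : ℝ}
    (hγ : 0 < γ) (hγ1 : γ ≤ 1) (hA : 0 < Fintype.card A) (hC : 0 < Fintype.card C)
    (hdeg : ∀ a, γ * Fintype.card C ≤ ((univ.filter fun c => R a c).card : ℝ)) {l b : ℕ}
    (hm : 8 * (Fintype.card A : ℝ) ≤ γ ^ 5 / 512 * Fintype.card C)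
    (hl : 4 * (l : ℝ) ≤ γ ^ 5 / 512 * Fintype.card A)
    (hb : (b : ℝ) ≤ γ ^ 5 / 512 * Fintype.card C)
    (hexp : (b : ℝ) * l * Real.exp (-(γ ^ 5 / 512 * Fintype.card A / 8)) < 1 / 2) :
    ∃ B₀ B₁ : Finset C, Disjoint B₀ B₁ ∧ B₀.card + l = Fintype.card A ∧ B₁.card = b ∧
      ∀ U ⊆ B₁, U.card = l → ∃ ψ : A → C, Function.Injective ψ ∧
        ∀ a, R a (ψ a) ∧ ψ a ∈ B₀ ∪ U := by
  set m : ℝ := (Fintype.card A : ℝ) with hmdef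
  set n : ℝ := (Fintype.card C : ℝ) with hndef
  have hm0 : 0 < m := by rw [hmdef]; exact_mod_cast hA
  have hn0 : 0 < n := by rw [hndef]; exact_mod_cast hC
  have hne : Nonempty C := Fintype.card_pos_iff.mp hC
  have hneA : Nonempty A := Fintype.card_pos_iff.mp hA
  set κ : ℝ := γ ^ 5 / 512 with hκ
  have hκ0 : 0 < κ := by positivity
  have hg5 : γ ^ 5 ≤ γ ^ 3 := pow_le_pow_of_le_one hγ.le hγ1 (by norm_num)
  have hg2 : γ ^ 5 ≤ γ ^ 2 := pow_le_pow_of_le_one hγ.le hγ1 (by norm_num)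
  have hg1 : γ ^ 5 ≤ γ := by
    simpa using pow_le_pow_of_le_one hγ.le hγ1 (show 1 ≤ 5 by norm_num)
  have hgκ : κ ≤ γ / 512 := by rw [hκ]; linarith
  have hgκ2 : κ ≤ γ ^ 2 / 512 := by rw [hκ]; linarith
  have hgκ3 : κ ≤ γ ^ 3 / 512 := by rw [hκ]; linarith
  obtain ⟨A₀, Bc, hA₀, hBc, hpaths⟩ := exists_many_paths R hγ hA hC hdeg
  obtain ⟨Z, hZA, hZ⟩ : ∃ Z ⊆ A₀, Z.card = l := by
    refine Finset.exists_subset_card_eq ?_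
    have : (l : ℝ) ≤ A₀.card := by
      have : κ * m ≤ γ / 512 * m := mul_le_mul_of_nonneg_right hgκ hm0.le
      have : 0 < γ * m := by positivity
      linarith
    exact_mod_cast this
  obtain ⟨B₁, hB₁c, hB₁⟩ : ∃ B₁ ⊆ Bc, B₁.card = b := by
    refine Finset.exists_subset_card_eq ?_
    have : (b : ℝ) ≤ Bc.card := by
      have : κ * n ≤ γ / 512 * n := mul_le_mul_of_nonneg_right hgκ hn0.le
      have : 0 < γ * n := by positivity
      linarith
    exact_mod_cast this
  -- The colours `c` completing a path `u - a - c - z`. The conditions `a ∉ Z` and `c ∉ B₁` keep the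
  -- fixed matching apart from the reserved elements and the flexible colours.
  let P : B₁ × Z → A → Finset C := fun p a =>
    if R a p.1.1 ∧ a ∉ Z then univ.filter fun c => R a c ∧ R p.2.1 c ∧ c ∉ B₁ else ∅
  have hP : ∀ p, κ * m * n ≤ ∑ a, ((P p a).card : ℝ) := by
    intro p
    have h1 := hpaths p.1.1 (hB₁c p.1.2) p.2.1 (hZA p.2.2)
    set G := univ.filter fun a => R a p.1.1 ∧
      γ ^ 3 / 16 * n ≤ ((univ.filter fun c => R a c ∧ R p.2.1 c).card : ℝ) with hG
    have h2 : γ ^ 2 * m / 16 ≤ ((G \ Z).card : ℝ) := by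
      have h3 : (G.card : ℝ) ≤ (G \ Z).card + l := by
        rw [← hZ]
        exact_mod_cast Finset.card_le_card_sdiff_add_card
      have h4 : κ * m ≤ γ ^ 2 / 512 * m := mul_le_mul_of_nonneg_right hgκ2 hm0.le
      have : 0 < γ ^ 2 * m := by positivity
      linarith
    have h3 : ∀ a ∈ G \ Z, γ ^ 3 / 32 * n ≤ ((P p a).card : ℝ) := by
      intro a ha
      obtain ⟨haG, haZ⟩ := Finset.mem_sdiff.mp ha
      obtain ⟨-, hR, hco⟩ := Finset.mem_filter.mp haG
      have h4 : P p a = univ.filter fun c => R a c ∧ R p.2.1 c ∧ c ∉ B₁ := if_pos ⟨hR, haZ⟩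
      have h5 : (univ.filter fun c => R a c ∧ R p.2.1 c) \ B₁ ⊆ P p a := by
        rw [h4]
        intro c hc
        obtain ⟨hc, hcB⟩ := Finset.mem_sdiff.mp hc
        obtain ⟨-, hc1, hc2⟩ := Finset.mem_filter.mp hc
        exact Finset.mem_filter.mpr ⟨Finset.mem_univ _, hc1, hc2, hcB⟩
      have h6 : ((univ.filter fun c => R a c ∧ R p.2.1 c).card : ℝ) ≤ (P p a).card + b := by
        rw [← hB₁]
        exact_mod_cast Finset.card_le_card_sdiff_add_card.trans
          (Nat.add_le_add_right (Finset.card_le_card h5) _)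
      have h7 : κ * n ≤ γ ^ 3 / 512 * n := mul_le_mul_of_nonneg_right hgκ3 hn0.le
      have : 0 < γ ^ 3 * n := by positivity
      linarith
    -- The constant `γ⁵/512` is the product of the factors `γ²/16` and `γ³/32` left after discarding
    -- `Z` and `B₁`.
    calc κ * m * n = (γ ^ 2 * m / 16) * (γ ^ 3 / 32 * n) := by rw [hκ]; ring
      _ ≤ (G \ Z).card * (γ ^ 3 / 32 * n) := mul_le_mul_of_nonneg_right h2 (by positivity)
      _ ≤ ∑ a ∈ G \ Z, ((P p a).card : ℝ) := by
        rw [← nsmul_eq_mul]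
        exact Finset.card_nsmul_le_sum _ _ _ h3
      _ ≤ _ := Finset.sum_le_sum_of_subset_of_nonneg (Finset.subset_univ _)
        fun _ _ _ => by positivity
  obtain ⟨g, hg, hcoll⟩ := exists_good_function P hC hA hP (by
    rw [Fintype.card_prod, Fintype.card_coe, Fintype.card_coe, hB₁, hZ]
    push_cast
    exact hexp)
  set X : Finset A := univ.filter fun a => ∃ a', a' ≠ a ∧ g a' = g a with hX
  have hXcard : (X.card : ℝ) ≤ κ * m / 4 := by
    refine hcoll.trans ?_
    rw [← hmdef, ← hndef, div_le_iff₀ hn0]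
    nlinarith [mul_le_mul_of_nonneg_left hm hm0.le]
  set Gd : Finset A := univ.filter fun a => a ∉ Z ∧ a ∉ X ∧ R a (g a) ∧ g a ∉ B₁ with hGd
  set Rest : Finset A := univ.filter fun a => a ∉ Z ∧ a ∉ Gd with hRest
  -- Elements on which `g` collides or is unusable are matched greedily: `γn` neighbours suffice,
  -- since at most `b + m` colours are forbidden and at most `m` elements have to be matched.
  obtain ⟨s, hsinj, hs⟩ := exists_injOn_choice Rest
    (fun a => (univ.filter fun c => R a c) \ (B₁ ∪ Gd.image g)) (by
      intro a _
      have h1 : ((univ.filter fun c => R a c).card : ℝ) ≤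
          ((univ.filter fun c => R a c) \ (B₁ ∪ Gd.image g)).card + (b + m) := by
        have h2 : (univ.filter fun c => R a c).card ≤
            ((univ.filter fun c => R a c) \ (B₁ ∪ Gd.image g)).card + (b + Fintype.card A) := by
          refine Finset.card_le_card_sdiff_add_card.trans (Nat.add_le_add_left ?_ _)
          refine (Finset.card_union_le _ _).trans ?_
          rw [hB₁]
          exact Nat.add_le_add_left (Finset.card_image_le.trans (Finset.card_le_univ _)) _
        rw [hmdef]
        exact_mod_cast h2
      have h3 : (Rest.card : ℝ) ≤ m := by
        rw [hmdef]; exact_mod_cast Finset.card_le_univ _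
      have h4 := hdeg a
      have h5 : κ * n ≤ γ / 512 * n := mul_le_mul_of_nonneg_right hgκ hn0.le
      have : 0 < γ * n := by positivity
      have h6 : (Rest.card : ℝ) ≤
          (((univ.filter fun c => R a c) \ (B₁ ∪ Gd.image g)).card : ℝ) := by linarith
      exact_mod_cast h6)
  let M₀ : A → C := fun a => if a ∈ Gd then g a else s a
  have hGdg : ∀ a ∈ Gd, M₀ a = g a := fun a ha => if_pos ha
  have hM₀R : ∀ a ∉ Z, R a (M₀ a) ∧ M₀ a ∉ B₁ := by
    intro a ha
    by_cases haG : a ∈ Gd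
    · rw [hGdg a haG]
      exact (Finset.mem_filter.mp haG).2.2.2
    · have h1 : M₀ a = s a := if_neg haG
      have h2 := hs a (Finset.mem_filter.mpr ⟨Finset.mem_univ _, ha, haG⟩)
      rw [Finset.mem_sdiff, Finset.mem_union, not_or] at h2
      rw [h1]
      exact ⟨(Finset.mem_filter.mp h2.1).2, h2.2.1⟩
  have hM₀inj : ∀ a ∉ Z, ∀ a' ∉ Z, M₀ a = M₀ a' → a = a' := by
    intro a ha a' ha' haa
    have hmix : ∀ x ∈ Gd, ∀ y ∉ Gd, y ∉ Z → M₀ x ≠ M₀ y := by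
      intro x hx y hy hyZ hxy
      have h1 : M₀ y = s y := if_neg hy
      have h2 := hs y (Finset.mem_filter.mpr ⟨Finset.mem_univ _, hyZ, hy⟩)
      rw [Finset.mem_sdiff, Finset.mem_union, not_or] at h2
      refine h2.2.2 ?_
      rw [← h1, ← hxy, hGdg x hx]
      exact Finset.mem_image_of_mem _ hx
    by_cases h1 : a ∈ Gd <;> by_cases h2 : a' ∈ Gd
    · rw [hGdg a h1, hGdg a' h2] at haa
      by_contra hne
      refine (Finset.mem_filter.mp h1).2.2.1 (Finset.mem_filter.mpr ⟨Finset.mem_univ _, a', ?_, ?_⟩)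
      · exact fun h => hne h.symm
      · exact haa.symm
    · exact absurd haa (hmix a h1 a' h2 ha')
    · exact absurd haa.symm (hmix a' h2 a h1 ha)
    · have e1 : M₀ a = s a := if_neg h1
      have e2 : M₀ a' = s a' := if_neg h2
      rw [e1, e2] at haa
      exact hsinj (Finset.mem_coe.mpr (Finset.mem_filter.mpr ⟨Finset.mem_univ _, ha, h1⟩))
        (Finset.mem_coe.mpr (Finset.mem_filter.mpr ⟨Finset.mem_univ _, ha', h2⟩)) haa
  refine ⟨(univ \ Z).image M₀, B₁, ?_, ?_, hB₁, ?_⟩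
  · rw [Finset.disjoint_left]
    intro c hc
    obtain ⟨a, ha, rfl⟩ := Finset.mem_image.mp hc
    exact (hM₀R a (Finset.mem_sdiff.mp ha).2).2
  · rw [Finset.card_image_of_injOn, Finset.card_sdiff_of_subset (Finset.subset_univ _),
      Finset.card_univ, hZ]
    · have : Z.card ≤ Fintype.card A := Finset.card_le_univ _
      omega
    · intro a ha a' ha' h
      exact hM₀inj a (Finset.mem_sdiff.mp (Finset.mem_coe.mp ha)).2 a'
        (Finset.mem_sdiff.mp (Finset.mem_coe.mp ha')).2 h
  · intro U hU hUl
    have hθ : Nonempty (Z ≃ U) :=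
      ⟨Fintype.equivOfCardEq (by rw [Fintype.card_coe, Fintype.card_coe, hZ, hUl])⟩
    obtain ⟨θ⟩ := hθ
    -- More than `κm/2` realised paths, less at most `κm/4` elements with collisions, leave at least
    -- `l` choices for each pair, so the `σ z` can be taken distinct.
    obtain ⟨σ, hσinj, hσ⟩ := exists_injOn_choice (univ : Finset Z)
      (fun z => Gd.filter fun a => R a (θ z).1 ∧ R z.1 (g a)) (by
        intro z _
        rw [Finset.card_univ, Fintype.card_coe, hZ]
        have h1 := hg (⟨(θ z).1, hU (θ z).2⟩, z)
        set S := univ.filter fun a => g a ∈ P (⟨(θ z).1, hU (θ z).2⟩, z) a with hS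
        have h2 : S ⊆ (Gd.filter fun a => R a (θ z).1 ∧ R z.1 (g a)) ∪ X := by
          intro a ha
          have ha := (Finset.mem_filter.mp ha).2
          rw [Finset.mem_union]
          by_cases haX : a ∈ X
          · exact Or.inr haX
          left
          by_cases hc : R a (θ z).1 ∧ a ∉ Z
          · have h4 : P (⟨(θ z).1, hU (θ z).2⟩, z) a =
                univ.filter fun c => R a c ∧ R z.1 c ∧ c ∉ B₁ := if_pos hc
            rw [h4] at ha
            obtain ⟨-, h5, h6, h7⟩ := Finset.mem_filter.mp ha
            exact Finset.mem_filter.mpr ⟨Finset.mem_filter.mpr ⟨Finset.mem_univ _, hc.2, haX, h5, h7⟩,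
              hc.1, h6⟩
          · have h4 : P (⟨(θ z).1, hU (θ z).2⟩, z) a = ∅ := if_neg hc
            rw [h4] at ha
            exact absurd ha (Finset.notMem_empty _)
        have h3 : (S.card : ℝ) ≤ (Gd.filter fun a => R a (θ z).1 ∧ R z.1 (g a)).card + X.card := by
          exact_mod_cast (Finset.card_le_card h2).trans (Finset.card_union_le _ _)
        have h4 : (l : ℝ) ≤ (Gd.filter fun a => R a (θ z).1 ∧ R z.1 (g a)).card := by linarith
        exact_mod_cast h4)
    have hσGd : ∀ z, σ z ∈ Gd := fun z => (Finset.mem_filter.mp (hσ z (Finset.mem_univ _))).1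
    have hσZ : ∀ z, σ z ∉ Z := fun z => (Finset.mem_filter.mp (hσGd z)).2.1
    have hσi : Function.Injective σ := fun z z' h =>
      hσinj (Finset.mem_coe.mpr (Finset.mem_univ z)) (Finset.mem_coe.mpr (Finset.mem_univ z')) h
    let ψ : A → C := fun a => if h : a ∈ Z then M₀ (σ ⟨a, h⟩) else
      if h' : ∃ z, σ z = a then (θ h'.choose).1 else M₀ a
    have hψZ : ∀ z : Z, ψ z.1 = M₀ (σ z) := fun z => dif_pos z.2
    have hψσ : ∀ z : Z, ψ (σ z) = (θ z).1 := by
      intro z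
      have hex : ∃ z', σ z' = σ z := ⟨z, rfl⟩
      have h1 : ψ (σ z) = (θ hex.choose).1 := by
        simp only [ψ, dif_neg (hσZ z), dif_pos hex]
      rw [h1, hσi hex.choose_spec]
    have hψo : ∀ a, a ∉ Z → (¬ ∃ z, σ z = a) → ψ a = M₀ a := by
      intro a ha ha'
      simp only [ψ, dif_neg ha, dif_neg ha']
    have hcases : ∀ a, (∃ z : Z, a = z.1) ∨ (∃ z, a = σ z) ∨ (a ∉ Z ∧ ¬ ∃ z, σ z = a) := by
      intro a
      by_cases h1 : a ∈ Z
      · exact Or.inl ⟨⟨a, h1⟩, rfl⟩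
      · by_cases h2 : ∃ z, σ z = a
        · obtain ⟨z, hz⟩ := h2
          exact Or.inr (Or.inl ⟨z, hz.symm⟩)
        · exact Or.inr (Or.inr ⟨h1, h2⟩)
    have hMU : ∀ a ∉ Z, ∀ z, M₀ a ≠ (θ z).1 := fun a ha z h =>
      (hM₀R a ha).2 (h ▸ hU (θ z).2)
    refine ⟨ψ, ?_, ?_⟩
    · intro a a' haa
      rcases hcases a with ⟨z, rfl⟩ | ⟨z, rfl⟩ | ⟨h1, h2⟩ <;>
      rcases hcases a' with ⟨z', rfl⟩ | ⟨z', rfl⟩ | ⟨h1', h2'⟩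
      · rw [hψZ, hψZ] at haa
        rw [hσi (hM₀inj _ (hσZ z) _ (hσZ z') haa)]
      · rw [hψZ, hψσ] at haa
        exact absurd haa (hMU _ (hσZ z) z')
      · rw [hψZ, hψo a' h1' h2'] at haa
        exact absurd ⟨z, hM₀inj _ (hσZ z) _ h1' haa⟩ h2'
      · rw [hψZ, hψσ] at haa
        exact absurd haa.symm (hMU _ (hσZ z') z)
      · rw [hψσ, hψσ] at haa
        rw [θ.injective (Subtype.ext haa)]
      · rw [hψσ, hψo a' h1' h2'] at haa
        exact absurd haa.symm (hMU _ h1' z)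
      · rw [hψZ, hψo a h1 h2] at haa
        exact absurd ⟨z', (hM₀inj _ h1 _ (hσZ z') haa).symm⟩ h2
      · rw [hψσ, hψo a h1 h2] at haa
        exact absurd haa (hMU _ h1 z')
      · rw [hψo a h1 h2, hψo a' h1' h2'] at haa
        exact hM₀inj _ h1 _ h1' haa
    · have hin : ∀ a ∉ Z, M₀ a ∈ (univ \ Z).image M₀ ∪ U := fun a ha =>
        Finset.mem_union_left _ (Finset.mem_image_of_mem _
          (Finset.mem_sdiff.mpr ⟨Finset.mem_univ _, ha⟩))
      intro a
      rcases hcases a with ⟨z, rfl⟩ | ⟨z, rfl⟩ | ⟨h1, h2⟩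
      · rw [hψZ]
        refine ⟨?_, hin _ (hσZ z)⟩
        rw [hGdg _ (hσGd z)]
        exact (Finset.mem_filter.mp (hσ z (Finset.mem_univ _))).2.2
      · rw [hψσ]
        exact ⟨(Finset.mem_filter.mp (hσ z (Finset.mem_univ _))).2.1,
          Finset.mem_union_right _ (θ z).2⟩
      · rw [hψo a h1 h2]
        exact ⟨(hM₀R a h1).1, hin a h1⟩

end absorber

/-! ### Blocks of bounded size and rainbow chains inside them -/

section blocks

open Finset

open Classical in
/-- A permutation moves a family of embeddings so that few of them are bad. -/
theorem exists_perm_few_bad {κ ι J : Type} [Fintype κ] [Fintype ι] [Fintype J]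
    (b : J → (κ ↪ ι)) (bad : (κ ↪ ι) → Prop) {p : ℝ} (hne : 0 < Fintype.card (κ ↪ ι))
    (hbad : ((univ.filter bad).card : ℝ) ≤ p * Fintype.card (κ ↪ ι)) :
    ∃ σ : Equiv.Perm ι, ((univ.filter fun j => bad ((b j).trans σ.toEmbedding)).card : ℝ) ≤
      p * Fintype.card J := by
  by_contra hcon
  push Not at hcon
  set I : ℝ := (Fintype.card (κ ↪ ι) : ℝ) with hI
  have hI0 : 0 < I := by rw [hI]; exact_mod_cast hne
  have hS0 : (0 : ℝ) < Fintype.card (Equiv.Perm ι) := by exact_mod_cast Fintype.card_pos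
  have h1 : ∑ σ : Equiv.Perm ι, p * (Fintype.card J : ℝ) <
      ∑ σ : Equiv.Perm ι,
        ((univ.filter fun j => bad ((b j).trans σ.toEmbedding)).card : ℝ) :=
    Finset.sum_lt_sum_of_nonempty Finset.univ_nonempty fun σ _ => hcon σ
  have h2 : (∑ σ : Equiv.Perm ι,
      ((univ.filter fun j => bad ((b j).trans σ.toEmbedding)).card : ℝ)) * I =
      Fintype.card J * (Fintype.card (Equiv.Perm ι) * ((univ.filter bad).card : ℝ)) := by
    have h3 : ∀ σ : Equiv.Perm ι,
        ((univ.filter fun j => bad ((b j).trans σ.toEmbedding)).card : ℝ) =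
        ∑ j, if bad ((b j).trans σ.toEmbedding) then (1 : ℝ) else 0 := fun σ => by
      rw [Finset.sum_boole]
    rw [Finset.sum_congr rfl fun σ _ => h3 σ, Finset.sum_comm, Finset.sum_mul]
    have h4 : ∀ j : J, (∑ σ : Equiv.Perm ι,
        if bad ((b j).trans σ.toEmbedding) then (1 : ℝ) else 0) * I =
        Fintype.card (Equiv.Perm ι) * ((univ.filter bad).card : ℝ) := by
      intro j
      rw [hI, sum_perm_trans (fun x => if bad x then (1 : ℝ) else 0) (b j), Finset.sum_boole]
    rw [Finset.sum_congr rfl fun j _ => h4 j, Finset.sum_const, nsmul_eq_mul, Finset.card_univ]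
  rw [Finset.sum_const, nsmul_eq_mul, Finset.card_univ] at h1
  have h3 := mul_lt_mul_of_pos_right h1 hI0
  rw [h2] at h3
  have h4 : (Fintype.card J : ℝ) * (Fintype.card (Equiv.Perm ι) * ((univ.filter bad).card : ℝ)) ≤
      Fintype.card J * (Fintype.card (Equiv.Perm ι) * (p * I)) := by gcongr
  have h5 : (Fintype.card (Equiv.Perm ι) : ℝ) * (p * Fintype.card J) * I =
      Fintype.card J * (Fintype.card (Equiv.Perm ι) * (p * I)) := by ring
  linarith

open Classical in
/-- Disjoint blocks, almost covering the ground set, each of which is bad for few colours. -/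
theorem exists_good_blocks {M N s : ℕ} (hs : 1 ≤ s) (hsN : s ≤ N)
    (bad : Fin M → (Fin s ↪ Fin N) → Prop) (C : Finset (Fin M)) {p e : ℝ} (he : 0 < e)
    (hC : 0 < C.card)
    (hp : ∀ i ∈ C, ((univ.filter (bad i)).card : ℝ) ≤ p * Fintype.card (Fin s ↪ Fin N)) :
    ∃ (x : ℕ → (Fin s ↪ Fin N)) (J : ℕ), (1 - p / e) * ((N / s : ℕ) : ℝ) ≤ J ∧
      (∀ j < J, ((C.filter fun i => bad i (x j)).card : ℝ) ≤ e * C.card) ∧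
      ∀ i < J, ∀ j < J, i ≠ j → Disjoint (univ.map (x i)) (univ.map (x j)) := by
  set Q := N / s with hQ
  have hQN : Q * s ≤ N := Nat.div_mul_le_self N s
  let b : Fin Q → (Fin s ↪ Fin N) := fun j =>
    ⟨fun i => ⟨j.1 * s + i.1, by
      have h1 : (j.1 + 1) * s ≤ Q * s := Nat.mul_le_mul_right _ j.2
      have := i.2
      rw [Nat.succ_mul] at h1
      omega⟩, fun i i' h => by
      have : j.1 * s + i.1 = j.1 * s + i'.1 := congrArg Fin.val h
      exact Fin.ext (by omega)⟩
  have hne : 0 < Fintype.card (Fin s ↪ Fin N) :=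
    Fintype.card_pos_iff.mpr ⟨Fin.castLEEmb hsN⟩
  have hC0 : (0 : ℝ) < C.card := by exact_mod_cast hC
  -- If each colour of `C` is bad for a `p`-fraction of injections, Markov's inequality shows that
  -- at most a `p/e`-fraction of injections is bad for more than `e|C|` colours. Some permutation of
  -- a fixed partition into blocks does at least as well as the average.
  let poor : (Fin s ↪ Fin N) → Prop := fun x =>
    e * C.card < ((C.filter fun i => bad i x).card : ℝ)
  have hpoor : ((univ.filter poor).card : ℝ) ≤ p / e * Fintype.card (Fin s ↪ Fin N) := by
    have h1 : ((univ.filter poor).card : ℝ) * (e * C.card) ≤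
        ∑ x : Fin s ↪ Fin N, ((C.filter fun i => bad i x).card : ℝ) := by
      calc _ ≤ ∑ x ∈ univ.filter poor, ((C.filter fun i => bad i x).card : ℝ) := by
            rw [← nsmul_eq_mul]
            exact Finset.card_nsmul_le_sum _ _ _ fun x hx => (Finset.mem_filter.mp hx).2.le
        _ ≤ _ := Finset.sum_le_sum_of_subset_of_nonneg (Finset.filter_subset _ _)
            fun _ _ _ => by positivity
    have h2 : ∑ x : Fin s ↪ Fin N, ((C.filter fun i => bad i x).card : ℝ) ≤
        C.card * (p * Fintype.card (Fin s ↪ Fin N)) := by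
      have h3 : ∀ x : Fin s ↪ Fin N, ((C.filter fun i => bad i x).card : ℝ) =
          ∑ i ∈ C, if bad i x then (1 : ℝ) else 0 := fun x => by rw [Finset.sum_boole]
      rw [Finset.sum_congr rfl fun x _ => h3 x, Finset.sum_comm, ← nsmul_eq_mul]
      refine Finset.sum_le_card_nsmul _ _ _ fun i hi => ?_
      rw [Finset.sum_boole]
      exact hp i hi
    have h3 : ((univ.filter poor).card : ℝ) * (e * C.card) ≤
        p / e * Fintype.card (Fin s ↪ Fin N) * (e * C.card) := by
      calc _ ≤ _ := h1.trans h2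
        _ = _ := by field_simp
    exact le_of_mul_le_mul_right h3 (by positivity)
  obtain ⟨σ, hσ⟩ := exists_perm_few_bad b poor hne hpoor
  set S := univ.filter fun j : Fin Q => ¬ poor ((b j).trans σ.toEmbedding) with hS
  have hScard : (univ.filter fun j : Fin Q => poor ((b j).trans σ.toEmbedding)).card + S.card =
      Q := by
    rw [hS, Finset.card_filter_add_card_filter_not, Finset.card_univ, Fintype.card_fin]
  let x : ℕ → (Fin s ↪ Fin N) := fun j =>
    if h : j < S.card then (b (S.equivFin.symm ⟨j, h⟩).1).trans σ.toEmbedding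
    else Fin.castLEEmb hsN
  have hx : ∀ j (h : j < S.card),
      x j = (b (S.equivFin.symm ⟨j, h⟩).1).trans σ.toEmbedding := fun j h => dif_pos h
  refine ⟨x, S.card, ?_, ?_, ?_⟩
  · rw [Fintype.card_fin] at hσ
    have : ((univ.filter fun j : Fin Q => poor ((b j).trans σ.toEmbedding)).card : ℝ) + S.card =
        Q := by exact_mod_cast hScard
    linarith
  · intro j hj
    rw [hx j hj]
    have := (Finset.mem_filter.mp (S.equivFin.symm ⟨j, hj⟩).2).2
    exact not_lt.mp this
  · intro i hi j hj hij
    rw [hx i hi, hx j hj, Finset.disjoint_left]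
    intro v hv hv'
    obtain ⟨u, _, hu⟩ := Finset.mem_map.mp hv
    obtain ⟨u', _, hu'⟩ := Finset.mem_map.mp hv'
    have h1 : b (S.equivFin.symm ⟨i, hi⟩).1 u = b (S.equivFin.symm ⟨j, hj⟩).1 u' :=
      σ.injective (hu.trans hu'.symm)
    have h2 : (S.equivFin.symm ⟨i, hi⟩).1.1 * s + u.1 =
        (S.equivFin.symm ⟨j, hj⟩).1.1 * s + u'.1 := congrArg Fin.val h1
    have h3 : (S.equivFin.symm ⟨i, hi⟩).1.1 = (S.equivFin.symm ⟨j, hj⟩).1.1 := by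
      have h4 := congrArg (· / s) h2
      simp only [Nat.add_comm (_ * s), Nat.add_mul_div_right _ _ hs,
        Nat.div_eq_of_lt u.2, Nat.div_eq_of_lt u'.2, Nat.zero_add] at h4
      exact h4
    have h4 : S.equivFin.symm ⟨i, hi⟩ = S.equivFin.symm ⟨j, hj⟩ := Subtype.ext (Fin.ext h3)
    have h5 := congrArg Fin.val (S.equivFin.symm.injective h4)
    exact hij h5

end blocks

namespace Link

open Finset

variable {k ℓ m : ℕ} {V : Type} [DecidableEq V]

theorem chainEdges_comp (A : Link k ℓ m) {V' : Type} [DecidableEq V'] (φ : V → V') (f : ℕ → V)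
    (t : ℕ) : A.chainEdges (φ ∘ f) t = (A.chainEdges f t).image (Finset.image φ) := by
  ext s
  rw [mem_chainEdges, Finset.mem_image]
  constructor
  · rintro ⟨q, hq, e, he, rfl⟩
    exact ⟨_, A.mem_chainEdges.mpr ⟨q, hq, e, he, rfl⟩, by rw [Finset.image_image]; rfl⟩
  · rintro ⟨s', hs', rfl⟩
    obtain ⟨q, hq, e, he, rfl⟩ := A.mem_chainEdges.mp hs'
    exact ⟨q, hq, e, he, by rw [Finset.image_image]; rfl⟩

theorem chainVerts_comp (A : Link k ℓ m) {V' : Type} [DecidableEq V'] (φ : V → V') (f : ℕ → V)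
    (t : ℕ) : A.chainVerts (φ ∘ f) t = (A.chainVerts f t).image φ := by
  unfold chainVerts
  rw [Finset.image_image]

theorem chainEdges_comp_subset (A : Link k ℓ m) {V' : Type} [Fintype V] [DecidableEq V']
    (φ : V ↪ V') {H : UniformHypergraph k V'} {f : ℕ → V} {t : ℕ}
    (h : A.chainEdges f t ⊆ (H.comap φ).edges) : A.chainEdges (φ ∘ f) t ⊆ H.edges := by
  rw [chainEdges_comp]
  intro s hs
  obtain ⟨e, he, rfl⟩ := Finset.mem_image.mp hs
  have := (Finset.mem_filter.mp (h he)).2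
  rwa [Finset.map_eq_image] at this

/-- The blocks are treated one at a time. Colours that are unused and good for the block are classed
by the hypergraph they induce on it. There are boundedly many classes, so one has at least as many
colours as the chain has edges. All its colours contain the same Hamilton cycle, so the edges of an
initial segment can receive any distinct colours of the class. -/
theorem exists_rainbow_chains (A : Link k ℓ m) (hlm : ℓ < m) {M s t d : ℕ}
    (H : Fin M → UniformHypergraph k V) (C : Finset (Fin M)) {y : ℝ} (ht : 1 ≤ t)
    (hst : (m - ℓ) * t + ℓ ≤ s)
    (hHam : ∀ G : UniformHypergraph k (Fin s), y ≤ G.minDegree d →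
      ∃ F : UniformHypergraph k (Fin s), A.IsCycle F ∧ F.edges ⊆ G.edges)
    (x : ℕ → (Fin s ↪ V)) (bd J : ℕ)
    (hgood : ∀ j < J, ∃ C' ⊆ C, C'.card ≤ bd ∧
      ∀ i ∈ C, i ∉ C' → y ≤ ((H i).comap (x j)).minDegree d)
    (hC : (J + Fintype.card (Finset (Finset (Fin s)))) *
      (t * A.newEdges.card + A.start.edges.card) + bd ≤ C.card) (hM : 0 < M) :
    ∃ (f : ℕ → ℕ → V) (ψ : Finset V → Fin M),
      (∀ j < J, Set.InjOn (f j) (Set.Iio ((m - ℓ) * t + ℓ)) ∧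
        A.chainVerts (f j) t ⊆ univ.map (x j)) ∧
      Set.InjOn ψ ((range J).biUnion fun j => A.chainEdges (f j) t) ∧
      ∀ e ∈ (range J).biUnion fun j => A.chainEdges (f j) t, ψ e ∈ C ∧ e ∈ (H (ψ e)).edges := by
  classical
  set κ := t * A.newEdges.card + A.start.edges.card with hκ
  have hs0 : 0 < s := by
    have : 0 < (m - ℓ) * t := Nat.mul_pos (by omega) ht
    omega
  induction J with
  | zero =>
    exact ⟨fun _ _ => x 0 ⟨0, hs0⟩, fun _ => ⟨0, hM⟩, by simp, by simp, by simp⟩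
  | succ J ih =>
    obtain ⟨f, ψ, hf, hψ, hψC⟩ := ih (fun j hj => hgood j (by omega)) (by
      refine le_trans ?_ hC
      gcongr
      omega)
    set E := (range J).biUnion fun j => A.chainEdges (f j) t with hE
    have hEcard : E.card ≤ J * κ := by
      have := Finset.card_biUnion_le_card_mul (range J) (fun j => A.chainEdges (f j) t) κ
        fun j hj => (A.card_chainEdges hlm ht (hf j (Finset.mem_range.mp hj)).1).le
      rwa [Finset.card_range] at this
    obtain ⟨C', hC'C, hC'card, hC'⟩ := hgood J (by omega)
    set U := (C \ E.image ψ) \ C' with hU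
    have hUcard : Fintype.card (Finset (Finset (Fin s))) * κ ≤ U.card := by
      have h1 : C.card ≤ U.card + C'.card + (E.image ψ).card := by
        calc C.card ≤ (C \ E.image ψ).card + (E.image ψ).card :=
              Finset.card_le_card_sdiff_add_card
          _ ≤ _ := Nat.add_le_add_right Finset.card_le_card_sdiff_add_card _
      have h2 : (E.image ψ).card ≤ J * κ := Finset.card_image_le.trans hEcard
      have h3 : (J + 1 + Fintype.card (Finset (Finset (Fin s)))) * κ =
          J * κ + κ + Fintype.card (Finset (Finset (Fin s))) * κ := by ring
      omega
    obtain ⟨T, -, hT⟩ := Finset.exists_le_card_fiber_of_mul_le_card_of_maps_to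
      (s := U) (t := (univ : Finset (Finset (Finset (Fin s)))))
      (f := fun i => ((H i).comap (x J)).edges) (n := κ) (fun _ _ => Finset.mem_univ _)
      Finset.univ_nonempty (by rwa [Finset.card_univ])
    set U' := U.filter fun i => ((H i).comap (x J)).edges = T with hU'
    -- the chain in the common type
    have hchain : ∃ g : ℕ → V, Set.InjOn g (Set.Iio ((m - ℓ) * t + ℓ)) ∧
        A.chainVerts g t ⊆ univ.map (x J) ∧
        ∀ i ∈ U', A.chainEdges g t ⊆ (H i).edges := by
      -- The class can be empty only if the chain has no edges; then any injective sequence inside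
      -- the block serves.
      rcases U'.eq_empty_or_nonempty with hemp | ⟨i₀, hi₀⟩
      · refine ⟨fun i => x J ⟨i % s, Nat.mod_lt _ hs0⟩, ?_, ?_, ?_⟩
        · intro a ha b hb hab
          rw [Set.mem_Iio] at ha hb
          have := congrArg Fin.val ((x J).injective hab)
          simpa [Nat.mod_eq_of_lt (ha.trans_le hst), Nat.mod_eq_of_lt (hb.trans_le hst)] using this
        · intro v hv
          obtain ⟨i, _, rfl⟩ := A.mem_chainVerts.mp hv
          exact Finset.mem_map_of_mem _ (Finset.mem_univ _)
        · rw [hemp]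
          intro i hi
          exact absurd hi (Finset.notMem_empty _)
      · obtain ⟨hi₀U, hi₀T⟩ := Finset.mem_filter.mp hi₀
        obtain ⟨h1, h2⟩ := Finset.mem_sdiff.mp hi₀U
        obtain ⟨F, hF, hFG⟩ := hHam _ (hC' i₀ (Finset.mem_sdiff.mp h1).1 h2)
        obtain ⟨g, T', hT', hcard, hginj, hgF⟩ := A.exists_of_isCycle hlm hF
        rw [Fintype.card_fin] at hcard
        have htT : t ≤ T' := by
          have h3 : (m - ℓ) * t ≤ (m - ℓ) * T' := by omega
          exact Nat.le_of_mul_le_mul_left h3 (by omega)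
        refine ⟨x J ∘ g, ?_, ?_, ?_⟩
        · intro a ha b hb hab
          rw [Set.mem_Iio] at ha hb
          exact hginj (Set.mem_Iio.mpr (by omega)) (Set.mem_Iio.mpr (by omega))
            ((x J).injective hab)
        · intro v hv
          obtain ⟨i, _, rfl⟩ := A.mem_chainVerts.mp hv
          exact Finset.mem_map_of_mem _ (Finset.mem_univ _)
        · intro i hi
          refine A.chainEdges_comp_subset (x J) ?_
          rw [(Finset.mem_filter.mp hi).2, ← hi₀T]
          exact (A.chainEdges_mono g htT).trans (hgF.trans hFG)
    obtain ⟨g, hginj, hgV, hgE⟩ := hchain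
    have hgcard := A.card_chainEdges hlm ht hginj
    have : Nonempty (Fin M) := ⟨⟨0, hM⟩⟩
    obtain ⟨χ, hχinj, hχ⟩ := exists_injOn_choice (A.chainEdges g t) (fun _ => U')
      (fun _ _ => by rw [hgcard]; exact hT)
    let f' : ℕ → ℕ → V := fun j => if j < J then f j else g
    let ψ' : Finset V → Fin M := fun e => if e ∈ E then ψ e else χ e
    have hf' : ∀ j < J, f' j = f j := fun j hj => if_pos hj
    have hf'J : f' J = g := if_neg (lt_irrefl J)
    have hE' : ((range (J + 1)).biUnion fun j => A.chainEdges (f' j) t) =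
        A.chainEdges g t ∪ E := by
      rw [Finset.range_add_one, Finset.biUnion_insert, hf'J]
      congr 1
      exact Finset.biUnion_congr rfl fun j hj => by rw [hf' j (Finset.mem_range.mp hj)]
    have hχU : ∀ e ∈ A.chainEdges g t, χ e ∈ C ∧ χ e ∉ E.image ψ := by
      intro e he
      have h1 := (Finset.mem_sdiff.mp (Finset.mem_filter.mp (hχ e he)).1).1
      exact ⟨(Finset.mem_sdiff.mp h1).1, (Finset.mem_sdiff.mp h1).2⟩
    refine ⟨f', ψ', ?_, ?_, ?_⟩
    · intro j hj
      by_cases hjJ : j < J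
      · rw [hf' j hjJ]; exact hf j hjJ
      · obtain rfl : j = J := by omega
        rw [hf'J]; exact ⟨hginj, hgV⟩
    · rw [hE']
      have hin : ∀ e ∈ A.chainEdges g t ∪ E, e ∉ E → e ∈ A.chainEdges g t := fun e he heE =>
        (Finset.mem_union.mp he).resolve_right heE
      intro e he e' he' hee
      rw [Finset.mem_coe] at he he'
      by_cases h1 : e ∈ E <;> by_cases h2 : e' ∈ E
      · simp only [ψ', if_pos h1, if_pos h2] at hee
        exact hψ h1 h2 hee
      · simp only [ψ', if_pos h1, if_neg h2] at hee
        exact absurd (hee ▸ Finset.mem_image_of_mem ψ h1) (hχU e' (hin e' he' h2)).2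
      · simp only [ψ', if_neg h1, if_pos h2] at hee
        exact absurd (hee ▸ Finset.mem_image_of_mem ψ h2) (hχU e (hin e he h1)).2
      · simp only [ψ', if_neg h1, if_neg h2] at hee
        exact hχinj (hin e he h1) (hin e' he' h2) hee
    · rw [hE']
      intro e he
      by_cases h1 : e ∈ E
      · simp only [ψ', if_pos h1]
        exact hψC e h1
      · have h2 := (Finset.mem_union.mp he).resolve_right h1
        simp only [ψ', if_neg h1]
        exact ⟨(hχU e h2).1, hgE _ (hχ e h2) h2⟩

end Link

/-! ### Connecting and merging chains -/

namespace Link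

open Finset

variable {k ℓ m : ℕ} {V : Type} [DecidableEq V]

/-- The inner vertices of the chain of length `t` given by `h`. -/
def interior (_ : Link k ℓ m) (h : ℕ → V) (t : ℕ) : Finset V :=
  (Finset.Ico ℓ ((m - ℓ) * t)).image h

theorem mem_interior (A : Link k ℓ m) {h : ℕ → V} {t : ℕ} {v : V} :
    v ∈ A.interior h t ↔ ∃ i, ℓ ≤ i ∧ i < (m - ℓ) * t ∧ h i = v := by
  simp [interior, and_assoc]

/-- Two disjoint chains joined by a third one. -/
theorem exists_join (A : Link k ℓ m) {g h f : ℕ → V} {t t₁ u : ℕ}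
    (hg : Set.InjOn g (Set.Iio ((m - ℓ) * t + ℓ)))
    (hh : Set.InjOn h (Set.Iio ((m - ℓ) * t₁ + ℓ)))
    (hf : Set.InjOn f (Set.Iio ((m - ℓ) * u + ℓ)))
    (hgh : ∀ i < ℓ, h i = g ((m - ℓ) * t + i)) (hhf : ∀ i < ℓ, h ((m - ℓ) * t₁ + i) = f i)
    (hgf : Disjoint (A.chainVerts g t) (A.chainVerts f u))
    (hIg : Disjoint (A.interior h t₁) (A.chainVerts g t))
    (hIf : Disjoint (A.interior h t₁) (A.chainVerts f u)) :
    ∃ G : ℕ → V, Set.InjOn G (Set.Iio ((m - ℓ) * (t + t₁ + u) + ℓ)) ∧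
      A.chainVerts G (t + t₁ + u) = A.chainVerts g t ∪ A.interior h t₁ ∪ A.chainVerts f u ∧
      A.chainEdges G (t + t₁ + u) =
        A.chainEdges g t ∪ A.chainEdges h t₁ ∪ A.chainEdges f u ∧
      (∀ i < ℓ, G i = g i) ∧ ∀ i < ℓ, G ((m - ℓ) * (t + t₁ + u) + i) = f ((m - ℓ) * u + i) := by
  have hgmem : ∀ i < (m - ℓ) * t + ℓ, g i ∈ A.chainVerts g t := fun i hi =>
    A.mem_chainVerts.mpr ⟨i, hi, rfl⟩
  have hfmem : ∀ i < (m - ℓ) * u + ℓ, f i ∈ A.chainVerts f u := fun i hi =>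
    A.mem_chainVerts.mpr ⟨i, hi, rfl⟩
  have hcase : ∀ j < (m - ℓ) * t₁ + ℓ, j < ℓ ∨ h j ∈ A.interior h t₁ ∨ ∃ i < ℓ, h j = f i := by
    intro j hj
    by_cases h1 : j < ℓ
    · exact Or.inl h1
    · by_cases h2 : j < (m - ℓ) * t₁
      · exact Or.inr (Or.inl (A.mem_interior.mpr ⟨j, not_lt.mp h1, h2, rfl⟩))
      · obtain ⟨i, rfl⟩ := Nat.exists_eq_add_of_le (not_lt.mp h2)
        exact Or.inr (Or.inr ⟨i, by omega, hhf i (by omega)⟩)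
  set G₁ := splice g h ((m - ℓ) * t) with hG₁
  have hG₁inj : Set.InjOn G₁ (Set.Iio ((m - ℓ) * (t + t₁) + ℓ)) := by
    rw [Nat.mul_add, Nat.add_assoc]
    refine injOn_splice (fun i hi => (hgh i hi).symm) hg hh ?_
    intro i hi j hj hj' heq
    rcases hcase j hj' with h1 | h1 | ⟨i', hi', h1⟩
    · omega
    · exact Finset.disjoint_left.mp hIg h1 (heq ▸ hgmem i hi)
    · exact Finset.disjoint_left.mp hgf (hgmem i hi) (by rw [heq, h1]; exact hfmem i' (by omega))
  have hG₁verts := A.chainVerts_splice t₁ (f := g) (g := h) (t := t) fun i hi => (hgh i hi).symm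
  have hG₁edges := A.chainEdges_splice t₁ (f := g) (g := h) (t := t) fun i hi => (hgh i hi).symm
  have hagree : ∀ i < ℓ, G₁ ((m - ℓ) * (t + t₁) + i) = f i := by
    intro i hi
    rw [hG₁, Nat.mul_add, Nat.add_assoc, splice_add]
    exact hhf i hi
  refine ⟨splice G₁ f ((m - ℓ) * (t + t₁)), ?_, ?_, ?_, ?_, ?_⟩
  · rw [Nat.mul_add (m - ℓ) (t + t₁), Nat.add_assoc]
    refine injOn_splice hagree hG₁inj hf ?_
    intro i hi j hj hj' heq
    have h1 : G₁ i ∈ A.chainVerts G₁ (t + t₁) := A.mem_chainVerts.mpr ⟨i, hi, rfl⟩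
    rw [hG₁verts, Finset.mem_union] at h1
    rcases h1 with h1 | h1
    · exact Finset.disjoint_left.mp hgf h1 (heq ▸ hfmem j hj')
    · obtain ⟨i', hi', h2⟩ := A.mem_chainVerts.mp h1
      rcases hcase i' hi' with h3 | h3 | ⟨i'', hi'', h3⟩
      · refine Finset.disjoint_left.mp hgf (hgmem ((m - ℓ) * t + i') (by omega)) ?_
        rw [← hgh i' h3, h2, heq]
        exact hfmem j hj'
      · refine Finset.disjoint_left.mp hIf h3 ?_
        rw [h2, heq]
        exact hfmem j hj'
      · have h4 : f i'' = f j := by rw [← h3, h2, heq]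
        have := hf (Set.mem_Iio.mpr (by omega)) hj' h4
        omega
  · rw [A.chainVerts_splice u hagree, hG₁verts]
    ext v
    simp only [Finset.mem_union]
    constructor
    · rintro ((h1 | h1) | h1)
      · exact Or.inl (Or.inl h1)
      · obtain ⟨j, hj, rfl⟩ := A.mem_chainVerts.mp h1
        rcases hcase j hj with h3 | h3 | ⟨i, hi, h3⟩
        · rw [hgh j h3]
          exact Or.inl (Or.inl (hgmem _ (by omega)))
        · exact Or.inl (Or.inr h3)
        · rw [h3]
          exact Or.inr (hfmem i (by omega))
      · exact Or.inr h1
    · rintro ((h1 | h1) | h1)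
      · exact Or.inl (Or.inl h1)
      · obtain ⟨i, _, hi, rfl⟩ := A.mem_interior.mp h1
        exact Or.inl (Or.inr (A.mem_chainVerts.mpr ⟨i, by omega, rfl⟩))
      · exact Or.inr h1
  · rw [A.chainEdges_splice u hagree, hG₁edges]
  · intro i hi
    rw [splice_left hagree (by omega)]
    exact splice_left (fun i hi => (hgh i hi).symm) (by omega)
  · intro i hi
    rw [Nat.mul_add (m - ℓ) (t + t₁), Nat.add_assoc, splice_add]

/-- Any two disjoint copies of the start outside `R` are joined in `H` by a chain of length at
most `c` with inner vertices in `R`, avoiding any `y` prescribed vertices. -/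
def Connects (A : Link k ℓ m) (H : UniformHypergraph k V) (R : Finset V) (c y : ℕ) : Prop :=
  ∀ a b : ℕ → V, Set.InjOn a (Set.Iio ℓ) → Set.InjOn b (Set.Iio ℓ) →
    (∀ i < ℓ, ∀ j < ℓ, a i ≠ b j) → (∀ i < ℓ, a i ∉ R) → (∀ i < ℓ, b i ∉ R) →
    ∀ Y : Finset V, Y.card ≤ y → ∃ (t : ℕ) (g : ℕ → V), 1 ≤ t ∧ t ≤ c ∧ ℓ ≤ (m - ℓ) * t ∧
      Set.InjOn g (Set.Iio ((m - ℓ) * t + ℓ)) ∧ (∀ i < ℓ, g i = a i) ∧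
      (∀ i < ℓ, g ((m - ℓ) * t + i) = b i) ∧ A.interior g t ⊆ R \ Y ∧
      A.chainEdges g t ⊆ H.edges ∪ A.startEdges a ∪ A.startEdges b

theorem card_of_mem_startEdges (A : Link k ℓ m) {a : ℕ → V} (ha : Set.InjOn a (Set.Iio ℓ))
    {s : Finset V} (hs : s ∈ A.startEdges a) : s.card = k := by
  obtain ⟨e, he, rfl⟩ := Finset.mem_image.mp hs
  rw [Finset.card_image_of_injective, A.start.uniform e he]
  intro i j hij
  exact Fin.ext (ha i.2 j.2 hij)

omit [DecidableEq V] in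
theorem exists_embedding_range (W : Finset V) : ∃ ι : Fin W.card ↪ V, univ.map ι = W := by
  refine ⟨W.equivFin.symm.toEmbedding.trans (Function.Embedding.subtype _), ?_⟩
  rw [← Finset.map_map, Finset.map_univ_equiv]
  ext v
  simp

/-- The edges inside the two prescribed copies of the start need not belong to `H`. They are added
to it before `hcon` is applied to the hypergraph induced on the two copies and a part `R'` of `R`
avoiding `Y`. -/
theorem connects_of_richOn [Fintype V] (A : Link k ℓ m) (hlm : ℓ < m) {d c n₀ y : ℕ} {β : ℝ}
    (hcon : ∀ n : ℕ, n₀ ≤ n → ∀ H : UniformHypergraph k (Fin n),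
      β * (n : ℝ) ^ (k - d) ≤ (H.minDegree d : ℝ) →
      ∀ a b : Fin ℓ ↪ Fin n, A.start.IsEmbedding a H → A.start.IsEmbedding b H →
        (∀ i j, a i ≠ b j) →
        ∃ (t : ℕ) (f : Fin ((m - ℓ) * t + ℓ) ↪ Fin n), t ≤ c ∧ A.IsChainEmbedding H t f a b)
    (hβ : 0 ≤ β) (H : UniformHypergraph k V) {R : Finset V} {x : ℝ} (hrich : H.RichOn d R x)
    (hx : β * (R.card : ℝ) ^ (k - d) + (y + 2 * ℓ) * (Fintype.card V : ℝ) ^ (k - d - 1) ≤ x)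
    (hR : n₀ + d + y + 2 * ℓ ≤ R.card) : A.Connects H R c y := by
  intro a b ha hb hab haR hbR Y hY
  set D := A.startEdges a ∪ A.startEdges b with hD
  let H' : UniformHypergraph k V :=
    { edges := H.edges ∪ D
      uniform := by
        intro e he
        rcases Finset.mem_union.mp he with he | he
        · exact H.uniform e he
        · rcases Finset.mem_union.mp he with he | he
          · exact A.card_of_mem_startEdges ha he
          · exact A.card_of_mem_startEdges hb he }
  -- The extra `2ℓ` deletions make room for the two copies: the working set then has `|R| - y`
  -- vertices and is no larger than `R`, as the comparison of degree conditions requires.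
  obtain ⟨R', hR'Y, hR'card⟩ : ∃ R' ⊆ R \ Y, R'.card = R.card - y - 2 * ℓ := by
    refine Finset.exists_subset_card_eq ?_
    have : R.card ≤ (R \ Y).card + Y.card := Finset.card_le_card_sdiff_add_card
    omega
  have hR'R : R' ⊆ R := hR'Y.trans Finset.sdiff_subset
  set Ea := (range ℓ).image a with hEa
  set Eb := (range ℓ).image b with hEb
  have hEacard : Ea.card = ℓ := by
    rw [hEa, Finset.card_image_of_injOn, Finset.card_range]
    simpa using ha
  have hEbcard : Eb.card = ℓ := by
    rw [hEb, Finset.card_image_of_injOn, Finset.card_range]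
    simpa using hb
  have hEab : Disjoint Ea Eb := by
    rw [Finset.disjoint_left]
    intro v hv hv'
    obtain ⟨i, hi, rfl⟩ := Finset.mem_image.mp hv
    obtain ⟨j, hj, h⟩ := Finset.mem_image.mp hv'
    exact hab i (Finset.mem_range.mp hi) j (Finset.mem_range.mp hj) h.symm
  have hER : Disjoint (Ea ∪ Eb) R' := by
    rw [Finset.disjoint_left]
    intro v hv hv'
    rcases Finset.mem_union.mp hv with hv | hv
    · obtain ⟨i, hi, rfl⟩ := Finset.mem_image.mp hv
      exact haR i (Finset.mem_range.mp hi) (hR'R hv')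
    · obtain ⟨i, hi, rfl⟩ := Finset.mem_image.mp hv
      exact hbR i (Finset.mem_range.mp hi) (hR'R hv')
  set W := (Ea ∪ Eb) ∪ R' with hW
  have hWcard : W.card = R.card - y := by
    rw [hW, Finset.card_union_of_disjoint hER, Finset.card_union_of_disjoint hEab, hEacard,
      hEbcard, hR'card]
    omega
  obtain ⟨ι, hι⟩ := exists_embedding_range W
  have hlift : ∀ v ∈ W, ∃ i, ι i = v := fun v hv => by
    rw [← hι] at hv
    obtain ⟨i, _, h⟩ := Finset.mem_map.mp hv
    exact ⟨i, h⟩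
  have haW : ∀ i : Fin ℓ, ∃ j, ι j = a i.1 := fun i => hlift _ (by
    rw [hW, hEa]
    exact Finset.mem_union_left _ (Finset.mem_union_left _
      (Finset.mem_image_of_mem _ (Finset.mem_range.mpr i.2))))
  have hbW : ∀ i : Fin ℓ, ∃ j, ι j = b i.1 := fun i => hlift _ (by
    rw [hW, hEb]
    exact Finset.mem_union_left _ (Finset.mem_union_right _
      (Finset.mem_image_of_mem _ (Finset.mem_range.mpr i.2))))
  choose a' ha' using haW
  choose b' hb' using hbW
  have hstart : ∀ (z : ℕ → V) (z' : Fin ℓ ↪ Fin W.card), (∀ i, ι (z' i) = z i.1) →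
      A.startEdges z ⊆ D → A.start.IsEmbedding z' (H'.comap ι) := by
    intro z z' hz hzD e he
    refine Finset.mem_filter.mpr ⟨Finset.mem_univ _, Finset.mem_union_right _ (hzD ?_)⟩
    refine Finset.mem_image.mpr ⟨e, he, ?_⟩
    rw [Finset.map_map, Finset.map_eq_image]
    exact Finset.image_congr fun i _ => (hz i).symm
  have hrich' : H'.RichOn d R' (β * (W.card : ℝ) ^ (k - d)) := by
    have h1 := (hrich.mono_edges (H' := H') Finset.subset_union_left).sdiff (R \ R')
    rw [Finset.sdiff_sdiff_eq_self hR'R] at h1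
    refine h1.mono (Finset.Subset.refl _) ?_
    have h2 : (R \ R').card = y + 2 * ℓ := by
      rw [Finset.card_sdiff_of_subset hR'R, hR'card]
      omega
    rw [h2]
    have h3 : β * (W.card : ℝ) ^ (k - d) ≤ β * (R.card : ℝ) ^ (k - d) := by
      refine mul_le_mul_of_nonneg_left (pow_le_pow_left₀ (by positivity) ?_ _) hβ
      rw [hWcard]
      exact_mod_cast Nat.sub_le _ _
    push_cast
    linarith
  have hmin := UniformHypergraph.le_minDegree_comap ι hrich'
    (by rw [hι]; exact Finset.subset_union_right) (by omega)
  obtain ⟨t, f, htc, hf⟩ := hcon W.card (by omega) (H'.comap ι) hmin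
    ⟨a', fun i j hij => Fin.ext (ha i.2 j.2 (by rw [← ha', ← ha', hij]))⟩
    ⟨b', fun i j hij => Fin.ext (hb i.2 j.2 (by rw [← hb', ← hb', hij]))⟩
    (hstart a _ (fun i => ha' i) Finset.subset_union_left)
    (hstart b _ (fun i => hb' i) Finset.subset_union_right)
    (fun i j hij => hab i.1 i.2 j.1 j.2 (by rw [← ha' i, ← hb' j]; exact congrArg ι hij))
  obtain ⟨ht, g, hginj, hgE, hgV, hga, hgb⟩ := A.exists_of_isChainEmbedding hlm hf
  have hga' : ∀ i < ℓ, ι (g i) = a i := fun i hi => by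
    rw [hga ⟨i, hi⟩]; exact ha' ⟨i, hi⟩
  have hgb' : ∀ i < ℓ, ι (g ((m - ℓ) * t + i)) = b i := fun i hi => by
    rw [hgb ⟨i, hi⟩]; exact hb' ⟨i, hi⟩
  have hinj : Set.InjOn (ι ∘ g) (Set.Iio ((m - ℓ) * t + ℓ)) := fun i hi j hj hij =>
    hginj hi hj (ι.injective hij)
  -- Start and end are disjoint, so the first and the last `ℓ` positions of the chain do not
  -- overlap.
  have hℓt : ℓ ≤ (m - ℓ) * t := by
    by_contra hlt
    push Not at hlt
    refine hab ((m - ℓ) * t) hlt 0 (by omega) ?_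
    rw [← hga' _ hlt, ← hgb' 0 (by omega), Nat.add_zero]
  refine ⟨t, ι ∘ g, ht, htc, hℓt, hinj, hga', hgb', ?_, ?_⟩
  · intro v hv
    obtain ⟨i, hi, hi', rfl⟩ := A.mem_interior.mp hv
    have h0 : (ι ∘ g) i ∈ (Ea ∪ Eb) ∪ R' :=
      (Finset.ext_iff.mp hι _).mp (Finset.mem_map_of_mem ι (Finset.mem_univ (g i)))
    have h1 := Finset.mem_union.mp h0
    rw [Finset.mem_union] at h1
    rcases h1 with (h1 | h1) | h1
    · obtain ⟨j, hj, h2⟩ := Finset.mem_image.mp h1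
      have hj := Finset.mem_range.mp hj
      rw [← hga' j hj] at h2
      have := hinj (Set.mem_Iio.mpr (by omega)) (Set.mem_Iio.mpr (by omega)) h2
      omega
    · obtain ⟨j, hj, h2⟩ := Finset.mem_image.mp h1
      have hj := Finset.mem_range.mp hj
      rw [← hgb' j hj] at h2
      have := hinj (Set.mem_Iio.mpr (by omega)) (Set.mem_Iio.mpr (by omega)) h2
      omega
    · exact hR'Y h1
  · have := A.chainEdges_comp_subset ι hgE
    rw [Finset.union_assoc]
    exact this

theorem interior_card_le (A : Link k ℓ m) (h : ℕ → V) (t : ℕ) :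
    (A.interior h t).card ≤ (m - ℓ) * t := by
  refine Finset.card_image_le.trans ?_
  simp

/-- Disjoint chains outside a reservoir can be merged into a single chain. -/
theorem exists_merge (A : Link k ℓ m) {H : UniformHypergraph k V} {R : Finset V} {c y : ℕ}
    (hcon : A.Connects H R c y) (f : ℕ → ℕ → V) (t : ℕ → ℕ) (J : ℕ)
    (ht : ∀ j ≤ J, 1 ≤ t j)
    (hf : ∀ j ≤ J, Set.InjOn (f j) (Set.Iio ((m - ℓ) * t j + ℓ)))
    (hdisj : ∀ i ≤ J, ∀ j ≤ J, i ≠ j →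
      Disjoint (A.chainVerts (f i) (t i)) (A.chainVerts (f j) (t j)))
    (hR : ∀ j ≤ J, Disjoint (A.chainVerts (f j) (t j)) R)
    (hy : J * ((m - ℓ) * c) ≤ y) :
    ∃ (g : ℕ → V) (T : ℕ) (R' : Finset V), 1 ≤ T ∧ R' ⊆ R ∧ R'.card ≤ J * ((m - ℓ) * c) ∧
      Set.InjOn g (Set.Iio ((m - ℓ) * T + ℓ)) ∧
      A.chainVerts g T = ((range (J + 1)).biUnion fun j => A.chainVerts (f j) (t j)) ∪ R' ∧
      ((range (J + 1)).biUnion fun j => A.chainEdges (f j) (t j)) ⊆ A.chainEdges g T ∧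
      A.chainEdges g T ⊆
        ((range (J + 1)).biUnion fun j => A.chainEdges (f j) (t j)) ∪ H.edges ∧
      (∀ i < ℓ, g i = f 0 i) ∧
      ∀ i < ℓ, g ((m - ℓ) * T + i) = f J ((m - ℓ) * t J + i) := by
  induction J with
  | zero =>
    refine ⟨f 0, t 0, ∅, ht 0 le_rfl, Finset.empty_subset _, by simp, hf 0 le_rfl, ?_, ?_, ?_,
      fun _ _ => rfl, fun _ _ => rfl⟩
    · simp
    · simp
    · simp
  | succ J ih =>
    obtain ⟨g, T, R', hT, hR'R, hR'card, hginj, hgV, hgE, hgE', hg0, hgJ⟩ :=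
      ih (fun j hj => ht j (by omega)) (fun j hj => hf j (by omega))
        (fun i hi j hj => hdisj i (by omega) j (by omega)) (fun j hj => hR j (by omega))
        (le_trans (Nat.mul_le_mul_right _ (by omega)) hy)
    have hmemV : ∀ j, ∀ i < (m - ℓ) * t j + ℓ, f j i ∈ A.chainVerts (f j) (t j) := fun j i hi =>
      A.mem_chainVerts.mpr ⟨i, hi, rfl⟩
    have hy' : J * ((m - ℓ) * c) + (m - ℓ) * c = (J + 1) * ((m - ℓ) * c) := by ring
    have hgf : Disjoint (A.chainVerts g T) (A.chainVerts (f (J + 1)) (t (J + 1))) := by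
      rw [hgV, Finset.disjoint_union_left]
      constructor
      · rw [Finset.disjoint_biUnion_left]
        intro j hj
        have := Finset.mem_range.mp hj
        exact hdisj j (by omega) (J + 1) le_rfl (by omega)
      · exact ((hR (J + 1) le_rfl).mono_right hR'R).symm
    -- The reservoir vertices used so far form `R'` and are the set to be avoided; each connection
    -- adds at most `(m - ℓ) * c` vertices to it.
    obtain ⟨t₁, h, ht₁, ht₁c, hℓt₁, hhinj, hha, hhb, hhI, hhE⟩ := hcon
      (fun i => g ((m - ℓ) * T + i)) (f (J + 1))
      (fun i hi j hj hij => by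
        rw [Set.mem_Iio] at hi hj
        have := hginj (Set.mem_Iio.mpr (by omega)) (Set.mem_Iio.mpr (by omega)) hij
        omega)
      ((hf (J + 1) le_rfl).mono (Set.Iio_subset_Iio (by omega)))
      (fun i hi j hj hij => Finset.disjoint_left.mp hgf
        (A.mem_chainVerts.mpr ⟨_, by omega, rfl⟩)
        (hij ▸ hmemV (J + 1) j (by omega)))
      (fun i hi hmem => by
        simp only [hgJ i hi] at hmem
        exact Finset.disjoint_left.mp (hR J (by omega)) (hmemV J _ (by omega)) hmem)
      (fun i hi hmem => Finset.disjoint_left.mp (hR (J + 1) le_rfl)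
        (hmemV (J + 1) i (by omega)) hmem)
      R' (by omega)
    have hIg : Disjoint (A.interior h t₁) (A.chainVerts g T) := by
      rw [hgV, Finset.disjoint_union_right]
      refine ⟨?_, (Finset.sdiff_disjoint.mono_left hhI)⟩
      rw [Finset.disjoint_biUnion_right]
      intro j hj
      have := Finset.mem_range.mp hj
      exact ((hR j (by omega)).mono_right (hhI.trans Finset.sdiff_subset)).symm
    have hIf : Disjoint (A.interior h t₁) (A.chainVerts (f (J + 1)) (t (J + 1))) :=
      ((hR (J + 1) le_rfl).mono_right (hhI.trans Finset.sdiff_subset)).symm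
    obtain ⟨G, hGinj, hGV, hGE, hG0, hGe⟩ := A.exists_join hginj hhinj (hf (J + 1) le_rfl)
      hha hhb hgf hIg hIf
    have hhE' : A.chainEdges h t₁ ⊆ H.edges ∪ A.chainEdges g T ∪
        A.chainEdges (f (J + 1)) (t (J + 1)) := by
      refine hhE.trans (Finset.union_subset_union (Finset.union_subset_union_right ?_) ?_)
      · exact A.endEdges_subset g hT
      · exact A.startEdges_subset _ (ht (J + 1) le_rfl)
    refine ⟨G, T + t₁ + t (J + 1), R' ∪ A.interior h t₁, by omega,
      Finset.union_subset hR'R (hhI.trans Finset.sdiff_subset), ?_, hGinj, ?_, ?_, ?_, ?_, hGe⟩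
    · have h1 := A.interior_card_le h t₁
      have h2 : (m - ℓ) * t₁ ≤ (m - ℓ) * c := Nat.mul_le_mul_left _ ht₁c
      have := Finset.card_union_le R' (A.interior h t₁)
      omega
    · rw [hGV, hgV, Finset.range_add_one (n := J + 1), Finset.biUnion_insert]
      ext v
      simp only [Finset.mem_union]
      tauto
    · rw [hGE, Finset.range_add_one (n := J + 1), Finset.biUnion_insert]
      refine Finset.union_subset Finset.subset_union_right (hgE.trans ?_)
      rw [Finset.union_assoc]
      exact Finset.subset_union_left
    · rw [hGE, Finset.range_add_one (n := J + 1), Finset.biUnion_insert]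
      intro e he
      have hg1 : e ∈ A.chainEdges g T → e ∈ A.chainEdges (f (J + 1)) (t (J + 1)) ∪
          ((range (J + 1)).biUnion fun j => A.chainEdges (f j) (t j)) ∪ H.edges := by
        intro he
        have := hgE' he
        simp only [Finset.mem_union] at this ⊢
        tauto
      rcases Finset.mem_union.mp he with he | he
      · rcases Finset.mem_union.mp he with he | he
        · exact hg1 he
        · rcases Finset.mem_union.mp (hhE' he) with he | he
          · rcases Finset.mem_union.mp he with he | he
            · exact Finset.mem_union_right _ he
            · exact hg1 he
          · exact Finset.mem_union_left _ (Finset.mem_union_left _ he)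
      · exact Finset.mem_union_left _ (Finset.mem_union_left _ he)
    · intro i hi
      rw [hG0 i hi, hg0 i hi]

/-- Closing a chain to a spanning cycle through a second chain. -/
theorem exists_closed [Fintype V] (A : Link k ℓ m) {g h₁ q h₂ : ℕ → V} {t t₁ u t₂ : ℕ}
    (hg : Set.InjOn g (Set.Iio ((m - ℓ) * t + ℓ)))
    (hh₁ : Set.InjOn h₁ (Set.Iio ((m - ℓ) * t₁ + ℓ)))
    (hq : Set.InjOn q (Set.Iio ((m - ℓ) * u + ℓ)))
    (hh₂ : Set.InjOn h₂ (Set.Iio ((m - ℓ) * t₂ + ℓ)))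
    (hgh : ∀ i < ℓ, h₁ i = g ((m - ℓ) * t + i)) (hhq : ∀ i < ℓ, h₁ ((m - ℓ) * t₁ + i) = q i)
    (hqh : ∀ i < ℓ, h₂ i = q ((m - ℓ) * u + i)) (hhg : ∀ i < ℓ, h₂ ((m - ℓ) * t₂ + i) = g i)
    (hℓ : ℓ ≤ (m - ℓ) * t₂)
    (hgq : Disjoint (A.chainVerts g t) (A.chainVerts q u))
    (hI₁g : Disjoint (A.interior h₁ t₁) (A.chainVerts g t))
    (hI₁q : Disjoint (A.interior h₁ t₁) (A.chainVerts q u))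
    (hI₂g : Disjoint (A.interior h₂ t₂) (A.chainVerts g t))
    (hI₂q : Disjoint (A.interior h₂ t₂) (A.chainVerts q u))
    (hI₂I₁ : Disjoint (A.interior h₂ t₂) (A.interior h₁ t₁))
    (huniv : A.chainVerts g t ∪ A.interior h₁ t₁ ∪ A.chainVerts q u ∪ A.interior h₂ t₂ = univ) :
    ∃ (F : ℕ → V) (T : ℕ), Fintype.card V = (m - ℓ) * T ∧
      Set.InjOn F (Set.Iio ((m - ℓ) * T)) ∧ (∀ i < ℓ, F ((m - ℓ) * T + i) = F i) ∧
      A.chainEdges F T = A.chainEdges g t ∪ A.chainEdges h₁ t₁ ∪ A.chainEdges q u ∪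
        A.chainEdges h₂ t₂ := by
  obtain ⟨G, hGinj, hGV, hGE, hG0, hGe⟩ := A.exists_join hg hh₁ hq hgh hhq hgq hI₁g hI₁q
  set S := t + t₁ + u with hS
  have hagree : ∀ i < ℓ, G ((m - ℓ) * S + i) = h₂ i := fun i hi => by
    rw [hGe i hi, hqh i hi]
  set F := splice G h₂ ((m - ℓ) * S) with hF
  have hinj : Set.InjOn F (Set.Iio ((m - ℓ) * (S + t₂))) := by
    rw [Nat.mul_add]
    refine injOn_splice hagree hGinj (hh₂.mono (Set.Iio_subset_Iio (by omega))) ?_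
    intro i hi j hj hj' heq
    have h1 : h₂ j ∈ A.interior h₂ t₂ := A.mem_interior.mpr ⟨j, hj, hj', rfl⟩
    have h2 : G i ∈ A.chainVerts G S := A.mem_chainVerts.mpr ⟨i, hi, rfl⟩
    rw [hGV, heq, Finset.mem_union, Finset.mem_union] at h2
    rcases h2 with (h2 | h2) | h2
    · exact Finset.disjoint_left.mp hI₂g h1 h2
    · exact Finset.disjoint_left.mp hI₂I₁ h1 h2
    · exact Finset.disjoint_left.mp hI₂q h1 h2
  have hper : ∀ i < ℓ, F ((m - ℓ) * (S + t₂) + i) = F i := by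
    intro i hi
    rw [hF, Nat.mul_add (m - ℓ) S, Nat.add_assoc, splice_add, hhg i hi,
      splice_left hagree (by omega), hG0 i hi]
  refine ⟨F, S + t₂, ?_, hinj, hper, ?_⟩
  · have h1 : (range ((m - ℓ) * (S + t₂))).image F = univ := by
      rw [Finset.eq_univ_iff_forall]
      intro v
      have hv : v ∈ A.chainVerts F (S + t₂) := by
        rw [A.chainVerts_splice t₂ hagree, hGV]
        have := Finset.mem_univ v
        rw [← huniv, Finset.mem_union] at this
        rcases this with h | h
        · exact Finset.mem_union_left _ h
        · obtain ⟨i, _, hi, rfl⟩ := A.mem_interior.mp h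
          exact Finset.mem_union_right _ (A.mem_chainVerts.mpr ⟨i, by omega, rfl⟩)
      obtain ⟨i, hi, rfl⟩ := A.mem_chainVerts.mp hv
      by_cases hlt : i < (m - ℓ) * (S + t₂)
      · exact Finset.mem_image_of_mem _ (Finset.mem_range.mpr hlt)
      · obtain ⟨j, rfl⟩ := Nat.exists_eq_add_of_le (not_lt.mp hlt)
        rw [hper j (by omega)]
        refine Finset.mem_image_of_mem _ (Finset.mem_range.mpr ?_)
        rw [Nat.mul_add]
        omega
    rw [← Finset.card_univ, ← h1, Finset.card_image_of_injOn, Finset.card_range]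
    simpa using hinj
  · rw [A.chainEdges_splice t₂ hagree, hGE]

end Link

/-! ### Completing a partial colouring -/

namespace UniformHypergraph

open Finset

variable {k : ℕ} {V : Type}

theorem isTransversal_of_injOn {M : ℕ} {F : UniformHypergraph k V}
    {H : Fin M → UniformHypergraph k V} (hcard : F.edges.card = M) (ψ : Finset V → Fin M)
    (hinj : Set.InjOn ψ F.edges) (hψ : ∀ e ∈ F.edges, e ∈ (H (ψ e)).edges) :
    F.IsTransversal H := by
  have hbij : Function.Bijective fun e : {e // e ∈ F.edges} => ψ e.1 :=
    (Fintype.bijective_iff_injective_and_card _).mpr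
      ⟨fun e e' h => Subtype.ext (hinj e.2 e'.2 h), by simp [hcard]⟩
  exact ⟨Equiv.ofBijective _ hbij, fun e => hψ e.1 e.2⟩

variable [DecidableEq V]

open Classical in
/-- Completing a partial colouring by a greedy colouring and an absorbing set of edges. -/
theorem isTransversal_of_absorber {M l : ℕ} {F : UniformHypergraph k V}
    {H : Fin M → UniformHypergraph k V} (hcard : F.edges.card = M)
    {E₁ E₀ : Finset (Finset V)} (hE₁ : E₁ ⊆ F.edges) (hE₀ : E₀ ⊆ F.edges) (hdisj : Disjoint E₁ E₀)
    (ψ₁ : Finset V → Fin M) (hψ₁ : Set.InjOn ψ₁ E₁) (hψ₁H : ∀ e ∈ E₁, e ∈ (H (ψ₁ e)).edges)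
    {B₀ B : Finset (Fin M)} (hB : Disjoint B₀ B) (hC₁ : Disjoint (E₁.image ψ₁) B₀)
    (hcover : ∀ i, i ∈ E₁.image ψ₁ ∨ i ∈ B₀ ∨ i ∈ B) (hB₀ : B₀.card + l = E₀.card)
    (habs : ∀ U ⊆ B, U.card = l → ∃ ψ : Finset V → Fin M, Set.InjOn ψ E₀ ∧
      ∀ e ∈ E₀, ψ e ∈ B₀ ∪ U ∧ e ∈ (H (ψ e)).edges)
    (hrest : ∀ e ∈ F.edges, e ∉ E₁ → e ∉ E₀ → (B \ E₁.image ψ₁).card ≤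
      ((B \ E₁.image ψ₁).filter fun i => e ∈ (H i).edges).card + l) (hM : 0 < M) :
    F.IsTransversal H := by
  set C₁ := E₁.image ψ₁ with hC₁def
  set E₂ := F.edges \ (E₁ ∪ E₀) with hE₂
  have hC₁card : C₁.card = E₁.card := Finset.card_image_of_injOn hψ₁
  have hun : C₁ ∪ B₀ ∪ (B \ C₁) = Finset.univ := Finset.eq_univ_iff_forall.mpr (by
    intro i
    simp only [Finset.mem_union, Finset.mem_sdiff]
    have := hcover i
    tauto)
  have htot : C₁.card + B₀.card + (B \ C₁).card = M := by
    rw [← Finset.card_union_of_disjoint hC₁, ← Finset.card_union_of_disjoint]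
    · rw [hun, Finset.card_univ, Fintype.card_fin]
    · rw [Finset.disjoint_union_left]
      exact ⟨Finset.disjoint_sdiff, hB.mono_right Finset.sdiff_subset⟩
  -- There are as many edges as colours, so together with `htot` and `hB₀` this gives `|B \ C₁| =
  -- |E₂| + l`. Greedy colouring of `E₂` therefore succeeds and leaves exactly the `l` colours that
  -- the absorbing edges can take.
  have hEtot : E₂.card + E₁.card + E₀.card = M := by
    rw [Nat.add_assoc, ← Finset.card_union_of_disjoint hdisj, hE₂, Finset.card_sdiff_of_subset
      (Finset.union_subset hE₁ hE₀), hcard]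
    have := Finset.card_le_card (Finset.union_subset hE₁ hE₀)
    omega
  have : Nonempty (Fin M) := ⟨⟨0, hM⟩⟩
  obtain ⟨ψ₂, hψ₂, hψ₂O⟩ := exists_injOn_choice E₂
    (fun e => (B \ C₁).filter fun i => e ∈ (H i).edges) (by
      intro e he
      obtain ⟨heF, hne⟩ := Finset.mem_sdiff.mp he
      rw [Finset.mem_union, not_or] at hne
      have := hrest e heF hne.1 hne.2
      omega)
  set U := (B \ C₁) \ E₂.image ψ₂ with hU
  have himg : E₂.image ψ₂ ⊆ B \ C₁ := by
    intro i hi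
    obtain ⟨e, he, rfl⟩ := Finset.mem_image.mp hi
    exact (Finset.mem_filter.mp (hψ₂O e he)).1
  have hUcard : U.card = l := by
    rw [hU, Finset.card_sdiff_of_subset himg, Finset.card_image_of_injOn hψ₂]
    omega
  obtain ⟨ψ₀, hψ₀, hψ₀U⟩ := habs U (Finset.sdiff_subset.trans Finset.sdiff_subset) hUcard
  let ψ : Finset V → Fin M := fun e => if e ∈ E₁ then ψ₁ e else if e ∈ E₀ then ψ₀ e else ψ₂ e
  have h1 : ∀ e ∈ E₁, ψ e = ψ₁ e := fun e he => if_pos he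
  have h0 : ∀ e ∈ E₀, ψ e = ψ₀ e := fun e he => by
    simp only [ψ, if_neg (Finset.disjoint_right.mp hdisj he), if_pos he]
  have h2 : ∀ e ∈ E₂, ψ e = ψ₂ e := fun e he => by
    have := (Finset.mem_sdiff.mp he).2
    rw [Finset.mem_union, not_or] at this
    simp only [ψ, if_neg this.1, if_neg this.2]
  have hcases : ∀ e ∈ F.edges, e ∈ E₁ ∨ e ∈ E₀ ∨ e ∈ E₂ := by
    intro e he
    by_cases h : e ∈ E₁ ∪ E₀
    · rcases Finset.mem_union.mp h with h | h
      · exact Or.inl h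
      · exact Or.inr (Or.inl h)
    · exact Or.inr (Or.inr (Finset.mem_sdiff.mpr ⟨he, h⟩))
  have c1 : ∀ e ∈ E₁, ψ₁ e ∈ C₁ := fun e he => Finset.mem_image_of_mem _ he
  have c2 : ∀ e ∈ E₂, ψ₂ e ∈ B \ C₁ := fun e he => himg (Finset.mem_image_of_mem _ he)
  have d10 : ∀ e ∈ E₁, ∀ e' ∈ E₀, ψ₁ e ≠ ψ₀ e' := by
    intro e he e' he' h
    rcases Finset.mem_union.mp (hψ₀U e' he').1 with h' | h'
    · exact Finset.disjoint_left.mp hC₁ (c1 e he) (h ▸ h')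
    · exact (Finset.mem_sdiff.mp (Finset.mem_sdiff.mp h').1).2 (h ▸ c1 e he)
  have d12 : ∀ e ∈ E₁, ∀ e' ∈ E₂, ψ₁ e ≠ ψ₂ e' := fun e he e' he' h =>
    (Finset.mem_sdiff.mp (c2 e' he')).2 (h ▸ c1 e he)
  have d02 : ∀ e ∈ E₀, ∀ e' ∈ E₂, ψ₀ e ≠ ψ₂ e' := by
    intro e he e' he' h
    rcases Finset.mem_union.mp (hψ₀U e he).1 with h' | h'
    · exact Finset.disjoint_left.mp hB h' (h ▸ (Finset.mem_sdiff.mp (c2 e' he')).1)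
    · exact (Finset.mem_sdiff.mp h').2 (h ▸ Finset.mem_image_of_mem _ he')
  refine isTransversal_of_injOn hcard ψ ?_ ?_
  · intro e he e' he' heq
    rcases hcases e he with h | h | h <;> rcases hcases e' he' with h' | h' | h'
    · rw [h1 e h, h1 e' h'] at heq; exact hψ₁ h h' heq
    · rw [h1 e h, h0 e' h'] at heq; exact absurd heq (d10 e h e' h')
    · rw [h1 e h, h2 e' h'] at heq; exact absurd heq (d12 e h e' h')
    · rw [h0 e h, h1 e' h'] at heq; exact absurd heq.symm (d10 e' h' e h)
    · rw [h0 e h, h0 e' h'] at heq; exact hψ₀ h h' heq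
    · rw [h0 e h, h2 e' h'] at heq; exact absurd heq (d02 e h e' h')
    · rw [h2 e h, h1 e' h'] at heq; exact absurd heq.symm (d12 e' h' e h)
    · rw [h2 e h, h0 e' h'] at heq; exact absurd heq.symm (d02 e' h' e h)
    · rw [h2 e h, h2 e' h'] at heq; exact hψ₂ h h' heq
  · intro e he
    rcases hcases e he with h | h | h
    · rw [h1 e h]; exact hψ₁H e h
    · rw [h0 e h]; exact (hψ₀U e h).2
    · rw [h2 e h]; exact (Finset.mem_filter.mp (hψ₂O e h)).2

end UniformHypergraph

/-! ### Absorbers and copies inside a vertex subset -/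

namespace Link

open Finset

variable {k ℓ m : ℕ} {V : Type}

theorem exists_nat_extension {N : ℕ} [Nonempty V] (f : Fin N → V) :
    ∃ g : ℕ → V, ∀ i : Fin N, g i.1 = f i := by
  classical
  refine ⟨fun i => if h : i < N then f ⟨i, h⟩ else Classical.arbitrary V, fun i => ?_⟩
  simp

variable [DecidableEq V]

/-- Absorbing chains inside the complement of a small set. -/
theorem exists_vertex_absorber [Fintype V] (A : Link k ℓ m) (hlm : ℓ < m) {d n₀ : ℕ} {β τ η : ℝ}
    (hab : ∀ n : ℕ, n₀ ≤ n → ∀ H : UniformHypergraph k (Fin n),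
      β * (n : ℝ) ^ (k - d) ≤ (H.minDegree d : ℝ) →
      ∃ S : Finset (Fin n), (S.card : ℝ) ≤ τ * n ∧
        ∃ a b : Fin ℓ → Fin n, ∀ L : Finset (Fin n), Disjoint L S → (L.card : ℝ) ≤ η * n →
          (m - ℓ) ∣ L.card →
          ∃ (t : ℕ) (f : Fin ((m - ℓ) * t + ℓ) ↪ Fin n),
            A.IsChainEmbedding H t f a b ∧ Finset.univ.map f = S ∪ L)
    (hβ : 0 ≤ β) (hτ : 0 ≤ τ) (H : UniformHypergraph k V) {W : Finset V}
    (hrich : H.RichOn d W (β * (Fintype.card V : ℝ) ^ (k - d))) (hW : n₀ + d + 1 ≤ W.card) :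
    ∃ S ⊆ W, (S.card : ℝ) ≤ τ * Fintype.card V ∧ ∃ a b : ℕ → V,
      ∀ L ⊆ W, Disjoint L S → (L.card : ℝ) ≤ η * W.card → (m - ℓ) ∣ L.card →
        ∃ (u : ℕ) (q : ℕ → V), 1 ≤ u ∧ Set.InjOn q (Set.Iio ((m - ℓ) * u + ℓ)) ∧
          A.chainVerts q u = S ∪ L ∧ A.chainEdges q u ⊆ H.edges ∧ (∀ i < ℓ, q i = a i) ∧
          ∀ i < ℓ, q ((m - ℓ) * u + i) = b i := by
  have hWV : (W.card : ℝ) ≤ Fintype.card V := by exact_mod_cast Finset.card_le_univ W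
  obtain ⟨ι, hι⟩ := exists_embedding_range W
  have hmin : β * (W.card : ℝ) ^ (k - d) ≤ ((H.comap ι).minDegree d : ℝ) := by
    refine UniformHypergraph.le_minDegree_comap ι (R := W) ?_ hι.ge (by omega)
    refine hrich.mono (Finset.Subset.refl _) (mul_le_mul_of_nonneg_left ?_ hβ)
    exact pow_le_pow_left₀ (by positivity) hWV _
  obtain ⟨S, hS, a, b, hL⟩ := hab W.card (by omega) (H.comap ι) hmin
  have : Nonempty V := ⟨ι ⟨0, by omega⟩⟩
  obtain ⟨a', ha'⟩ := exists_nat_extension (ι ∘ a)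
  obtain ⟨b', hb'⟩ := exists_nat_extension (ι ∘ b)
  have himg : ∀ v, v ∈ W ↔ ∃ i, ι i = v := by
    intro v
    have := Finset.ext_iff.mp hι v
    rw [← this, Finset.mem_map]
    simp
  refine ⟨S.map ι, ?_, ?_, a', b', ?_⟩
  · intro v hv
    obtain ⟨i, _, h⟩ := Finset.mem_map.mp hv
    exact (himg v).mpr ⟨i, h⟩
  · rw [Finset.card_map]
    exact hS.trans (mul_le_mul_of_nonneg_left hWV hτ)
  · intro L hLW hLS hLcard hLdvd
    obtain ⟨L', _, rfl⟩ := Finset.subset_map_iff.mp (hLW.trans hι.ge)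
    rw [Finset.card_map] at hLcard hLdvd
    obtain ⟨u, f, hf, hfL⟩ := hL L' ((Finset.disjoint_map ι).mp hLS) hLcard hLdvd
    obtain ⟨hu, g, hginj, hgE, hgV, hga, hgb⟩ := A.exists_of_isChainEmbedding hlm hf
    refine ⟨u, ι ∘ g, hu, fun i hi j hj hij => hginj hi hj (ι.injective hij), ?_,
      A.chainEdges_comp_subset ι hgE, ?_, ?_⟩
    · rw [chainVerts_comp, hgV, hfL, ← Finset.map_eq_image, Finset.map_union]
    · intro i hi
      exact (congrArg ι (hga ⟨i, hi⟩)).trans (ha' ⟨i, hi⟩).symm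
    · intro i hi
      exact (congrArg ι (hgb ⟨i, hi⟩)).trans (hb' ⟨i, hi⟩).symm

/-- Disjoint transversal copies of `A` inside a vertex set, using exactly a prescribed set of
colours. -/
theorem exists_transversal_copies (A : Link k ℓ m) (hlm : ℓ < m) {d n₀ M : ℕ} {β β₀ : ℝ}
    (hfac : ∀ (n : ℕ) (β' : ℝ), n₀ ≤ n → β' ≤ β₀ →
      ∀ (M : ℕ) (H : Fin M → UniformHypergraph k (Fin n)), (M : ℝ) ≤ β' * n →
        (∀ i, β * (n : ℝ) ^ (k - d) ≤ ((H i).minDegree d : ℝ)) →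
        A.graph.edges.card ∣ M →
        ∃ (g : Fin (M / A.graph.edges.card) → (Fin m ↪ Fin n)) (F : UniformHypergraph k (Fin n)),
          (∀ p q, p ≠ q → ∀ x y, g p x ≠ g q y) ∧
          (F.edges = Finset.univ.biUnion fun p => A.graph.edges.image (Finset.map (g p))) ∧
          F.IsTransversal H)
    (H : Fin M → UniformHypergraph k V) {R : Finset V} (C : Finset (Fin M))
    (hrich : ∀ i, (H i).RichOn d R (β * (R.card : ℝ) ^ (k - d))) (hR : n₀ + d + 1 ≤ R.card)
    (hC : (C.card : ℝ) ≤ β₀ * R.card) (hdvd : A.graph.edges.card ∣ C.card) (hM : 0 < M) :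
    ∃ (P : ℕ) (g : ℕ → ℕ → V) (ψ : Finset V → Fin M), P ≤ C.card ∧
      (∀ p < P, Set.InjOn (g p) (Set.Iio ((m - ℓ) * 1 + ℓ)) ∧ A.chainVerts (g p) 1 ⊆ R) ∧
      (∀ p < P, ∀ q < P, p ≠ q → Disjoint (A.chainVerts (g p) 1) (A.chainVerts (g q) 1)) ∧
      Set.InjOn ψ ((range P).biUnion fun p => A.chainEdges (g p) 1) ∧
      (((range P).biUnion fun p => A.chainEdges (g p) 1).image ψ = C) ∧
      ∀ e ∈ (range P).biUnion fun p => A.chainEdges (g p) 1, e ∈ (H (ψ e)).edges := by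
  have hm1 : (m - ℓ) * 1 + ℓ = m := by omega
  obtain ⟨ι, hι⟩ := exists_embedding_range R
  let H' : Fin C.card → UniformHypergraph k (Fin R.card) := fun i =>
    (H (C.equivFin.symm i).1).comap ι
  have hfac' := hfac R.card β₀ (by omega) le_rfl C.card H' hC
    (fun i => UniformHypergraph.le_minDegree_comap ι (hrich _) hι.ge (by omega)) hdvd
  have hPle : C.card / A.graph.edges.card ≤ C.card := Nat.div_le_self _ _
  generalize C.card / A.graph.edges.card = P at hfac' hPle
  obtain ⟨g, F, hgdisj, hF, φ, hφ⟩ := hfac'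
  have : Nonempty V := ⟨ι ⟨0, by omega⟩⟩
  have hext : ∀ p : Fin P, ∃ z : ℕ → V, ∀ i : Fin m, z i.1 = ι (g p i) := fun p =>
    exists_nat_extension (ι ∘ g p)
  choose z hz using hext
  let z' : ℕ → ℕ → V := fun p => if h : p < P then z ⟨p, h⟩ else fun _ => Classical.arbitrary V
  have hz' : ∀ p : Fin P, ∀ i : Fin m, z' p.1 i.1 = ι (g p i) := fun p i => by
    have : z' p.1 = z p := dif_pos p.2
    rw [this, hz]
  have hE : ∀ p : Fin P, A.chainEdges (z' p.1) 1 =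
      (A.graph.edges.image (Finset.map (g p))).image (Finset.map ι) := by
    intro p
    have h1 : ∀ e : Finset (Fin m), (e.image fun i => z' p.1 ((m - ℓ) * 0 + i.1)) =
        (e.map (g p)).map ι := by
      intro e
      rw [Finset.map_map, Finset.map_eq_image]
      refine Finset.image_congr fun i _ => ?_
      simp only [Nat.mul_zero, Nat.zero_add]
      rw [hz']
      rfl
    unfold chainEdges
    rw [Finset.range_one, Finset.singleton_biUnion, Finset.image_image]
    exact Finset.image_congr fun e _ => h1 e
  have hEtot : ((range P).biUnion fun p => A.chainEdges (z' p) 1) =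
      F.edges.image (Finset.map ι) := by
    rw [hF]
    ext e
    simp only [Finset.mem_biUnion, Finset.mem_range, Finset.mem_image, Finset.mem_univ, true_and]
    constructor
    · rintro ⟨p, hp, he⟩
      have he' : e ∈ A.chainEdges (z' (⟨p, hp⟩ : Fin P).1) 1 := he
      rw [hE, Finset.mem_image] at he'
      obtain ⟨e', he', rfl⟩ := he'
      obtain ⟨e'', h1, h2⟩ := Finset.mem_image.mp he'
      exact ⟨e', ⟨⟨p, hp⟩, e'', h1, h2⟩, rfl⟩
    · rintro ⟨e', ⟨p, e'', h1, h2⟩, rfl⟩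
      refine ⟨p.1, p.2, ?_⟩
      rw [hE]
      exact Finset.mem_image_of_mem _ (Finset.mem_image.mpr ⟨e'', h1, h2⟩)
  have hinv : ∀ e : Finset V, ∃ c : Fin M, ∀ e' (he' : e' ∈ F.edges), e'.map ι = e →
      c = (C.equivFin.symm (φ ⟨e', he'⟩)).1 := by
    intro e
    by_cases h : ∃ e' ∈ F.edges, e'.map ι = e
    · obtain ⟨e', he', rfl⟩ := h
      refine ⟨(C.equivFin.symm (φ ⟨e', he'⟩)).1, fun e'' he'' h => ?_⟩
      have := Finset.map_injective ι h
      subst this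
      rfl
    · exact ⟨⟨0, hM⟩, fun e' he' h' => absurd ⟨e', he', h'⟩ h⟩
  choose ψ hψ using hinv
  have hψ' : ∀ e' (he' : e' ∈ F.edges), ψ (e'.map ι) = (C.equivFin.symm (φ ⟨e', he'⟩)).1 :=
    fun e' he' => hψ _ e' he' rfl
  refine ⟨P, z', ψ, hPle, ?_, ?_, ?_, ?_, ?_⟩
  · intro p hp
    constructor
    · intro i hi j hj hij
      rw [Set.mem_Iio, hm1] at hi hj
      have h1 := hz' ⟨p, hp⟩ ⟨i, hi⟩
      have h2 := hz' ⟨p, hp⟩ ⟨j, hj⟩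
      simp only at h1 h2
      rw [h1, h2] at hij
      exact congrArg Fin.val ((g ⟨p, hp⟩).injective (ι.injective hij))
    · intro v hv
      obtain ⟨i, hi, rfl⟩ := A.mem_chainVerts.mp hv
      rw [hm1] at hi
      have h1 := hz' ⟨p, hp⟩ ⟨i, hi⟩
      simp only at h1
      rw [h1]
      exact (Finset.ext_iff.mp hι _).mp (Finset.mem_map_of_mem ι (Finset.mem_univ _))
  · intro p hp q hq hpq
    rw [Finset.disjoint_left]
    intro v hv hv'
    obtain ⟨i, hi, rfl⟩ := A.mem_chainVerts.mp hv
    obtain ⟨j, hj, h⟩ := A.mem_chainVerts.mp hv'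
    rw [hm1] at hi hj
    have h1 := hz' ⟨p, hp⟩ ⟨i, hi⟩
    have h2 := hz' ⟨q, hq⟩ ⟨j, hj⟩
    simp only at h1 h2
    rw [h1, h2] at h
    refine hgdisj ⟨p, hp⟩ ⟨q, hq⟩ (fun h => hpq (congrArg Fin.val h)) ⟨i, hi⟩ ⟨j, hj⟩ ?_
    exact (ι.injective h).symm
  · rw [hEtot]
    intro e he e' he' hee
    obtain ⟨x, hx, rfl⟩ := Finset.mem_image.mp (Finset.mem_coe.mp he)
    obtain ⟨y, hy, rfl⟩ := Finset.mem_image.mp (Finset.mem_coe.mp he')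
    rw [hψ' x hx, hψ' y hy] at hee
    have h1 := φ.injective (C.equivFin.symm.injective (Subtype.ext hee))
    exact congrArg (Finset.map ι) (congrArg Subtype.val h1)
  · rw [hEtot, Finset.image_image]
    ext c
    rw [Finset.mem_image]
    constructor
    · rintro ⟨x, hx, rfl⟩
      rw [Function.comp, hψ' x hx]
      exact (C.equivFin.symm _).2
    · intro hc
      refine ⟨(φ.symm (C.equivFin ⟨c, hc⟩)).1, (φ.symm (C.equivFin ⟨c, hc⟩)).2, ?_⟩
      rw [Function.comp, hψ' _ (φ.symm (C.equivFin ⟨c, hc⟩)).2]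
      simp
  · rw [hEtot]
    intro e he
    obtain ⟨x, hx, rfl⟩ := Finset.mem_image.mp he
    rw [hψ' x hx]
    exact (Finset.mem_filter.mp (hφ ⟨x, hx⟩)).2

end Link

/-! ### Assembling the pieces into a Hamilton cycle -/

namespace Link

open Finset

variable {k ℓ m : ℕ} {V : Type} [DecidableEq V]

theorem card_interior (A : Link k ℓ m) {h : ℕ → V} {t : ℕ}
    (hh : Set.InjOn h (Set.Iio ((m - ℓ) * t + ℓ))) :
    (A.interior h t).card = (m - ℓ) * t - ℓ := by
  have : A.interior h t = (Finset.Ico ℓ ((m - ℓ) * t)).image h := by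
    ext v
    rw [mem_interior, Finset.mem_image]
    simp only [Finset.mem_Ico, and_assoc]
  rw [this, Finset.card_image_of_injOn, Nat.card_Ico]
  intro i hi j hj hij
  have hi := (Finset.mem_Ico.mp (Finset.mem_coe.mp hi)).2
  have hj := (Finset.mem_Ico.mp (Finset.mem_coe.mp hj)).2
  exact hh (Set.mem_Iio.mpr (by omega)) (Set.mem_Iio.mpr (by omega)) hij

theorem startEdges_congr (A : Link k ℓ m) {a b : ℕ → V} (h : ∀ i < ℓ, a i = b i) :
    A.startEdges a = A.startEdges b := by
  unfold startEdges
  refine Finset.image_congr fun e _ => Finset.image_congr fun i _ => h i.1 i.2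

set_option maxHeartbeats 1000000 in
open Classical in
/-- Joining disjoint chains and an absorber to a Hamilton cycle, and completing a partial
colouring of it to a transversal. -/
theorem exists_transversal_of_pieces [Fintype V] (A : Link k ℓ m) (hlm : ℓ < m) (hk : 0 < k)
    {M T c y J Λ l : ℕ} (hcard : Fintype.card V = (m - ℓ) * T) (hT : 2 * m ≤ (m - ℓ) * T)
    (hM : T * A.newEdges.card = M) (hM0 : 0 < M) (H : Fin M → UniformHypergraph k V)
    {f : ℕ → ℕ → V} {t : ℕ → ℕ} (ht : ∀ j ≤ J, 1 ≤ t j)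
    (hf : ∀ j ≤ J, Set.InjOn (f j) (Set.Iio ((m - ℓ) * t j + ℓ)))
    (hdisj : ∀ i ≤ J, ∀ j ≤ J, i ≠ j →
      Disjoint (A.chainVerts (f i) (t i)) (A.chainVerts (f j) (t j)))
    {S R : Finset V} {H' : UniformHypergraph k V}
    (hS : ∀ j ≤ J, Disjoint (A.chainVerts (f j) (t j)) S)
    (hR : ∀ j ≤ J, Disjoint (A.chainVerts (f j) (t j)) R) (hSR : Disjoint S R)
    (hcon : A.Connects H' R c y) (hy : (J + 2) * ((m - ℓ) * c) ≤ y) {a b : ℕ → V}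
    (hab : ∀ L, Disjoint L S → Disjoint L (A.chainVerts (f 0) (t 0)) → L.card ≤ Λ →
      (m - ℓ) ∣ L.card → ∃ (u : ℕ) (q : ℕ → V), 1 ≤ u ∧
        Set.InjOn q (Set.Iio ((m - ℓ) * u + ℓ)) ∧ A.chainVerts q u = S ∪ L ∧
        A.chainEdges q u ⊆ H'.edges ∧ (∀ i < ℓ, q i = a i) ∧
        ∀ i < ℓ, q ((m - ℓ) * u + i) = b i)
    (hΛ : Fintype.card V ≤
      ((range (J + 1)).biUnion fun j => A.chainVerts (f j) (t j)).card + S.card + Λ)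
    (ψ₁ : Finset V → Fin M)
    (hψ₁ : Set.InjOn ψ₁ ((Finset.Icc 1 J).biUnion fun j => A.chainEdges (f j) (t j)))
    (hψ₁H : ∀ e ∈ (Finset.Icc 1 J).biUnion fun j => A.chainEdges (f j) (t j),
      e ∈ (H (ψ₁ e)).edges)
    {B₀ B : Finset (Fin M)} (hB : Disjoint B₀ B)
    (hC₁ : Disjoint (((Finset.Icc 1 J).biUnion fun j => A.chainEdges (f j) (t j)).image ψ₁) B₀)
    (hcover : ∀ i, i ∈ ((Finset.Icc 1 J).biUnion fun j => A.chainEdges (f j) (t j)).image ψ₁ ∨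
      i ∈ B₀ ∨ i ∈ B)
    (hB₀ : B₀.card + l = (A.chainEdges (f 0) (t 0)).card)
    (habs : ∀ U ⊆ B, U.card = l → ∃ ψ : Finset V → Fin M,
      Set.InjOn ψ (A.chainEdges (f 0) (t 0)) ∧
      ∀ e ∈ A.chainEdges (f 0) (t 0), ψ e ∈ B₀ ∪ U ∧ e ∈ (H (ψ e)).edges)
    (hrest : ∀ e ∈ H'.edges, B.card ≤ (B.filter fun i => e ∈ (H i).edges).card + l) :
    ∃ F : UniformHypergraph k V, A.IsCycle F ∧ F.IsTransversal H := by
  have hw0 : 0 < m - ℓ := by omega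
  set E₁ := (Finset.Icc 1 J).biUnion fun j => A.chainEdges (f j) (t j) with hE₁
  set X := (range (J + 1)).biUnion fun j => A.chainVerts (f j) (t j) with hX
  have hyJ : J * ((m - ℓ) * c) + 2 * ((m - ℓ) * c) ≤ y := by rw [← Nat.add_mul]; exact hy
  obtain ⟨g, T', R', hT', hR'R, hR'card, hg, hgV, hgE, hgE', hg0, hgJ⟩ :=
    A.exists_merge hcon f t J ht hf hdisj hR (by omega)
  have hXS : Disjoint X S := by
    rw [hX, Finset.disjoint_biUnion_left]
    intro j hj
    exact hS j (by have := Finset.mem_range.mp hj; omega)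
  have hgS : Disjoint (A.chainVerts g T') S := by
    rw [hgV, Finset.disjoint_union_left]
    exact ⟨hXS, (hSR.mono_right hR'R).symm⟩
  have hg0R : ∀ i < ℓ, g i ∉ R := fun i hi hiR => by
    rw [hg0 i hi] at hiR
    exact Finset.disjoint_left.mp (hR 0 (Nat.zero_le _))
      (A.mem_chainVerts.mpr ⟨i, by omega, rfl⟩) hiR
  have hgJR : ∀ i < ℓ, g ((m - ℓ) * T' + i) ∉ R := fun i hi hiR => by
    rw [hgJ i hi] at hiR
    exact Finset.disjoint_left.mp (hR J le_rfl)
      (A.mem_chainVerts.mpr ⟨(m - ℓ) * t J + i, by omega, rfl⟩) hiR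
  -- Absorbing the empty set shows that `a` and `b` are injective with values in `S`. Since they do
  -- not depend on `L`, the connections can be made before the set of leftover vertices is known.
  obtain ⟨u₀, q₀, hu₀, hq₀, hq₀V, -, hq₀a, hq₀b⟩ :=
    hab ∅ (Finset.disjoint_empty_left _) (Finset.disjoint_empty_left _) (by simp) (by simp)
  rw [Finset.union_empty] at hq₀V
  have haS : ∀ i < ℓ, a i ∈ S := fun i hi => by
    rw [← hq₀a i hi, ← hq₀V]
    exact A.mem_chainVerts.mpr ⟨i, by omega, rfl⟩
  have hbS : ∀ i < ℓ, b i ∈ S := fun i hi => by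
    rw [← hq₀b i hi, ← hq₀V]
    exact A.mem_chainVerts.mpr ⟨(m - ℓ) * u₀ + i, by omega, rfl⟩
  have hainj : Set.InjOn a (Set.Iio ℓ) := fun i hi j hj hij => by
    rw [Set.mem_Iio] at hi hj
    rw [← hq₀a i hi, ← hq₀a j hj] at hij
    exact hq₀ (Set.mem_Iio.mpr (by omega)) (Set.mem_Iio.mpr (by omega)) hij
  have hbinj : Set.InjOn b (Set.Iio ℓ) := fun i hi j hj hij => by
    rw [Set.mem_Iio] at hi hj
    rw [← hq₀b i hi, ← hq₀b j hj] at hij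
    have := hq₀ (Set.mem_Iio.mpr (by omega)) (Set.mem_Iio.mpr (by omega)) hij
    omega
  have hginj : Set.InjOn (fun i => g ((m - ℓ) * T' + i)) (Set.Iio ℓ) := fun i hi j hj hij => by
    rw [Set.mem_Iio] at hi hj
    have := hg (Set.mem_Iio.mpr (by omega)) (Set.mem_Iio.mpr (by omega)) hij
    omega
  have hg0inj : Set.InjOn g (Set.Iio ℓ) :=
    hg.mono (Set.Iio_subset_Iio (by omega))
  have hgmem : ∀ i < (m - ℓ) * T' + ℓ, g i ∉ S := fun i hi =>
    Finset.disjoint_left.mp hgS (A.mem_chainVerts.mpr ⟨i, hi, rfl⟩)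
  obtain ⟨t₁, h₁, ht₁, ht₁c, hℓ₁, hh₁, hh₁s, hh₁e, hI₁, hh₁E⟩ :=
    hcon (fun i => g ((m - ℓ) * T' + i)) a hginj hainj
      (fun i hi j hj h => hgmem ((m - ℓ) * T' + i) (by omega) (by rw [h]; exact haS j hj))
      hgJR (fun i hi => Finset.disjoint_left.mp hSR (haS i hi)) R' (by omega)
  have hI₁card : (A.interior h₁ t₁).card ≤ (m - ℓ) * c :=
    (A.interior_card_le h₁ t₁).trans (Nat.mul_le_mul_left _ ht₁c)
  obtain ⟨t₂, h₂, ht₂, ht₂c, hℓ₂, hh₂, hh₂s, hh₂e, hI₂, hh₂E⟩ :=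
    hcon b g hbinj hg0inj
      (fun i hi j hj h => hgmem j (by omega) (by rw [← h]; exact hbS i hi))
      (fun i hi => Finset.disjoint_left.mp hSR (hbS i hi)) hg0R (R' ∪ A.interior h₁ t₁)
      (by have := Finset.card_union_le R' (A.interior h₁ t₁); omega)
  set I₁ := A.interior h₁ t₁ with hI₁def
  set I₂ := A.interior h₂ t₂ with hI₂def
  have hRX : Disjoint X R := by
    rw [hX, Finset.disjoint_biUnion_left]
    intro j hj
    exact hR j (by have := Finset.mem_range.mp hj; omega)
  have hI₁R : I₁ ⊆ R := hI₁.trans Finset.sdiff_subset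
  have hI₂R : I₂ ⊆ R := hI₂.trans Finset.sdiff_subset
  have hI₁g : Disjoint I₁ (A.chainVerts g T') := by
    rw [hgV, Finset.disjoint_union_right]
    exact ⟨(hRX.mono_right hI₁R).symm, Finset.sdiff_disjoint.mono_left hI₁⟩
  have hI₂' : Disjoint I₂ (R' ∪ I₁) := Finset.sdiff_disjoint.mono_left hI₂
  rw [Finset.disjoint_union_right] at hI₂'
  have hI₂g : Disjoint I₂ (A.chainVerts g T') := by
    rw [hgV, Finset.disjoint_union_right]
    exact ⟨(hRX.mono_right hI₂R).symm, hI₂'.1⟩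
  have hI₁S : Disjoint I₁ S := (hSR.mono_right hI₁R).symm
  have hI₂S : Disjoint I₂ S := (hSR.mono_right hI₂R).symm
  set Z := A.chainVerts g T' ∪ I₁ ∪ S ∪ I₂ with hZ
  have hZcard : Z.card = (m - ℓ) * T' + ℓ + ((m - ℓ) * t₁ - ℓ) + ((m - ℓ) * u₀ + ℓ) +
      ((m - ℓ) * t₂ - ℓ) := by
    rw [hZ, Finset.card_union_of_disjoint, Finset.card_union_of_disjoint,
      Finset.card_union_of_disjoint hI₁g.symm, A.card_chainVerts hg, A.card_interior hh₁,
      A.card_interior hh₂, ← hq₀V, A.card_chainVerts hq₀]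
    · rw [Finset.disjoint_union_left]
      exact ⟨hgS, hI₁S⟩
    · rw [Finset.disjoint_union_left, Finset.disjoint_union_left]
      exact ⟨⟨hI₂g.symm, hI₂'.2.symm⟩, hI₂S.symm⟩
  set L := Finset.univ \ Z with hL
  have hLcard : L.card = Fintype.card V - Z.card := by
    rw [hL, Finset.card_sdiff_of_subset (Finset.subset_univ _), Finset.card_univ]
  -- Modulo `m - ℓ`, the two chains contribute `ℓ` vertices each and the two interiors `-ℓ` each, so
  -- the leftover set automatically has admissible size.
  have hLdvd : (m - ℓ) ∣ L.card := by
    have : Z.card = (m - ℓ) * (T' + t₁ + u₀ + t₂) := by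
      rw [hZcard, Nat.mul_add, Nat.mul_add, Nat.mul_add]
      omega
    rw [hLcard, hcard, this]
    exact Nat.dvd_sub (Nat.dvd_mul_right _ _) (Nat.dvd_mul_right _ _)
  have hLΛ : L.card ≤ Λ := by
    have h1 : (X ∪ S).card ≤ Z.card := by
      refine Finset.card_le_card ?_
      rw [hZ, hgV]
      intro v hv
      simp only [Finset.mem_union] at hv ⊢
      tauto
    rw [Finset.card_union_of_disjoint hXS] at h1
    omega
  have hLZ : Disjoint L Z := Finset.sdiff_disjoint
  have hX0 : A.chainVerts (f 0) (t 0) ⊆ Z := by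
    intro v hv
    have : v ∈ X := Finset.mem_biUnion.mpr ⟨0, by simp, hv⟩
    rw [hZ, hgV]
    simp only [Finset.mem_union]
    tauto
  have hSZ : S ⊆ Z := fun v hv => by rw [hZ]; simp only [Finset.mem_union]; tauto
  obtain ⟨u, q, hu, hq, hqV, hqE, hqa, hqb⟩ :=
    hab L (hLZ.mono_right hSZ) (hLZ.mono_right hX0) hLΛ hLdvd
  have hgZ : A.chainVerts g T' ⊆ Z := fun v hv => by
    rw [hZ]; simp only [Finset.mem_union]; tauto
  have hI₁Z : I₁ ⊆ Z := fun v hv => by rw [hZ]; simp only [Finset.mem_union]; tauto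
  have hI₂Z : I₂ ⊆ Z := fun v hv => by rw [hZ]; simp only [Finset.mem_union]; tauto
  obtain ⟨F, T'', hT'', hF, hFper, hFE⟩ := A.exists_closed hg hh₁ hq hh₂ hh₁s
    (fun i hi => (hh₁e i hi).trans (hqa i hi).symm)
    (fun i hi => (hh₂s i hi).trans (hqb i hi).symm) hh₂e hℓ₂
    (by rw [hqV, Finset.disjoint_union_right]; exact ⟨hgS, (hLZ.mono_right hgZ).symm⟩)
    hI₁g
    (by rw [hqV, Finset.disjoint_union_right]; exact ⟨hI₁S, (hLZ.mono_right hI₁Z).symm⟩)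
    hI₂g
    (by rw [hqV, Finset.disjoint_union_right]; exact ⟨hI₂S, (hLZ.mono_right hI₂Z).symm⟩)
    hI₂'.2
    (by
      refine Finset.eq_univ_iff_forall.mpr fun v => ?_
      rw [hqV]
      by_cases hv : v ∈ Z
      · rw [hZ] at hv
        simp only [Finset.mem_union] at hv ⊢
        tauto
      · have : v ∈ L := Finset.mem_sdiff.mpr ⟨Finset.mem_univ _, hv⟩
        simp only [Finset.mem_union]
        tauto)
  have hTT : T'' = T := Nat.eq_of_mul_eq_mul_left hw0 (hT''.symm.trans hcard)
  subst hTT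
  obtain ⟨F', hF'cyc, hF'E, hF'card⟩ := A.exists_isCycle hlm hk hT hcard hF hFper
  refine ⟨F', hF'cyc, ?_⟩
  have hpieces : ∀ j ≤ J, A.chainEdges (f j) (t j) ⊆ F'.edges := by
    intro j hj
    rw [hF'E, hFE]
    intro e he
    have : e ∈ A.chainEdges g T' :=
      hgE (Finset.mem_biUnion.mpr ⟨j, Finset.mem_range.mpr (by omega), he⟩)
    simp only [Finset.mem_union]
    tauto
  -- The start edges permitted in a connection belong to the chains being joined. Hence an edge in
  -- none of the given pieces lies in `H'`.
  have hrest' : ∀ e ∈ F'.edges, e ∉ E₁ → e ∉ A.chainEdges (f 0) (t 0) → e ∈ H'.edges := by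
    intro e he h1 h0
    have hg' : e ∈ A.chainEdges g T' → e ∈ H'.edges := by
      intro he
      rcases Finset.mem_union.mp (hgE' he) with h | h
      · obtain ⟨j, hj, hje⟩ := Finset.mem_biUnion.mp h
        rcases Nat.eq_zero_or_pos j with rfl | hj0
        · exact absurd hje h0
        · exact absurd (Finset.mem_biUnion.mpr ⟨j, Finset.mem_Icc.mpr
            ⟨hj0, by have := Finset.mem_range.mp hj; omega⟩, hje⟩) h1
      · exact h
    rw [hF'E, hFE] at he
    simp only [Finset.mem_union] at he
    rcases he with ((he | he) | he) | he
    · exact hg' he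
    · have := hh₁E he
      simp only [Finset.mem_union] at this
      rcases this with (h | h) | h
      · exact h
      · exact hg' (A.endEdges_subset g hT' h)
      · rw [A.startEdges_congr fun i hi => (hqa i hi).symm] at h
        exact hqE (A.startEdges_subset q hu h)
    · exact hqE he
    · have := hh₂E he
      simp only [Finset.mem_union] at this
      rcases this with (h | h) | h
      · exact h
      · rw [A.startEdges_congr fun i hi => (hqb i hi).symm] at h
        exact hqE (A.endEdges_subset q hu h)
      · exact hg' (A.startEdges_subset g hT' h)
  have hE₁0 : Disjoint E₁ (A.chainEdges (f 0) (t 0)) := by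
    rw [Finset.disjoint_left]
    intro e he he0
    obtain ⟨j, hj, hje⟩ := Finset.mem_biUnion.mp he
    obtain ⟨hj1, hjJ⟩ := Finset.mem_Icc.mp hj
    have hc := A.card_of_mem_chainEdges (hf 0 (Nat.zero_le _)) he0
    obtain ⟨v, hv⟩ : e.Nonempty := Finset.card_pos.mp (by omega)
    exact Finset.disjoint_left.mp (hdisj j hjJ 0 (Nat.zero_le _) (by omega))
      (A.subset_chainVerts hje hv) (A.subset_chainVerts he0 hv)
  refine UniformHypergraph.isTransversal_of_absorber (hF'card.trans hM) (E₁ := E₁)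
    (E₀ := A.chainEdges (f 0) (t 0)) ?_ (hpieces 0 (Nat.zero_le _)) hE₁0 ψ₁ hψ₁ hψ₁H hB hC₁
    hcover hB₀ habs ?_ hM0
  · intro e he
    obtain ⟨j, hj, hje⟩ := Finset.mem_biUnion.mp he
    exact hpieces j (Finset.mem_Icc.mp hj).2 hje
  · intro e he h1 h0
    -- At most `l` colours of `B` miss `e`, and this passes to the subset of `B` not used by `ψ₁`.
    have h2 := hrest e (hrest' e he h1 h0)
    have h3 : ((B \ E₁.image ψ₁).filter fun i => ¬ e ∈ (H i).edges).card ≤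
        (B.filter fun i => ¬ e ∈ (H i).edges).card :=
      Finset.card_le_card (Finset.filter_subset_filter _ Finset.sdiff_subset)
    have h4 := Finset.card_filter_add_card_filter_not (s := B \ E₁.image ψ₁)
      (fun i => e ∈ (H i).edges)
    have h5 := Finset.card_filter_add_card_filter_not (s := B) (fun i => e ∈ (H i).edges)
    omega

end Link

/-! ### Asymptotic estimates and linear-size reservoirs -/

open Filter Topology in
theorem eventually_mul_pow_mul_exp_lt (a : ℕ) {c C ε : ℝ} (hc : 0 < c) (hε : 0 < ε) :
    ∀ᶠ n : ℕ in atTop, C * (n : ℝ) ^ a * Real.exp (-(c * n)) < ε := by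
  have h1 : Tendsto (fun n : ℕ => c * (n : ℝ)) atTop atTop :=
    tendsto_natCast_atTop_atTop.const_mul_atTop hc
  have h2 := ((Real.tendsto_pow_mul_exp_neg_atTop_nhds_zero a).comp h1).const_mul (C / c ^ a)
  rw [mul_zero] at h2
  filter_upwards [h2.eventually (gt_mem_nhds hε)] with n hn
  have hca : c ^ a ≠ 0 := pow_ne_zero _ hc.ne'
  calc C * (n : ℝ) ^ a * Real.exp (-(c * n))
      = C / c ^ a * ((c * n) ^ a * Real.exp (-(c * n))) := by
        rw [mul_pow]; field_simp
    _ < ε := hn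

open Filter Topology Asymptotics in
theorem eventually_mul_pow_le_mul_descFactorial (K d : ℕ) {a b : ℝ} (hab : a < b) :
    ∀ᶠ r : ℕ in atTop, a * (r : ℝ) ^ K ≤ b * ((r - d).descFactorial K : ℝ) := by
  have hne : ∀ᶠ r : ℕ in atTop, ((r : ℝ) ^ K) ≠ 0 := by
    filter_upwards [eventually_gt_atTop 0] with r hr
    positivity
  have h0 : Tendsto (fun r : ℕ => ((r - d : ℕ) : ℝ) / r) atTop (𝓝 1) := by
    have h1 : Tendsto (fun r : ℕ => 1 - (d : ℝ) / r) atTop (𝓝 (1 - 0)) :=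
      tendsto_const_nhds.sub (tendsto_const_div_atTop_nhds_zero_nat (d : ℝ))
    rw [sub_zero] at h1
    refine h1.congr' ?_
    filter_upwards [eventually_gt_atTop 0, eventually_ge_atTop d] with r hr hd
    have : (r : ℝ) ≠ 0 := by positivity
    rw [Nat.cast_sub hd]
    field_simp
  have h2 : Tendsto (fun r : ℕ => ((r - d).descFactorial K : ℝ) / ((r - d : ℕ) : ℝ) ^ K) atTop
      (𝓝 1) := by
    have h3 : Tendsto (fun r : ℕ => (r.descFactorial K : ℝ) / (r : ℝ) ^ K) atTop (𝓝 1) :=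
      (isEquivalent_iff_tendsto_one hne).mp (isEquivalent_descFactorial K)
    exact h3.comp (tendsto_sub_atTop_nat d)
  have h4 : Tendsto (fun r : ℕ => b * (((r - d).descFactorial K : ℝ) / ((r - d : ℕ) : ℝ) ^ K *
      (((r - d : ℕ) : ℝ) / r) ^ K)) atTop (𝓝 (b * (1 * 1 ^ K))) :=
    (h2.mul (h0.pow K)).const_mul b
  rw [one_pow, mul_one, mul_one] at h4
  filter_upwards [h4.eventually (lt_mem_nhds hab), eventually_gt_atTop d] with r hr hd
  have hr0 : (0 : ℝ) < r := by
    have : 0 < r := by omega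
    exact_mod_cast this
  have hrd : (0 : ℝ) < ((r - d : ℕ) : ℝ) := by
    have : 0 < r - d := by omega
    exact_mod_cast this
  have h5 : b * (((r - d).descFactorial K : ℝ) / ((r - d : ℕ) : ℝ) ^ K *
      (((r - d : ℕ) : ℝ) / r) ^ K) * (r : ℝ) ^ K = b * ((r - d).descFactorial K : ℝ) := by
    rw [div_pow]; field_simp
  rw [← h5]
  exact mul_le_mul_of_nonneg_right hr.le (by positivity)

/-- Use `exp (2x) ≥ 1 + 2x` and `(1 - x)(1 + 2x) = 1 + x(1 - 2x) ≥ 1`. -/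
theorem exp_neg_two_mul_le {x : ℝ} (h0 : 0 ≤ x) (h1 : x ≤ 1 / 2) : Real.exp (-(2 * x)) ≤ 1 - x := by
  rw [Real.exp_neg, inv_le_comm₀ (Real.exp_pos _) (by linarith)]
  refine le_trans ?_ (Real.add_one_le_exp (2 * x))
  rw [inv_le_iff_one_le_mul₀ (by linarith)]
  nlinarith

namespace UniformHypergraph

open Filter in
/-- Linear-size random subsets inherit large relative degrees. -/
theorem exists_linear_reservoir {k d : ℕ} (hdk : d < k) {q q' : ℝ} (hq : q' < q) (a : ℕ) :
    ∃ ρ₁ : ℝ, 0 < ρ₁ ∧ ∀ ρ : ℝ, 0 < ρ → ρ ≤ ρ₁ → ∀ᶠ n : ℕ in atTop,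
      ∀ (I : Type) [Fintype I] (H : I → UniformHypergraph k (Fin n)) (W : Finset (Fin n)),
        (Fintype.card I : ℝ) ≤ a * n → n ≤ 2 * W.card →
        (∀ i, (H i).RichOn d W (q * (W.card : ℝ) ^ (k - d))) →
        ∃ R ⊆ W, R.card = ⌊ρ * n⌋₊ ∧ ∀ i, (H i).RichOn d R (q' * (R.card : ℝ) ^ (k - d)) := by
  set K := k - d with hK
  have hK0 : 0 < K := by omega
  have hKR : (0 : ℝ) < K := by exact_mod_cast hK0
  set ε := (q - q') / 2 with hε
  have hε0 : 0 < ε := by rw [hε]; linarith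
  set c := ε ^ 2 / (4 * K) with hc
  have hc0 : 0 < c := by positivity
  -- The tail exponent is about `2cr`. One factor `exp (-cr)` pays for restricting to injective
  -- samples, which needs `2r/|W| ≤ c` and hence `ρ ≤ c/4`; the other beats the polynomial union
  -- bound.
  refine ⟨min (1 / 8) (c / 4), by positivity, fun ρ hρ hρ₁ => ?_⟩
  have hρ8 : ρ ≤ 1 / 8 := hρ₁.trans (min_le_left _ _)
  have hρc : ρ ≤ c / 4 := hρ₁.trans (min_le_right _ _)
  have hfl : Tendsto (fun n : ℕ => ⌊ρ * (n : ℝ)⌋₊) atTop atTop :=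
    tendsto_nat_floor_atTop.comp (tendsto_natCast_atTop_atTop.const_mul_atTop hρ)
  have hdesc := hfl.eventually
    (eventually_mul_pow_le_mul_descFactorial K 0 (a := q') (b := q - ε) (by rw [hε]; linarith))
  have hexp := eventually_mul_pow_mul_exp_lt (d + 1) (c := c * ρ)
    (C := a * Real.exp (ε ^ 2 / 2 + c)) (ε := 1) (by positivity) one_pos
  filter_upwards [hdesc, hexp, eventually_gt_atTop 0] with n hdesc hexp hn I _ H W hI hW hrich
  set r := ⌊ρ * (n : ℝ)⌋₊ with hr
  have hnR : (0 : ℝ) < n := by exact_mod_cast hn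
  have hWn : (n : ℝ) ≤ 2 * W.card := by exact_mod_cast hW
  have hW0 : (0 : ℝ) < W.card := by linarith
  have hrle : (r : ℝ) ≤ ρ * n := Nat.floor_le (by positivity)
  have hrW' : (r : ℝ) ≤ 2 * ρ * W.card := by nlinarith
  have hrge : ρ * n < r + 1 := Nat.lt_floor_add_one _
  have hrW : r ≤ W.card := by
    have : (r : ℝ) ≤ W.card := by nlinarith
    exact_mod_cast this
  have hnum : (Fintype.card I : ℝ) * (Fintype.card (Fin n) : ℝ) ^ d *
      ((W.card : ℝ) ^ r * Real.exp (-(((r / K : ℕ) : ℝ) * ε ^ 2 / 2))) <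
        ((W.card : ℝ) - r) ^ r := by
    rw [Fintype.card_fin]
    have h1 : (W.card : ℝ) ^ r * Real.exp (-(c * r)) ≤ ((W.card : ℝ) - r) ^ r := by
      have h2 : (W.card : ℝ) * Real.exp (-c) ≤ (W.card : ℝ) - r := by
        have hx : (r : ℝ) / W.card ≤ 2 * ρ := by rwa [div_le_iff₀ hW0]
        have h3 := exp_neg_two_mul_le (x := (r : ℝ) / W.card) (by positivity) (by linarith)
        have h4 : Real.exp (-c) ≤ 1 - (r : ℝ) / W.card :=
          (Real.exp_le_exp.mpr (by linarith)).trans h3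
        have h5 := mul_le_mul_of_nonneg_left h4 hW0.le
        rw [mul_sub, mul_one, mul_div_cancel₀ _ hW0.ne'] at h5
        exact h5
      calc (W.card : ℝ) ^ r * Real.exp (-(c * r)) = ((W.card : ℝ) * Real.exp (-c)) ^ r := by
            rw [mul_pow, ← Real.exp_nat_mul]; congr 2; ring
        _ ≤ _ := pow_le_pow_left₀ (by positivity) h2 _
    have hbge : (r : ℝ) / K ≤ ((r / K : ℕ) : ℝ) + 1 := by
      rw [div_le_iff₀ hKR]
      have := Nat.lt_div_mul_add (a := r) hK0
      have h' : (r : ℝ) < (r / K : ℕ) * K + K := by exact_mod_cast this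
      linarith
    have h2 : Real.exp (-(((r / K : ℕ) : ℝ) * ε ^ 2 / 2)) ≤
        Real.exp (ε ^ 2 / 2) * (Real.exp (-(c * r)) * Real.exp (-(c * r))) := by
      rw [← Real.exp_add, ← Real.exp_add]
      refine Real.exp_le_exp.mpr ?_
      have h3 : c * r + c * r = (r : ℝ) / K * (ε ^ 2 / 2) := by
        rw [hc]; field_simp; ring
      have h4 := mul_le_mul_of_nonneg_right hbge (show 0 ≤ ε ^ 2 / 2 by positivity)
      linarith
    have h5 : Real.exp (-(c * r)) ≤ Real.exp c * Real.exp (-(c * ρ * n)) := by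
      rw [← Real.exp_add]
      refine Real.exp_le_exp.mpr ?_
      have := mul_le_mul_of_nonneg_left hrge.le hc0.le
      nlinarith
    have h6 : (Fintype.card I : ℝ) * (n : ℝ) ^ d * (Real.exp (ε ^ 2 / 2) * Real.exp (-(c * r))) <
        1 := by
      refine lt_of_le_of_lt ?_ hexp
      calc (Fintype.card I : ℝ) * (n : ℝ) ^ d * (Real.exp (ε ^ 2 / 2) * Real.exp (-(c * r)))
          ≤ (a * n) * (n : ℝ) ^ d * (Real.exp (ε ^ 2 / 2) *
            (Real.exp c * Real.exp (-(c * ρ * n)))) := by gcongr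
        _ = a * Real.exp (ε ^ 2 / 2 + c) * (n : ℝ) ^ (d + 1) * Real.exp (-(c * ρ * n)) := by
            rw [Real.exp_add, pow_succ]; ring
    have hpos : 0 < (W.card : ℝ) ^ r * Real.exp (-(c * r)) := by positivity
    calc (Fintype.card I : ℝ) * (n : ℝ) ^ d *
          ((W.card : ℝ) ^ r * Real.exp (-(((r / K : ℕ) : ℝ) * ε ^ 2 / 2)))
        ≤ (Fintype.card I : ℝ) * (n : ℝ) ^ d * ((W.card : ℝ) ^ r *
          (Real.exp (ε ^ 2 / 2) * (Real.exp (-(c * r)) * Real.exp (-(c * r))))) := by gcongr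
      _ = ((Fintype.card I : ℝ) * (n : ℝ) ^ d * (Real.exp (ε ^ 2 / 2) * Real.exp (-(c * r)))) *
          ((W.card : ℝ) ^ r * Real.exp (-(c * r))) := by ring
      _ < 1 * ((W.card : ℝ) ^ r * Real.exp (-(c * r))) := mul_lt_mul_of_pos_right h6 hpos
      _ ≤ _ := by rw [one_mul]; exact h1
  obtain ⟨R, hRW, hRcard, hR⟩ := exists_reservoir H (Finset.card_pos.mp (by exact_mod_cast hW0))
    hε0.le hrich (Nat.div_mul_le_self r K) hrW hnum
  refine ⟨R, hRW, hRcard, fun i => (hR i).mono (Finset.Subset.refl _) ?_⟩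
  rw [hRcard]
  simpa using hdesc

end UniformHypergraph

/-! ### The colour absorber and the almost-cover by rainbow chains -/

namespace Link

open Finset

variable {k ℓ m : ℕ}

set_option maxHeartbeats 1000000 in
open Filter Classical in
/-- A chain whose edges absorb colours: with a fixed set of colours and any `l` further colours
from a reservoir they can be coloured bijectively. -/
theorem exists_colour_absorber (A : Link k ℓ m) (hlm : ℓ < m) {d : ℕ} (hd : 0 < d) (hdk : d < k)
    {δ x γ ν : ℝ} (hF : A.ForcesHamiltonCycle d δ) (hE : A.graph.edges.Nonempty) (hγ : 0 < γ)
    (hγ1 : γ ≤ 1) (hx : δ < x) (hν : 0 < ν) :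
    ∃ ε : ℝ, 0 < ε ∧ ∀ᶠ T : ℕ in atTop, ∀ (n M : ℕ), n = (m - ℓ) * T →
      M = T * A.newEdges.card → ∀ H : Fin M → UniformHypergraph k (Fin n),
      (∀ i, (H i).RichOn d univ ((x + γ) * (n : ℝ) ^ (k - d))) →
      ∃ (f : ℕ → Fin n) (t : ℕ), 1 ≤ t ∧ (t : ℝ) ≤ ν * T ∧ Set.InjOn f (Set.Iio ((m - ℓ) * t + ℓ)) ∧
        ∀ l b : ℕ, (l : ℝ) ≤ ε * n → (b : ℝ) ≤ ε * n →
        ∃ B₀ B₁ : Finset (Fin M), Disjoint B₀ B₁ ∧ B₀.card + l = (A.chainEdges f t).card ∧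
          B₁.card = b ∧ ∀ U ⊆ B₁, U.card = l → ∃ ψ : Finset (Fin n) → Fin M,
            Set.InjOn ψ (A.chainEdges f t) ∧
            ∀ e ∈ A.chainEdges f t, ψ e ∈ B₀ ∪ U ∧ e ∈ (H (ψ e)).edges := by
  have hw0 : 0 < m - ℓ := by omega
  have hwR : (1 : ℝ) ≤ ((m - ℓ : ℕ) : ℝ) := by exact_mod_cast hw0
  have hD0 : 0 < A.newEdges.card :=
    Finset.card_pos.mpr (A.newEdges_nonempty hlm (by omega) hE)
  have hDR : (1 : ℝ) ≤ (A.newEdges.card : ℝ) := by exact_mod_cast hD0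
  set D := A.newEdges.card with hD
  set es := A.start.edges.card with hes
  set κ := γ ^ 5 / 512 with hκ
  have hκ0 : 0 < κ := by positivity
  have hκ1 : κ ≤ 1 / 512 := by
    have := pow_le_one₀ (n := 5) hγ.le hγ1
    rw [hκ]; linarith
  -- The segment has about `μT` windows: few enough edges compared with the `T * D` colours for the
  -- bipartite absorber, yet linearly many, so that `l` and `b` may be linear in `n`.
  set μ := min (κ / 16) ν with hμ
  have hμ0 : 0 < μ := by positivity
  have hμκ : μ ≤ κ / 16 := min_le_left _ _
  set ε := κ * μ / (8 * ((m - ℓ : ℕ) : ℝ)) with hε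
  have hε0 : 0 < ε := by positivity
  obtain ⟨n₁, hn₁⟩ := hF (x - δ) (by linarith)
  have hexp := eventually_mul_pow_mul_exp_lt 2 (c := κ * μ / 16) (C := 1) (ε := 1 / 2)
    (by positivity) (by norm_num)
  have hbig : ∀ᶠ T : ℕ in atTop, 2 / μ + 16 * es / κ ≤ (T : ℝ) :=
    tendsto_natCast_atTop_atTop.eventually_ge_atTop _
  refine ⟨ε, hε0, ?_⟩
  filter_upwards [hexp, hbig, eventually_ge_atTop (n₁ + d + 2 * ℓ + 1)] with T hexp hbig hT n M hn
    hM H hH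
  have hT0 : (0 : ℝ) < T := by
    have : 0 < T := by omega
    exact_mod_cast this
  have hnT : T ≤ n := by rw [hn]; exact Nat.le_mul_of_pos_left _ hw0
  have hnR : (n : ℝ) = ((m - ℓ : ℕ) : ℝ) * T := by rw [hn]; push_cast; ring
  have hMR : (M : ℝ) = T * D := by rw [hM]; push_cast; ring
  have hM0 : 0 < M := by rw [hM]; exact Nat.mul_pos (by omega) hD0
  have hbig1 : 2 ≤ μ * T := by
    have h1 : 2 / μ ≤ T := le_trans (le_add_of_nonneg_right (by positivity)) hbig
    rw [div_le_iff₀ hμ0] at h1; linarith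
  have hbig2 : 16 * (es : ℝ) ≤ κ * T := by
    have h1 : 16 * (es : ℝ) / κ ≤ T := le_trans (le_add_of_nonneg_left (by positivity)) hbig
    rw [div_le_iff₀ hκ0] at h1; linarith
  have : Nonempty (Fin M) := ⟨⟨0, hM0⟩⟩
  have hpop := UniformHypergraph.richOn_popular (B := (Finset.univ : Finset (Fin M)))
    Finset.univ_nonempty hγ.le fun i _ => hH i
  set P := UniformHypergraph.popular H univ (γ * (univ : Finset (Fin M)).card) with hP
  -- Here the uncoloured threshold enters: the popular edges contain a Hamilton cycle, and each of
  -- its edges is available in at least `γM` colours.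
  have hmin : (δ + (x - δ)) * (n : ℝ) ^ (k - d) ≤
      ((P.comap (Function.Embedding.refl _)).minDegree d : ℝ) := by
    refine UniformHypergraph.le_minDegree_comap _ (R := univ) ?_ (by simp) (by omega)
    refine hpop.mono (Finset.Subset.refl _) ?_
    rw [Fintype.card_fin]
    apply le_of_eq; ring
  obtain ⟨F, hFc, hFE⟩ := hn₁ n (by omega) (by rw [hn]; exact Nat.dvd_mul_right _ _) _ hmin
  obtain ⟨f, T', -, hcardT, hf, hfE⟩ := A.exists_of_isCycle hlm hFc
  have hTT : T' = T := by
    rw [Fintype.card_fin] at hcardT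
    exact Nat.eq_of_mul_eq_mul_left hw0 (hcardT.symm.trans hn)
  subst hTT
  have hfP : ∀ e ∈ A.chainEdges f T', e ∈ P.edges := by
    intro e he
    have := (Finset.mem_filter.mp (hFE (hfE he))).2
    rwa [Finset.map_refl] at this
  set t := ⌊μ * (T' : ℝ)⌋₊ with ht
  have htle : (t : ℝ) ≤ μ * T' := Nat.floor_le (by positivity)
  have htge : μ * T' < t + 1 := Nat.lt_floor_add_one _
  have ht1 : 1 ≤ t := by
    have : (0 : ℝ) < t := by linarith
    exact_mod_cast this
  have ht4 : 4 * t ≤ T' := by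
    have : (4 * t : ℝ) ≤ T' := by nlinarith
    exact_mod_cast this
  have hinj : Set.InjOn f (Set.Iio ((m - ℓ) * t + ℓ)) := by
    refine hf.mono (Set.Iio_subset_Iio ?_)
    have h1 : (m - ℓ) * t + (m - ℓ) * (T' - t) = (m - ℓ) * T' := by
      rw [← Nat.mul_add]; congr 1; omega
    have h2 : T' - t ≤ (m - ℓ) * (T' - t) := Nat.le_mul_of_pos_left _ hw0
    omega
  refine ⟨f, t, ht1, htle.trans (mul_le_mul_of_nonneg_right (min_le_right _ _) hT0.le), hinj,
    fun l b hl hb => ?_⟩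
  set E := A.chainEdges f t with hEdef
  have hEcard : E.card = t * D + es := A.card_chainEdges hlm ht1 hinj
  have hEfin : Fintype.card {e // e ∈ E} = E.card := Fintype.card_coe E
  have hECR : (E.card : ℝ) = t * D + es := by rw [hEcard]; push_cast; ring
  have hEpos : 0 < E.card := by
    rw [hEcard]; exact Nat.add_pos_left (Nat.mul_pos ht1 hD0) _
  have hEge : μ * T' / 2 ≤ E.card := by
    rw [hECR]
    have h1 : (t : ℝ) ≤ t * D := le_mul_of_one_le_right (by positivity) hDR
    have h2 : (0 : ℝ) ≤ es := by positivity
    linarith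
  have hεn : ε * n = κ * μ / 8 * T' := by
    rw [hnR, hε]; field_simp
  have hl' : (l : ℝ) ≤ κ * μ / 8 * T' := hεn ▸ hl
  have hb' : (b : ℝ) ≤ κ * μ / 8 * T' := hεn ▸ hb
  have hμ1 : μ ≤ 1 := by linarith
  have hcoef : κ * μ / 8 * T' ≤ T' := by
    have : κ * μ ≤ 1 := mul_le_one₀ (by linarith) hμ0.le hμ1
    nlinarith
  have hdeg : ∀ a : {e // e ∈ E}, γ * Fintype.card (Fin M) ≤
      ((univ.filter fun c => a.1 ∈ (H c).edges).card : ℝ) := by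
    intro e
    have h1 := (UniformHypergraph.mem_popular.mp
      (hfP e.1 (A.chainEdges_mono f (by omega) e.2))).2
    rw [← Finset.card_univ]
    convert h1 using 2
  have hm' : 8 * (Fintype.card {e // e ∈ E} : ℝ) ≤ γ ^ 5 / 512 * Fintype.card (Fin M) := by
    rw [hEfin, hECR, Fintype.card_fin, hMR, ← hκ]
    have h1 : 16 * (t : ℝ) ≤ κ * T' := by nlinarith
    have h2 := mul_le_mul_of_nonneg_right h1 (show (0 : ℝ) ≤ D by positivity)
    have h3 : κ * T' ≤ κ * T' * D := le_mul_of_one_le_right (by positivity) hDR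
    linarith
  have hl'' : 4 * (l : ℝ) ≤ γ ^ 5 / 512 * Fintype.card {e // e ∈ E} := by
    rw [hEfin, ← hκ]
    have := mul_le_mul_of_nonneg_left hEge hκ0.le
    linarith
  have hb'' : (b : ℝ) ≤ γ ^ 5 / 512 * Fintype.card (Fin M) := by
    rw [Fintype.card_fin, hMR, ← hκ]
    have h1 : (T' : ℝ) ≤ T' * D := le_mul_of_one_le_right (by positivity) hDR
    have h2 := mul_le_mul_of_nonneg_left h1 hκ0.le
    have h3 : κ * μ / 8 * T' ≤ κ * T' := by
      have : κ * μ ≤ κ := mul_le_of_le_one_right hκ0.le hμ1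
      nlinarith
    linarith
  have hexp' : (b : ℝ) * l * Real.exp (-(γ ^ 5 / 512 * Fintype.card {e // e ∈ E} / 8)) < 1 / 2 := by
    rw [hEfin, ← hκ]
    refine lt_of_le_of_lt ?_ hexp
    have h1 : (b : ℝ) * l ≤ 1 * (T' : ℝ) ^ 2 := by
      rw [one_mul, sq]
      exact mul_le_mul (hb'.trans hcoef) (hl'.trans hcoef) (by positivity) (by positivity)
    refine mul_le_mul h1 (Real.exp_le_exp.mpr ?_) (Real.exp_pos _).le (by positivity)
    have := mul_le_mul_of_nonneg_left hEge hκ0.le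
    linarith
  obtain ⟨B₀, B₁, hB, hB₀, hB₁, habs⟩ := exists_absorber_core
    (fun (e : {e // e ∈ E}) (c : Fin M) => e.1 ∈ (H c).edges) hγ hγ1 (by rwa [hEfin])
    (by rwa [Fintype.card_fin]) (l := l) (b := b)
    (fun a => by convert hdeg a) hm' hl'' hb'' hexp'
  refine ⟨B₀, B₁, hB, by rw [hB₀, hEfin], hB₁, fun U hU hUl => ?_⟩
  obtain ⟨ψ, hψ, hψ'⟩ := habs U hU hUl
  refine ⟨fun e => if h : e ∈ E then ψ ⟨e, h⟩ else Classical.arbitrary _, ?_, ?_⟩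
  · intro e he e' he' h
    rw [Finset.mem_coe] at he he'
    simp only [dif_pos he, dif_pos he'] at h
    exact congrArg Subtype.val (hψ h)
  · intro e he
    simp only [dif_pos he]
    exact ⟨by convert (hψ' ⟨e, he⟩).2, (hψ' ⟨e, he⟩).1⟩

end Link

namespace Link

open Finset

variable {k ℓ m : ℕ}

/-- Every large collection of dense hypergraphs contains, for every colour set, disjoint rainbow
chains of bounded length covering almost everything. -/
theorem exists_rainbow_chain_cover (A : Link k ℓ m) (hlm : ℓ < m) {d : ℕ} (hdk : d < k)
    {δ q : ℝ} (hF : A.ForcesHamiltonCycle d δ) (hq : δ < q) {p e : ℝ} (hp : 0 < p) (he : 0 < e)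
    (t₀ : ℕ) :
    ∃ t C₀ N₀ : ℕ, t₀ ≤ t ∧ 1 ≤ t ∧ ∀ (n M : ℕ) (H : Fin M → UniformHypergraph k (Fin n))
      (W : Finset (Fin n)) (C : Finset (Fin M)), N₀ ≤ W.card → C.Nonempty →
      (∀ i, (H i).RichOn d W (q * (W.card : ℝ) ^ (k - d))) → ∀ J : ℕ,
      (J : ℝ) ≤ (1 - p / e) * ((W.card / ((m - ℓ) * (t + ℓ)) : ℕ) : ℝ) →
      ((J : ℝ) + C₀) * (t * A.newEdges.card + A.start.edges.card) + e * C.card ≤ C.card →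
      ∃ (f : ℕ → ℕ → Fin n) (ψ : Finset (Fin n) → Fin M),
        (∀ j < J, Set.InjOn (f j) (Set.Iio ((m - ℓ) * t + ℓ)) ∧ A.chainVerts (f j) t ⊆ W) ∧
        (∀ i < J, ∀ j < J, i ≠ j → Disjoint (A.chainVerts (f i) t) (A.chainVerts (f j) t)) ∧
        Set.InjOn ψ ((range J).biUnion fun j => A.chainEdges (f j) t) ∧
        ∀ e ∈ (range J).biUnion fun j => A.chainEdges (f j) t, ψ e ∈ C ∧ e ∈ (H (ψ e)).edges := by
  classical
  have hw0 : 0 < m - ℓ := by omega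
  set K := k - d with hK
  have hK0 : 0 < K := by omega
  have hKR : (0 : ℝ) < K := by exact_mod_cast hK0
  -- The surplus over `δ` is split: `q - q'` is spent on passing to random blocks, `q' - δ` is what
  -- the threshold needs inside a block.
  set q' := (δ + q) / 2 with hq'
  set ε := (q - q') / 2 with hε
  have hε0 : 0 < ε := by rw [hε, hq']; linarith
  obtain ⟨n₁, hn₁⟩ := hF (q' - δ) (by rw [hq']; linarith)
  set c := ε ^ 2 / (2 * K) with hc
  have hc0 : 0 < c := by positivity
  have hdesc := eventually_mul_pow_le_mul_descFactorial K d (a := q') (b := q - ε)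
    (by rw [hε, hq']; linarith)
  have hexp := eventually_mul_pow_mul_exp_lt d (c := c) (C := 2 * Real.exp (c * (K + d))) hc0 hp
  obtain ⟨s₀, hs₀⟩ := Filter.eventually_atTop.mp (hdesc.and hexp)
  set t := t₀ + s₀ + n₁ + d + 1 with ht
  -- The block size is a multiple of `m - ℓ`, so the threshold applies inside a block, and a chain
  -- of length `t` fits. The excess is at most `(m - ℓ) * ℓ`, negligible for large `t`.
  set s := (m - ℓ) * (t + ℓ) with hs
  have hst : t + ℓ ≤ s := Nat.le_mul_of_pos_left _ hw0
  obtain ⟨hdesc, hexp⟩ := hs₀ s (by omega)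
  obtain ⟨N₁, hN₁⟩ := Filter.eventually_atTop.mp
    (eventually_mul_pow_le_mul_descFactorial s 0 (a := 1) (b := 2) (by norm_num))
  refine ⟨t, Fintype.card (Finset (Finset (Fin s))), N₁ + s + d, by omega, by omega, ?_⟩
  intro n M H W C hN hC hrich J hJ hCJ
  have hM : 0 < M := by
    obtain ⟨i, _⟩ := hC
    exact i.pos
  obtain ⟨ι, hι⟩ := exists_embedding_range W
  have hrich' : ∀ i, ((H i).comap ι).RichOn d univ (q * (W.card : ℝ) ^ K) := fun i =>
    UniformHypergraph.richOn_univ_of_le_minDegree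
      (UniformHypergraph.le_minDegree_comap ι (hrich i) hι.ge (by omega))
  let bad : Fin M → (Fin s ↪ Fin W.card) → Prop := fun i x =>
    ¬ (q - ε) * ((s - d).descFactorial K : ℝ) ≤ (((H i).comap ι).comap x).minDegree d
  have hbge : ((s : ℝ) - d) / K ≤ (((s - d) / K : ℕ) : ℝ) + 1 := by
    rw [div_le_iff₀ hKR]
    have := Nat.lt_div_mul_add (a := s - d) hK0
    have h' : ((s - d : ℕ) : ℝ) < ((s - d) / K : ℕ) * K + K := by exact_mod_cast this
    rw [Nat.cast_sub (by omega)] at h'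
    linarith
  have hpoor : ∀ i ∈ C, ((univ.filter (bad i)).card : ℝ) ≤
      p * Fintype.card (Fin s ↪ Fin W.card) := by
    intro i _
    have h1 := UniformHypergraph.card_poor_injections_le (s := s) (b := (s - d) / K) (by omega)
      ((H i).comap ι) hε0.le (hrich' i) (by omega) (Nat.div_mul_le_self _ _)
    have h2 : ((univ.filter (bad i)).card : ℝ) ≤ (s : ℝ) ^ d * ((W.card : ℝ) ^ s *
        Real.exp (-((((s - d) / K : ℕ) : ℝ) * ε ^ 2 / 2))) := by
      convert h1 using 2
    refine h2.trans ?_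
    have h3 : (W.card : ℝ) ^ s ≤ 2 * Fintype.card (Fin s ↪ Fin W.card) := by
      rw [Fintype.card_embedding_eq, Fintype.card_fin, Fintype.card_fin]
      have := hN₁ W.card (by omega)
      simpa using this
    have h4 : Real.exp (-((((s - d) / K : ℕ) : ℝ) * ε ^ 2 / 2)) ≤
        Real.exp (c * (K + d)) * Real.exp (-(c * s)) := by
      rw [← Real.exp_add]
      refine Real.exp_le_exp.mpr ?_
      have h5 := mul_le_mul_of_nonneg_right hbge (show 0 ≤ ε ^ 2 / 2 by positivity)
      have h6 : c * s - c * d = ((s : ℝ) - d) / K * (ε ^ 2 / 2) := by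
        rw [hc]; field_simp
      have h7 : c * K = ε ^ 2 / 2 := by rw [hc]; field_simp
      linarith
    calc (s : ℝ) ^ d * ((W.card : ℝ) ^ s *
          Real.exp (-((((s - d) / K : ℕ) : ℝ) * ε ^ 2 / 2)))
        ≤ (s : ℝ) ^ d * (2 * Fintype.card (Fin s ↪ Fin W.card) *
          (Real.exp (c * (K + d)) * Real.exp (-(c * s)))) := by gcongr
      _ = 2 * Real.exp (c * (K + d)) * (s : ℝ) ^ d * Real.exp (-(c * s)) *
          Fintype.card (Fin s ↪ Fin W.card) := by ring
      _ ≤ p * Fintype.card (Fin s ↪ Fin W.card) := by gcongr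
  obtain ⟨x, J', hJ', hgood, hdisj⟩ := exists_good_blocks (s := s) (p := p) (by omega) (by omega)
    bad C he (Finset.card_pos.mpr hC) (fun i hi => by convert hpoor i hi)
  have hgood' : ∀ j < J', ((C.filter fun i => bad i (x j)).card : ℝ) ≤ e * C.card :=
    fun j hj => by convert hgood j hj
  have hJJ : J ≤ J' := by exact_mod_cast hJ.trans hJ'
  have hfl : (⌊e * (C.card : ℝ)⌋₊ : ℝ) ≤ e * C.card := Nat.floor_le (by positivity)
  have hws : (m - ℓ) * t + ℓ ≤ s := by
    rw [hs, Nat.mul_add (m - ℓ) t ℓ]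
    exact Nat.add_le_add_left (Nat.le_mul_of_pos_left _ hw0) _
  obtain ⟨f, ψ, hf, hψ, hψH⟩ := A.exists_rainbow_chains hlm (fun i => (H i).comap ι) C
    (y := q' * (s : ℝ) ^ K) (t := t) (d := d) (s := s) (by omega) hws
    (fun G hG => hn₁ s (by omega) (Nat.dvd_mul_right _ _) G
      (by rw [add_sub_cancel]; exact hG)) x ⌊e * (C.card : ℝ)⌋₊ J
    (fun j hj => ⟨C.filter fun i => bad i (x j), Finset.filter_subset _ _,
      Nat.le_floor (hgood' j (by omega)), fun i hi hi' => by
        have h1 : ¬ bad i (x j) := fun h => hi' (Finset.mem_filter.mpr ⟨hi, h⟩)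
        exact hdesc.trans (not_not.mp h1)⟩)
    (by
      have : (((J + Fintype.card (Finset (Finset (Fin s)))) *
          (t * A.newEdges.card + A.start.edges.card) + ⌊e * (C.card : ℝ)⌋₊ : ℕ) : ℝ) ≤
          (C.card : ℝ) := by
        push_cast
        linarith
      exact_mod_cast this) hM
  have himg : ∀ S : Finset (Fin W.card),
      (univ.filter fun v => ι v ∈ S.image ι) = S := by
    intro S
    ext v
    simp
  have hE : ((range J).biUnion fun j => A.chainEdges (ι ∘ f j) t) =
      ((range J).biUnion fun j => A.chainEdges (f j) t).image (Finset.image ι) := by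
    rw [Finset.biUnion_image]
    exact Finset.biUnion_congr rfl fun j _ => A.chainEdges_comp ι (f j) t
  have hsub : ∀ j < J, A.chainVerts (ι ∘ f j) t ⊆ (univ.map (x j)).map ι := by
    intro j hj
    rw [chainVerts_comp, Finset.map_eq_image ι]
    exact Finset.image_subset_image (hf j hj).2
  refine ⟨fun j => ι ∘ f j, fun S => ψ (univ.filter fun v => ι v ∈ S), ?_, ?_, ?_, ?_⟩
  · intro j hj
    refine ⟨fun a ha b hb hab => (hf j hj).1 ha hb (ι.injective hab), (hsub j hj).trans ?_⟩
    exact (Finset.map_subset_map.mpr (Finset.subset_univ _)).trans hι.le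
  · intro i hi j hj hij
    refine Disjoint.mono (hsub i hi) (hsub j hj) ?_
    exact (Finset.disjoint_map ι).mpr (hdisj i (by omega) j (by omega) hij)
  · rw [hE]
    intro S hS S' hS' h
    obtain ⟨Y, hY, rfl⟩ := Finset.mem_image.mp (Finset.mem_coe.mp hS)
    obtain ⟨Y', hY', rfl⟩ := Finset.mem_image.mp (Finset.mem_coe.mp hS')
    simp only [himg] at h
    rw [hψ (Finset.mem_coe.mpr hY) (Finset.mem_coe.mpr hY') h]
  · rw [hE]
    intro S hS
    obtain ⟨Y, hY, rfl⟩ := Finset.mem_image.mp hS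
    simp only [himg]
    refine ⟨(hψH Y hY).1, ?_⟩
    have := (Finset.mem_filter.mp (hψH Y hY).2).2
    rwa [Finset.map_eq_image] at this

end Link

/-! ### Listing the pieces together with their colours -/

namespace Link

open Finset

variable {k ℓ m : ℕ} {V : Type} [DecidableEq V]

theorem disjoint_chainEdges (A : Link k ℓ m) (hk : 0 < k) {f g : ℕ → V} {t u : ℕ}
    (hf : Set.InjOn f (Set.Iio ((m - ℓ) * t + ℓ)))
    (hfg : Disjoint (A.chainVerts f t) (A.chainVerts g u)) :
    Disjoint (A.chainEdges f t) (A.chainEdges g u) := by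
  rw [Finset.disjoint_left]
  intro e he he'
  obtain ⟨v, hv⟩ : e.Nonempty :=
    Finset.card_pos.mp (by rw [A.card_of_mem_chainEdges hf he]; exact hk)
  exact Finset.disjoint_left.mp hfg (A.subset_chainVerts he hv) (A.subset_chainVerts he' hv)

set_option maxHeartbeats 1000000 in
open Classical in
/-- Completing a colour-absorbing chain, a rainbow family of long chains and a rainbow family of
copies of `A` to a transversal Hamilton cycle. -/
theorem exists_transversal_of_blocks [Fintype V] (A : Link k ℓ m) (hlm : ℓ < m) (hk : 0 < k)
    {M T c y J P Λ l t₀ t₁ : ℕ} (hcard : Fintype.card V = (m - ℓ) * T)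
    (hT : 2 * m ≤ (m - ℓ) * T) (hM : T * A.newEdges.card = M) (hM0 : 0 < M)
    (H : Fin M → UniformHypergraph k V) {f₀ : ℕ → V} (ht₀ : 1 ≤ t₀)
    (hf₀ : Set.InjOn f₀ (Set.Iio ((m - ℓ) * t₀ + ℓ))) {f : ℕ → ℕ → V} (ht₁ : 1 ≤ t₁)
    {S R V' : Finset V} (hf : ∀ j < J, Set.InjOn (f j) (Set.Iio ((m - ℓ) * t₁ + ℓ)) ∧
      A.chainVerts (f j) t₁ ⊆ V')
    (hfdisj : ∀ i < J, ∀ j < J, i ≠ j → Disjoint (A.chainVerts (f i) t₁) (A.chainVerts (f j) t₁))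
    {g : ℕ → ℕ → V} (hg : ∀ p < P, Set.InjOn (g p) (Set.Iio ((m - ℓ) * 1 + ℓ)) ∧
      A.chainVerts (g p) 1 ⊆ R)
    (hgdisj : ∀ p < P, ∀ q < P, p ≠ q → Disjoint (A.chainVerts (g p) 1) (A.chainVerts (g q) 1))
    (hXS : Disjoint (A.chainVerts f₀ t₀) S) (hXR : Disjoint (A.chainVerts f₀ t₀) R)
    (hXV : Disjoint (A.chainVerts f₀ t₀) V') (hSR : Disjoint S R) (hSV : Disjoint S V')
    (hRV : Disjoint R V') {H' : UniformHypergraph k V}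
    (hcon : A.Connects H' (R \ (range P).biUnion fun p => A.chainVerts (g p) 1) c y)
    (hy : (J + P + 2) * ((m - ℓ) * c) ≤ y) {a b : ℕ → V}
    (hab : ∀ L, Disjoint L S → Disjoint L (A.chainVerts f₀ t₀) → L.card ≤ Λ →
      (m - ℓ) ∣ L.card → ∃ (u : ℕ) (q : ℕ → V), 1 ≤ u ∧
        Set.InjOn q (Set.Iio ((m - ℓ) * u + ℓ)) ∧ A.chainVerts q u = S ∪ L ∧
        A.chainEdges q u ⊆ H'.edges ∧ (∀ i < ℓ, q i = a i) ∧
        ∀ i < ℓ, q ((m - ℓ) * u + i) = b i)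
    (hΛ : Fintype.card V ≤ (m - ℓ) * t₀ + J * ((m - ℓ) * t₁) + S.card + Λ)
    {B₀ B C C₄ : Finset (Fin M)} (hB : Disjoint B₀ B) (hC₀ : Disjoint C B₀) (hCB : Disjoint C B)
    (hcover : ∀ i, i ∈ B₀ ∨ i ∈ B ∨ i ∈ C)
    {ψ₁ ψ₂ : Finset V → Fin M}
    (hψ₁ : Set.InjOn ψ₁ ((range J).biUnion fun j => A.chainEdges (f j) t₁))
    (hψ₁H : ∀ e ∈ (range J).biUnion fun j => A.chainEdges (f j) t₁, ψ₁ e ∈ C ∧ e ∈ (H (ψ₁ e)).edges)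
    (hψ₂ : Set.InjOn ψ₂ ((range P).biUnion fun p => A.chainEdges (g p) 1))
    (hψ₂C : ((range P).biUnion fun p => A.chainEdges (g p) 1).image ψ₂ = C₄)
    (hψ₂H : ∀ e ∈ (range P).biUnion fun p => A.chainEdges (g p) 1, e ∈ (H (ψ₂ e)).edges)
    (hC₄ : C \ ((range J).biUnion fun j => A.chainEdges (f j) t₁).image ψ₁ ⊆ C₄)
    (hC₄' : C₄ ⊆ (C \ ((range J).biUnion fun j => A.chainEdges (f j) t₁).image ψ₁) ∪ B)
    (hB₀ : B₀.card + l = (A.chainEdges f₀ t₀).card)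
    (habs : ∀ U ⊆ B, U.card = l → ∃ ψ : Finset V → Fin M,
      Set.InjOn ψ (A.chainEdges f₀ t₀) ∧
      ∀ e ∈ A.chainEdges f₀ t₀, ψ e ∈ B₀ ∪ U ∧ e ∈ (H (ψ e)).edges)
    (hrest : ∀ e ∈ H'.edges, B.card ≤ (B.filter fun i => e ∈ (H i).edges).card + l) :
    ∃ F : UniformHypergraph k V, A.IsCycle F ∧ F.IsTransversal H := by
  -- All pieces in one list: the colour absorber at index `0`, the long chains at `1, …, J`, then
  -- the copies of `A` as chains of length `1`.
  let F : ℕ → ℕ → V := fun j => if j = 0 then f₀ else if j ≤ J then f (j - 1) else g (j - J - 1)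
  let t : ℕ → ℕ := fun j => if j = 0 then t₀ else if j ≤ J then t₁ else 1
  have hF0 : F 0 = f₀ := if_pos rfl
  have ht0 : t 0 = t₀ := if_pos rfl
  have hF1 : ∀ j, 1 ≤ j → j ≤ J → F j = f (j - 1) ∧ t j = t₁ := fun j h1 h2 => by
    simp only [F, t, if_neg (show j ≠ 0 by omega), if_pos h2, and_self]
  have hF2 : ∀ j, J < j → F j = g (j - J - 1) ∧ t j = 1 := fun j h1 => by
    simp only [F, t, if_neg (show j ≠ 0 by omega), if_neg (show ¬ j ≤ J by omega), and_self]
  set Eb := (range J).biUnion fun j => A.chainEdges (f j) t₁ with hEb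
  set Eg := (range P).biUnion fun p => A.chainEdges (g p) 1 with hEg
  set G := (range P).biUnion fun p => A.chainVerts (g p) 1 with hG
  have hcases : ∀ j ≤ J + P, j = 0 ∨ (1 ≤ j ∧ j ≤ J ∧ j - 1 < J) ∨ (J < j ∧ j - J - 1 < P) := by
    intro j hj
    omega
  have hgG : ∀ p < P, A.chainVerts (g p) 1 ⊆ G := fun p hp v hv =>
    Finset.mem_biUnion.mpr ⟨p, Finset.mem_range.mpr hp, hv⟩
  have ht : ∀ j ≤ J + P, 1 ≤ t j := by
    intro j hj
    rcases hcases j hj with rfl | ⟨h1, h2, _⟩ | ⟨h1, _⟩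
    · rw [ht0]; exact ht₀
    · rw [(hF1 j h1 h2).2]; exact ht₁
    · rw [(hF2 j h1).2]
  have hFinj : ∀ j ≤ J + P, Set.InjOn (F j) (Set.Iio ((m - ℓ) * t j + ℓ)) := by
    intro j hj
    rcases hcases j hj with rfl | ⟨h1, h2, h3⟩ | ⟨h1, h2⟩
    · rw [ht0, hF0]; exact hf₀
    · rw [(hF1 j h1 h2).1, (hF1 j h1 h2).2]; exact (hf _ h3).1
    · rw [(hF2 j h1).1, (hF2 j h1).2]; exact (hg _ h2).1
  have hFdisj : ∀ i ≤ J + P, ∀ j ≤ J + P, i < j →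
      Disjoint (A.chainVerts (F i) (t i)) (A.chainVerts (F j) (t j)) := by
    intro i hi j hj hij
    rcases hcases i hi with rfl | ⟨h1, h2, h3⟩ | ⟨h1, h2⟩ <;>
      rcases hcases j hj with rfl | ⟨h1', h2', h3'⟩ | ⟨h1', h2'⟩
    · omega
    · rw [hF0, ht0, (hF1 j h1' h2').1, (hF1 j h1' h2').2]
      exact hXV.mono_right (hf _ h3').2
    · rw [hF0, ht0, (hF2 j h1').1, (hF2 j h1').2]
      exact hXR.mono_right (hg _ h2').2
    · omega
    · rw [(hF1 i h1 h2).1, (hF1 i h1 h2).2, (hF1 j h1' h2').1, (hF1 j h1' h2').2]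
      exact hfdisj _ h3 _ h3' (by omega)
    · rw [(hF1 i h1 h2).1, (hF1 i h1 h2).2, (hF2 j h1').1, (hF2 j h1').2]
      exact (hRV.mono (hg _ h2').2 (hf _ h3).2).symm
    · omega
    · omega
    · rw [(hF2 i h1).1, (hF2 i h1).2, (hF2 j h1').1, (hF2 j h1').2]
      exact hgdisj _ h2 _ h2' (by omega)
  have hFS : ∀ j ≤ J + P, Disjoint (A.chainVerts (F j) (t j)) S := by
    intro j hj
    rcases hcases j hj with rfl | ⟨h1, h2, h3⟩ | ⟨h1, h2⟩
    · rw [ht0, hF0]; exact hXS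
    · rw [(hF1 j h1 h2).1, (hF1 j h1 h2).2]; exact (hSV.mono_right (hf _ h3).2).symm
    · rw [(hF2 j h1).1, (hF2 j h1).2]; exact (hSR.mono_right (hg _ h2).2).symm
  have hFR : ∀ j ≤ J + P, Disjoint (A.chainVerts (F j) (t j)) (R \ G) := by
    intro j hj
    rcases hcases j hj with rfl | ⟨h1, h2, h3⟩ | ⟨h1, h2⟩
    · rw [ht0, hF0]; exact hXR.mono_right Finset.sdiff_subset
    · rw [(hF1 j h1 h2).1, (hF1 j h1 h2).2]
      exact (hRV.mono Finset.sdiff_subset (hf _ h3).2).symm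
    · rw [(hF2 j h1).1, (hF2 j h1).2]; exact Finset.disjoint_sdiff.mono_left (hgG _ h2)
  have hE₁ : ((Finset.Icc 1 (J + P)).biUnion fun j => A.chainEdges (F j) (t j)) = Eb ∪ Eg := by
    ext e
    simp only [hEb, hEg, Finset.mem_union, Finset.mem_biUnion, Finset.mem_Icc, Finset.mem_range]
    constructor
    · rintro ⟨j, ⟨hj1, hj2⟩, he⟩
      rcases hcases j hj2 with rfl | ⟨h1, h2, h3⟩ | ⟨h1, h2⟩
      · omega
      · rw [(hF1 j h1 h2).1, (hF1 j h1 h2).2] at he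
        exact Or.inl ⟨_, h3, he⟩
      · rw [(hF2 j h1).1, (hF2 j h1).2] at he
        exact Or.inr ⟨_, h2, he⟩
    · rintro (⟨j, hj, he⟩ | ⟨p, hp, he⟩)
      · refine ⟨j + 1, ⟨by omega, by omega⟩, ?_⟩
        rw [(hF1 (j + 1) (by omega) (by omega)).1, (hF1 (j + 1) (by omega) (by omega)).2]
        exact he
      · refine ⟨J + p + 1, ⟨by omega, by omega⟩, ?_⟩
        rw [(hF2 (J + p + 1) (by omega)).1, (hF2 (J + p + 1) (by omega)).2]
        rwa [show J + p + 1 - J - 1 = p by omega]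
  have hEdisj : Disjoint Eb Eg := by
    rw [hEb, hEg, Finset.disjoint_biUnion_left]
    intro j hj
    rw [Finset.disjoint_biUnion_right]
    intro p hp
    have hj := Finset.mem_range.mp hj
    have hp := Finset.mem_range.mp hp
    exact A.disjoint_chainEdges hk (hf j hj).1 (hRV.mono (hg p hp).2 (hf j hj).2).symm
  let ψ : Finset V → Fin M := fun e => if e ∈ Eb then ψ₁ e else ψ₂ e
  have hψb : ∀ e ∈ Eb, ψ e = ψ₁ e := fun e he => if_pos he
  have hψg : ∀ e ∈ Eg, ψ e = ψ₂ e := fun e he => if_neg (Finset.disjoint_right.mp hEdisj he)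
  -- The copies use leftover colours of `C` or padding from `B`, never a colour of a long chain.
  have hne : ∀ e ∈ Eb, ∀ e' ∈ Eg, ψ₁ e ≠ ψ₂ e' := by
    intro e he e' he' h
    have h1 : ψ₂ e' ∈ C₄ := hψ₂C ▸ Finset.mem_image_of_mem _ he'
    rw [← h] at h1
    rcases Finset.mem_union.mp (hC₄' h1) with h2 | h2
    · exact (Finset.mem_sdiff.mp h2).2 (Finset.mem_image_of_mem _ he)
    · exact Finset.disjoint_left.mp hCB (hψ₁H e he).1 h2
  have himg : (Eb ∪ Eg).image ψ = Eb.image ψ₁ ∪ C₄ := by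
    rw [Finset.image_union, ← hψ₂C]
    congr 1
    · exact Finset.image_congr fun e he => hψb e he
    · exact Finset.image_congr fun e he => hψg e he
  refine A.exists_transversal_of_pieces hlm hk hcard hT hM hM0 H (f := F) (t := t) (J := J + P)
    (S := S) (H' := H') (a := a) (b := b) (Λ := Λ) (l := l) (B₀ := B₀) (B := B)
    ht hFinj ?_ hFS hFR (hSR.mono_right Finset.sdiff_subset) hcon hy ?_ ?_ ψ ?_ ?_ hB ?_ ?_ ?_ ?_
    hrest
  · intro i hi j hj hij
    rcases Nat.lt_or_gt_of_ne hij with h | h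
    · exact hFdisj i hi j hj h
    · exact (hFdisj j hj i hi h).symm
  · rw [hF0, ht0]
    exact hab
  · refine hΛ.trans (Nat.add_le_add_right (Nat.add_le_add_right ?_ _) _)
    calc (m - ℓ) * t₀ + J * ((m - ℓ) * t₁)
        ≤ (A.chainVerts (F 0) (t 0)).card +
          ∑ j ∈ Finset.Icc 1 J, (A.chainVerts (F j) (t j)).card := by
          refine Nat.add_le_add ?_ ?_
          · rw [hF0, ht0, A.card_chainVerts hf₀]; omega
          · calc J * ((m - ℓ) * t₁) = ∑ j ∈ Finset.Icc 1 J, (m - ℓ) * t₁ := by simp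
              _ ≤ _ := Finset.sum_le_sum fun j hj => by
                obtain ⟨h1, h2⟩ := Finset.mem_Icc.mp hj
                rw [(hF1 j h1 h2).1, (hF1 j h1 h2).2, A.card_chainVerts (hf _ (by omega)).1]
                omega
      _ = ∑ j ∈ insert 0 (Finset.Icc 1 J), (A.chainVerts (F j) (t j)).card := by
          rw [Finset.sum_insert (by simp)]
      _ = ((insert 0 (Finset.Icc 1 J)).biUnion fun j => A.chainVerts (F j) (t j)).card := by
          refine (Finset.card_biUnion fun i hi j hj hij => ?_).symm
          have hi' : i ≤ J := by
            rcases Finset.mem_insert.mp hi with h | h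
            · omega
            · exact (Finset.mem_Icc.mp h).2
          have hj' : j ≤ J := by
            rcases Finset.mem_insert.mp hj with h | h
            · omega
            · exact (Finset.mem_Icc.mp h).2
          rcases Nat.lt_or_gt_of_ne hij with h | h
          · exact hFdisj i (by omega) j (by omega) h
          · exact (hFdisj j (by omega) i (by omega) h).symm
      _ ≤ _ := by
          refine Finset.card_le_card (Finset.biUnion_subset_biUnion_of_subset_left _ ?_)
          intro j hj
          rw [Finset.mem_range]
          rcases Finset.mem_insert.mp hj with h | h
          · omega
          · have := (Finset.mem_Icc.mp h).2
            omega
  · rw [hE₁]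
    intro e he e' he' h
    rw [Finset.mem_coe, Finset.mem_union] at he he'
    rcases he with he | he <;> rcases he' with he' | he'
    · rw [hψb e he, hψb e' he'] at h; exact hψ₁ he he' h
    · rw [hψb e he, hψg e' he'] at h; exact absurd h (hne e he e' he')
    · rw [hψg e he, hψb e' he'] at h; exact absurd h.symm (hne e' he' e he)
    · rw [hψg e he, hψg e' he'] at h; exact hψ₂ he he' h
  · rw [hE₁]
    intro e he
    rcases Finset.mem_union.mp he with he | he
    · rw [hψb e he]; exact (hψ₁H e he).2
    · rw [hψg e he]; exact hψ₂H e he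
  · rw [hE₁, himg, Finset.disjoint_union_left]
    constructor
    · refine hC₀.mono_left fun i hi => ?_
      obtain ⟨e, he, rfl⟩ := Finset.mem_image.mp hi
      exact (hψ₁H e he).1
    · refine Finset.disjoint_left.mpr fun i hi hi0 => ?_
      rcases Finset.mem_union.mp (hC₄' hi) with h | h
      · exact Finset.disjoint_left.mp hC₀ (Finset.mem_sdiff.mp h).1 hi0
      · exact Finset.disjoint_left.mp hB hi0 h
  · rw [hE₁, himg]
    intro i
    rcases hcover i with h | h | h
    · exact Or.inr (Or.inl h)
    · exact Or.inr (Or.inr h)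
    · refine Or.inl (Finset.mem_union.mpr ?_)
      by_cases hi : i ∈ Eb.image ψ₁
      · exact Or.inl hi
      · exact Or.inr (hC₄ (Finset.mem_sdiff.mpr ⟨h, hi⟩))
  · rw [hF0, ht0]; exact hB₀
  · rw [hF0, ht0]; exact habs

end Link

/-! ### Bookkeeping of sizes -/

/-- `Fac` accepts only multiples of `e(A)` colours, so the leftover colours are filled up from the
flexible ones. Between `1` and `e` elements are added, with `e` in the divisible case. -/
theorem exists_padding {α : Type} [DecidableEq α] {s t : Finset α} {e : ℕ} (he : 0 < e)
    (ht : e ≤ t.card) (hst : Disjoint s t) :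
    ∃ u, s ⊆ u ∧ u ⊆ s ∪ t ∧ e ∣ u.card ∧ u.card ≤ s.card + e := by
  have hmod := Nat.mod_lt s.card he
  obtain ⟨v, hvt, hv⟩ := Finset.exists_subset_card_eq (s := t) (n := e - s.card % e) (by omega)
  refine ⟨s ∪ v, Finset.subset_union_left, Finset.union_subset_union_right hvt, ?_, ?_⟩
  · rw [Finset.card_union_of_disjoint (hst.mono_right hvt), hv]
    have h1 := Nat.div_add_mod s.card e
    refine ⟨s.card / e + 1, ?_⟩
    rw [Nat.mul_add]
    omega
  · have := Finset.card_union_le s v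
    omega

/-- In normalised form: deleting at most a `z`-fraction of the vertices costs at most `z` in the
degree density. -/
theorem UniformHypergraph.RichOn.sdiff_of_le {k d : ℕ} {V : Type} [DecidableEq V] [Fintype V]
    {H : UniformHypergraph k V} {W : Finset V} {x : ℝ} (hdk : d < k)
    (h : H.RichOn d W (x * (Fintype.card V : ℝ) ^ (k - d))) {Y : Finset V} {z : ℝ}
    (hY : (Y.card : ℝ) ≤ z * Fintype.card V) :
    H.RichOn d (W \ Y) ((x - z) * (Fintype.card V : ℝ) ^ (k - d)) := by
  refine (h.sdiff Y).mono (Finset.Subset.refl _) ?_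
  have h1 : (Fintype.card V : ℝ) ^ (k - d) =
      Fintype.card V * (Fintype.card V : ℝ) ^ (k - d - 1) := by
    rw [← pow_succ']; congr 1; omega
  have h2 := mul_le_mul_of_nonneg_right hY
    (show 0 ≤ (Fintype.card V : ℝ) ^ (k - d - 1) by positivity)
  rw [h1]
  linarith

/-- The number of chains that use up almost all colours. -/
theorem exists_chain_number {κ c e C₀ : ℝ} (hκ : 0 < κ) (h : C₀ * κ ≤ (1 - e) * c) :
    ∃ J : ℕ, ((J : ℝ) + C₀) * κ + e * c ≤ c ∧ c ≤ J * κ + e * c + (C₀ + 1) * κ := by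
  have h0 : 0 ≤ (1 - e) * c / κ - C₀ := by
    rw [sub_nonneg, le_div_iff₀ hκ]; exact h
  have h1 := Nat.floor_le h0
  have h2 := Nat.lt_floor_add_one ((1 - e) * c / κ - C₀)
  refine ⟨⌊(1 - e) * c / κ - C₀⌋₊, ?_, ?_⟩
  · have h3 : (⌊(1 - e) * c / κ - C₀⌋₊ : ℝ) + C₀ ≤ (1 - e) * c / κ := by linarith
    rw [le_div_iff₀ hκ] at h3
    linarith
  · have h3 : (1 - e) * c / κ < (⌊(1 - e) * c / κ - C₀⌋₊ : ℝ) + 1 + C₀ := by linarith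
    rw [div_lt_iff₀ hκ] at h3
    linarith

/-- The chains that use up almost all colours fit into disjoint blocks. -/
theorem chain_number_le {w D es T t₀ t₁ σ θ n y c N r ℓ s J : ℝ} (hw : 1 ≤ w) (hD : 1 ≤ D)
    (hes : 0 ≤ es) (hn : n = w * T) (hc : c + t₀ * D + es + y = T * D) (hn0 : 0 ≤ n)
    (hy : D * (σ + θ * n) ≤ w * y) (hJ : J * (t₁ * D + es) ≤ c) (hJ0 : 0 ≤ J)
    (hN : n - w * t₀ - ℓ - σ - r ≤ N) (hr : r ≤ θ / 8 * n) (hℓn : ℓ ≤ θ / 8 * n) (hℓ : 0 ≤ ℓ)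
    (hs : s = w * (t₁ + ℓ)) (ht₁ : 8 * ℓ ≤ θ * t₁) (ht₁0 : 1 ≤ t₁) (hsn : s ≤ θ / 8 * n)
    (hNn : N ≤ n) (hθ : 0 ≤ θ) (hθ1 : θ ≤ 1) (hNk : N < s * (K + 1)) :
    J ≤ (1 - θ / 8) * K := by
  have hs0 : 0 < s := by rw [hs]; positivity
  -- The colour balance is converted at the rate of `D` colours per `w` vertices. As `y` sets aside
  -- the colours of `σ + θn` vertices, the chains need at least `θn/2` fewer vertices than are
  -- available.
  have h1 : J * t₁ * w ≤ N - θ / 2 * n := by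
    have h2 : D * (J * t₁ * w) ≤ D * (n - w * t₀ - σ - θ * n) := by
      have h3 : J * (t₁ * D) ≤ c := by nlinarith
      have h4 := mul_le_mul_of_nonneg_left h3 (show 0 ≤ w by linarith)
      have h5 : w * c = D * n - D * (w * t₀) - w * es - w * y := by
        rw [hn]; linear_combination w * hc
      have h6 : 0 ≤ w * es := mul_nonneg (by linarith) hes
      nlinarith
    have h7 := le_of_mul_le_mul_left h2 (by linarith)
    linarith
  -- Blocks exceed chains by a factor `1 + ℓ/t₁ ≤ 1 + θ/8`, which the slack absorbs.
  have h2 : J * s ≤ (1 - θ / 8) * (N - s) := by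
    have h3 : J * s * 8 ≤ J * t₁ * w * (8 + θ) := by
      have h4 : J * w * (8 * ℓ) ≤ J * w * (θ * t₁) :=
        mul_le_mul_of_nonneg_left ht₁ (by positivity)
      rw [hs]; nlinarith
    have h5 : J * t₁ * w * (8 + θ) ≤ (N - θ / 2 * n) * (8 + θ) :=
      mul_le_mul_of_nonneg_right h1 (by linarith)
    have h6 : θ * N ≤ θ * n := mul_le_mul_of_nonneg_left hNn hθ
    have h7 : 0 ≤ θ * s := by positivity
    have h8 : 0 ≤ θ * (θ * n) := by positivity
    nlinarith
  have h3 : J * s ≤ (1 - θ / 8) * (s * K) := by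
    refine h2.trans (mul_le_mul_of_nonneg_left (by linarith) (by linarith))
  have h4 : s * J ≤ s * ((1 - θ / 8) * K) := by linarith
  exact le_of_mul_le_mul_left h4 hs0

/-- The chains that use up almost all colours cover almost all vertices. -/
theorem uncovered_le {w D es T t₀ t₁ σ θ n y c e J : ℝ} (hw : 1 ≤ w) (hD : 1 ≤ D)
    (hn : n = w * T) (hc : c + t₀ * D + es + y = T * D) (hn0 : 0 ≤ n)
    (hy : w * y ≤ D * (σ + θ * n) + w) (hJ : c ≤ J * (t₁ * D + es) + 2 * e * D * n)
    (hJn : J * t₁ * w ≤ n) (hJ0 : 0 ≤ J) (ht₁ : 2 * es ≤ θ * t₁) (he : 8 * w * e ≤ θ)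
    (hbig : w * (1 + es) ≤ θ / 4 * n) (hθ : 0 ≤ θ) :
    n ≤ w * t₀ + J * (w * t₁) + σ + 2 * θ * n := by
  -- The same balance read backwards: all but `2eDn` colours of `C` lie on chains, and the `es`
  -- start edges per chain are negligible since `t₁` is large.
  have h1 : D * (n - w * t₀ - σ - J * (w * t₁)) ≤ D * (2 * θ * n) := by
    have h2 := mul_le_mul_of_nonneg_left hJ (show 0 ≤ w by linarith)
    have h3 : w * c = D * n - D * (w * t₀) - w * es - w * y := by
      rw [hn]; linear_combination w * hc
    have h4 : J * w * (2 * es) ≤ J * w * (θ * t₁) :=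
      mul_le_mul_of_nonneg_left ht₁ (by positivity)
    have h5 : θ * (J * t₁ * w) ≤ θ * n := mul_le_mul_of_nonneg_left hJn hθ
    have h6 : D * n * (8 * w * e) ≤ D * n * θ := mul_le_mul_of_nonneg_left he (by positivity)
    have h7 : θ * n ≤ D * (θ * n) := le_mul_of_one_le_left (by positivity) hD
    nlinarith
  have h2 := le_of_mul_le_mul_left h1 (by linarith)
  linarith

open Filter in
theorem eventually_le_mul_natCast {c : ℝ} (hc : 0 < c) (a : ℝ) :
    ∀ᶠ n : ℕ in atTop, a ≤ c * (n : ℝ) :=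
  (tendsto_natCast_atTop_atTop.const_mul_atTop hc).eventually_ge_atTop a

/-! ### Choice of constants and the main argument -/

namespace Link

open Finset

variable {k ℓ m : ℕ}

/-- For a link without edges every real number would be an admissible density, and a set unbounded
below has no least element. -/
theorem nonempty_of_isHamiltonThreshold (A : Link k ℓ m) (hlm : ℓ < m) (hk : 0 < k) {d : ℕ}
    {δ : ℝ} (hδ : A.IsHamiltonThreshold d δ) : A.graph.edges.Nonempty := by
  by_contra hne
  rw [Finset.not_nonempty_iff_eq_empty] at hne
  have hF : A.ForcesHamiltonCycle d (δ - 1) := by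
    intro α _
    refine ⟨2 * m, fun n hn hdvd H _ => ?_⟩
    obtain ⟨T, rfl⟩ := hdvd
    have hpos : 0 < (m - ℓ) * T := by omega
    have hinj : Set.InjOn (fun i : ℕ => (⟨i % ((m - ℓ) * T), Nat.mod_lt _ hpos⟩ :
        Fin ((m - ℓ) * T))) (Set.Iio ((m - ℓ) * T)) := by
      intro i hi j hj hij
      have := congrArg Fin.val hij
      simpa only [Nat.mod_eq_of_lt (Set.mem_Iio.mp hi), Nat.mod_eq_of_lt (Set.mem_Iio.mp hj)]
        using this
    obtain ⟨F, hF, hFE, -⟩ := A.exists_isCycle (T := T) hlm hk hn (by simp) hinj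
      (fun i _ => Fin.ext (by simp))
    refine ⟨F, hF, ?_⟩
    rw [hFE]
    intro e he
    obtain ⟨q, _, e', he', _⟩ := A.mem_chainEdges.mp he
    rw [hne] at he'
    exact absurd he' (Finset.notMem_empty _)
  have := hδ.2 hF
  linarith

/-- With `α = -δ` the degree condition is void, and the empty hypergraph would have to contain a
cycle that has edges. -/
theorem ForcesHamiltonCycle.nonneg {A : Link k ℓ m} (hlm : ℓ < m)
    (hE : A.graph.edges.Nonempty) {d : ℕ} {δ : ℝ} (hF : A.ForcesHamiltonCycle d δ) : 0 ≤ δ := by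
  by_contra hneg
  push Not at hneg
  obtain ⟨n₀, hn₀⟩ := hF (-δ) (by linarith)
  have hle : n₀ ≤ (m - ℓ) * n₀ := Nat.le_mul_of_pos_left _ (by omega)
  obtain ⟨F, hFc, hFE⟩ := hn₀ ((m - ℓ) * n₀) hle (Nat.dvd_mul_right _ _)
    ⟨∅, fun e he => absurd he (Finset.notMem_empty _)⟩ (by
      rw [add_neg_cancel, zero_mul]; positivity)
  obtain ⟨f, T, hT, -, -, hfE⟩ := A.exists_of_isCycle hlm hFc
  obtain ⟨e, he⟩ := hE
  have := hFE (hfE (A.mem_chainEdges.mpr ⟨0, hT, e, he, rfl⟩))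
  exact absurd this (Finset.notMem_empty _)

/-- Inside a rich reservoir one finds disjoint copies of `A` using up a small set of colours, and
the rest of the reservoir still connects chains. -/
theorem exists_copies_and_connector {V : Type} [Fintype V] [DecidableEq V] (A : Link k ℓ m)
    (hlm : ℓ < m) {d c n₁ n₂ M J y : ℕ} {β β₀ a : ℝ}
    (hcon : ∀ n : ℕ, n₁ ≤ n → ∀ H : UniformHypergraph k (Fin n),
      β * (n : ℝ) ^ (k - d) ≤ (H.minDegree d : ℝ) →
      ∀ a b : Fin ℓ ↪ Fin n, A.start.IsEmbedding a H → A.start.IsEmbedding b H →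
        (∀ i j, a i ≠ b j) →
        ∃ (t : ℕ) (f : Fin ((m - ℓ) * t + ℓ) ↪ Fin n), t ≤ c ∧ A.IsChainEmbedding H t f a b)
    (hfac : ∀ (n : ℕ) (β' : ℝ), n₂ ≤ n → β' ≤ β₀ →
      ∀ (M : ℕ) (H : Fin M → UniformHypergraph k (Fin n)), (M : ℝ) ≤ β' * n →
        (∀ i, β * (n : ℝ) ^ (k - d) ≤ ((H i).minDegree d : ℝ)) →
        A.graph.edges.card ∣ M →
        ∃ (g : Fin (M / A.graph.edges.card) → (Fin m ↪ Fin n)) (F : UniformHypergraph k (Fin n)),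
          (∀ p q, p ≠ q → ∀ x y, g p x ≠ g q y) ∧
          (F.edges = Finset.univ.biUnion fun p => A.graph.edges.image (Finset.map (g p))) ∧
          F.IsTransversal H)
    (hβ : 0 ≤ β) (ha : 0 ≤ a) (H : Fin M → UniformHypergraph k V) {H' : UniformHypergraph k V}
    {R : Finset V} (C : Finset (Fin M))
    (hrich : ∀ i, (H i).RichOn d R ((β + a) * (R.card : ℝ) ^ (k - d)))
    (hrich' : H'.RichOn d R ((β + a) * (R.card : ℝ) ^ (k - d)))
    (hC : (C.card : ℝ) ≤ β₀ * R.card) (hdvd : A.graph.edges.card ∣ C.card) (hM : 0 < M)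
    (hR₂ : n₂ + d + 1 ≤ R.card) (hR₁ : n₁ + d + y + 2 * ℓ + C.card * m ≤ R.card)
    (hy : (J + C.card + 2) * ((m - ℓ) * c) ≤ y)
    (hnum : ((C.card : ℝ) * m + y + 2 * ℓ) * (Fintype.card V : ℝ) ^ (k - d - 1) ≤
      a * (R.card : ℝ) ^ (k - d)) :
    ∃ (P : ℕ) (g : ℕ → ℕ → V) (ψ : Finset V → Fin M), (J + P + 2) * ((m - ℓ) * c) ≤ y ∧
      (∀ p < P, Set.InjOn (g p) (Set.Iio ((m - ℓ) * 1 + ℓ)) ∧ A.chainVerts (g p) 1 ⊆ R) ∧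
      (∀ p < P, ∀ q < P, p ≠ q → Disjoint (A.chainVerts (g p) 1) (A.chainVerts (g q) 1)) ∧
      Set.InjOn ψ ((range P).biUnion fun p => A.chainEdges (g p) 1) ∧
      (((range P).biUnion fun p => A.chainEdges (g p) 1).image ψ = C) ∧
      (∀ e ∈ (range P).biUnion fun p => A.chainEdges (g p) 1, e ∈ (H (ψ e)).edges) ∧
      A.Connects H' (R \ (range P).biUnion fun p => A.chainVerts (g p) 1) c y := by
  obtain ⟨P, g, ψ, hP, hg, hgdisj, hψ, hψC, hψH⟩ := A.exists_transversal_copies hlm hfac H C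
    (fun i => (hrich i).mono (Finset.Subset.refl _)
      (mul_le_mul_of_nonneg_right (by linarith) (by positivity))) hR₂ hC hdvd hM
  set G := (range P).biUnion fun p => A.chainVerts (g p) 1 with hG
  have hGcard : G.card ≤ C.card * m := by
    refine (Finset.card_biUnion_le_card_mul _ _ m fun p hp => ?_).trans ?_
    · rw [A.card_chainVerts (hg p (Finset.mem_range.mp hp)).1]; omega
    · rw [Finset.card_range]; exact Nat.mul_le_mul_right _ hP
  have hGR : (G.card : ℝ) ≤ C.card * m := by exact_mod_cast hGcard
  have hRG : (R \ G).card ≤ R.card := Finset.card_le_card Finset.sdiff_subset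
  have hRG' := Finset.le_card_sdiff G R
  refine ⟨P, g, ψ, le_trans (Nat.mul_le_mul_right _ (by omega)) hy, hg, hgdisj, hψ, hψC, hψH, ?_⟩
  -- The copies occupy at most `|C| * m` vertices of `R`; the surplus `a` in the degree pays for
  -- deleting these as well as for the set to be avoided.
  refine A.connects_of_richOn hlm hcon hβ H' (hrich'.sdiff G) ?_ (by rw [← hG]; omega)
  · have h1 : β * ((R \ G).card : ℝ) ^ (k - d) ≤ β * (R.card : ℝ) ^ (k - d) :=
      mul_le_mul_of_nonneg_left (pow_le_pow_left₀ (by positivity) (by exact_mod_cast hRG) _) hβ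
    have h2 : (G.card : ℝ) * (Fintype.card V : ℝ) ^ (k - d - 1) ≤
        (C.card : ℝ) * m * (Fintype.card V : ℝ) ^ (k - d - 1) :=
      mul_le_mul_of_nonneg_right hGR (by positivity)
    linarith

end Link

namespace Link

open Finset

variable {k ℓ m : ℕ}

set_option maxHeartbeats 4000000 in
open Filter in
-- The colours are split into `B₀`, fixed for the absorbing chain, flexible ones `B`, and the rest
-- `C`. Long chains and copies of `A` exhaust `C` together with a little padding from `B`;
-- connections, vertex absorber and absorbing chain take the remainder. The constants are chosen in
-- the order `γ`, `ν`, `ε`, `α'`, `θ`, `ρ`, `ξ`, `e`, `t₁`, each small (or, for `t₁`, large) in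
-- terms of what it must be compared with, and `T` is large last.
theorem eventually_exists_transversal_cycle {d : ℕ} (A : Link k ℓ m) (hlm : ℓ < m) (hd : 1 ≤ d)
    (hdk : d < k) {δ δ₀ α : ℝ} (hF : A.ForcesHamiltonCycle d δ) (hE : A.graph.edges.Nonempty)
    (hδ₀ : δ ≤ δ₀) (hgood : A.IsGood δ₀ d) (hα : 0 < α) :
    ∀ᶠ T : ℕ in atTop, ∀ n M : ℕ, n = (m - ℓ) * T → M = T * A.newEdges.card →
      ∀ H : Fin M → UniformHypergraph k (Fin n),
        (∀ i, (δ₀ + α) * (n : ℝ) ^ (k - d) ≤ ((H i).minDegree d : ℝ)) →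
        ∃ F : UniformHypergraph k (Fin n), A.IsCycle F ∧ F.IsTransversal H := by
  classical
  have hδ0 : 0 ≤ δ₀ := (hF.nonneg hlm hE).trans hδ₀
  have hw0 : 0 < m - ℓ := by omega
  have hD0 : 0 < A.newEdges.card :=
    Finset.card_pos.mpr (A.newEdges_nonempty hlm (by omega) hE)
  obtain ⟨D, hDdef⟩ : ∃ D, D = A.newEdges.card := ⟨_, rfl⟩
  obtain ⟨es, hesdef⟩ : ∃ es, es = A.start.edges.card := ⟨_, rfl⟩
  obtain ⟨eA, heAdef⟩ : ∃ eA, eA = A.graph.edges.card := ⟨_, rfl⟩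
  have heA0 : 0 < eA := heAdef ▸ Finset.card_pos.mpr hE
  rw [← hDdef] at hD0 ⊢
  obtain ⟨w, hw⟩ : ∃ w : ℝ, w = ((m - ℓ : ℕ) : ℝ) := ⟨_, rfl⟩
  have hw1 : 1 ≤ w := by rw [hw]; exact_mod_cast hw0
  have hD1 : (1 : ℝ) ≤ D := by exact_mod_cast hD0
  obtain ⟨hab, hcon, hfac⟩ := hgood
  obtain ⟨γ, hγ0, hγα, hγ1⟩ : ∃ γ : ℝ, 0 < γ ∧ γ ≤ α / 8 ∧ γ ≤ 1 :=
    ⟨min (α / 8) 1, by positivity, min_le_left _ _, min_le_right _ _⟩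
  obtain ⟨ν, hν0, hνα, hν1⟩ : ∃ ν : ℝ, 0 < ν ∧ ν ≤ α / 32 ∧ ν ≤ 1 / 16 :=
    ⟨min (α / 32) (1 / 16), by positivity, min_le_left _ _, min_le_right _ _⟩
  obtain ⟨ε, hε0, evS⟩ := A.exists_colour_absorber hlm hd hdk hF hE hγ0 hγ1
    (x := δ₀ + α / 2) (by linarith) hν0
  -- `Ab` is applied with a much smaller constant: the colours set aside for `S` and the slack come
  -- from the about `γεn/8` spare flexible ones, so `|S|` and `η` must be small against `γε`.
  obtain ⟨α', hα'0, hα'α, hα'1, hα'γ⟩ : ∃ α' : ℝ, 0 < α' ∧ α' ≤ α / 32 ∧ α' ≤ 1 / 16 ∧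
      α' * (64 * D) ≤ γ * ε := by
    refine ⟨min (α / 32) (min (1 / 16) (γ * ε / (64 * D))), by positivity, min_le_left _ _,
      (min_le_right _ _).trans (min_le_left _ _), ?_⟩
    rw [← le_div_iff₀ (by positivity)]
    exact (min_le_right _ _).trans (min_le_right _ _)
  obtain ⟨τ, η, n₃, hτ0, hτα', hη0, hηα', hab⟩ := hab α' hα'0
  -- The absorber copes with an `8θ`-fraction of the vertices outside the absorbing chain, while
  -- only `2θn` will be left uncovered.
  obtain ⟨θ, hθη⟩ : ∃ θ : ℝ, 8 * θ = η := ⟨η / 8, by ring⟩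
  have hθ0 : 0 < θ := by linarith
  have hθ1 : θ ≤ 1 / 128 := by linarith
  obtain ⟨c, n₁, hc0, hcon⟩ := hcon (α / 8) (by linarith)
  obtain ⟨β₀, n₂, hβ₀, hfac⟩ := hfac (α / 8) (by linarith)
  obtain ⟨ρ₁, hρ₁, hres⟩ := UniformHypergraph.exists_linear_reservoir hdk
    (q := δ₀ + α / 2) (q' := δ₀ + α / 4) (by linarith) (D + 1)
  obtain ⟨ρ, hρ0, hρρ₁, hρθ, hρα⟩ : ∃ ρ : ℝ, 0 < ρ ∧ ρ ≤ ρ₁ ∧ ρ ≤ θ / 8 ∧ ρ ≤ α / 32 :=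
    ⟨min ρ₁ (min (θ / 8) (α / 32)), by positivity, min_le_left _ _,
      (min_le_right _ _).trans (min_le_left _ _), (min_le_right _ _).trans (min_le_right _ _)⟩
  have hres := hres ρ hρ0 hρρ₁
  obtain ⟨ξ, hξ0, hξρ, hξα⟩ : ∃ ξ : ℝ, 0 < ξ ∧ ξ ≤ ρ / 4 ∧ ξ ≤ α / 8 * (ρ / 2) ^ (k - d) :=
    ⟨min (ρ / 4) (α / 8 * (ρ / 2) ^ (k - d)), by positivity, min_le_left _ _, min_le_right _ _⟩
  have hm0 : (0 : ℝ) < m := by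
    have : 0 < m := by omega
    exact_mod_cast this
  -- `e` bounds the proportion of colours of `C` withheld from long chains. The three conditions
  -- keep the resulting uncovered vertices within the slack, let the leftover colours fit into `Fac`
  -- on the reservoir, and bound the space for the copies and the connections they cause in terms of
  -- `ξn`.
  obtain ⟨e, he0, heθ, heβ, heξ⟩ : ∃ e : ℝ, 0 < e ∧ 8 * w * e ≤ θ ∧ 4 * D * e ≤ β₀ * ρ ∧
      8 * D * (m + w * c) * e ≤ ξ := by
    have h1 : (0 : ℝ) < 8 * D * (m + w * c) := by positivity
    refine ⟨min (θ / (8 * w)) (min (β₀ * ρ / (4 * D)) (ξ / (8 * D * (m + w * c)))),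
      by positivity, ?_, ?_, ?_⟩
    · rw [← le_div_iff₀' (by positivity)]; exact min_le_left _ _
    · rw [← le_div_iff₀' (by positivity)]; exact (min_le_right _ _).trans (min_le_left _ _)
    · rw [← le_div_iff₀' h1]; exact (min_le_right _ _).trans (min_le_right _ _)
  have he8 : e ≤ 1 / 8 := by nlinarith
  -- With `p = eθ/8` only a `θ/8`-fraction of the blocks is lost. The lower bound on `t₁` makes the
  -- costs per chain small: excess block vertices, one connection, and the start edges.
  obtain ⟨t₁, C₀, N₀, ht₁, ht₁1, hcov⟩ := A.exists_rainbow_chain_cover hlm hdk hF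
    (q := δ₀ + α / 2) (by linarith) (p := e * (θ / 8)) (by positivity) he0
    ⌈8 * ℓ / θ + 4 * c / ξ + 2 * es / θ⌉₊
  have ht₁R : 8 * ℓ / θ + 4 * c / ξ + 2 * es / θ ≤ (t₁ : ℝ) := Nat.ceil_le.mp ht₁
  have hq1 : 0 ≤ 8 * (ℓ : ℝ) / θ := by positivity
  have hq2 : 0 ≤ 4 * (c : ℝ) / ξ := by positivity
  have hq3 : 0 ≤ 2 * (es : ℝ) / θ := by positivity
  have ht₁ℓ : 8 * (ℓ : ℝ) ≤ θ * t₁ := by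
    rw [← div_le_iff₀' hθ0]; linarith
  have ht₁c : 4 * (c : ℝ) ≤ ξ * t₁ := by
    rw [← div_le_iff₀' hξ0]; linarith
  have ht₁es : 2 * (es : ℝ) ≤ θ * t₁ := by
    rw [← div_le_iff₀' hθ0]; linarith
  clear hq1 hq2 hq3 ht₁R ht₁
  have ht₁1R : (1 : ℝ) ≤ t₁ := by exact_mod_cast ht₁1
  obtain ⟨κ, hκ⟩ : ∃ κ : ℝ, κ = t₁ * D + es := ⟨_, rfl⟩
  have hκ0 : 0 < κ := by rw [hκ]; positivity
  obtain ⟨s, hs⟩ : ∃ s, s = (m - ℓ) * (t₁ + ℓ) := ⟨_, rfl⟩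
  have hs0 : 0 < s := by rw [hs]; exact Nat.mul_pos hw0 (by omega)
  rw [← hs] at hcov
  have hγε : 0 < γ * ε := by positivity
  filter_upwards [evS, (tendsto_atTop_mono (fun T : ℕ => Nat.le_mul_of_pos_left T hw0)
    tendsto_id).eventually hres,
    eventually_le_mul_natCast (c := α / 32) (by positivity) (ℓ : ℝ),
    eventually_le_mul_natCast (c := θ / 8) (by positivity) (ℓ : ℝ),
    eventually_le_mul_natCast (c := γ * ε / 16) (by positivity) ((eA : ℝ) + 4),
    eventually_le_mul_natCast (c := 1 / 4) (by positivity) ((n₃ : ℝ) + d + 1 + N₀),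
    eventually_le_mul_natCast (c := ρ / 4) (by positivity) ((n₁ : ℝ) + n₂ + d + 1),
    eventually_le_mul_natCast (c := 1 / 16) (by positivity) ((es : ℝ) + 1 + C₀ * κ),
    eventually_le_mul_natCast (c := e) (by positivity) (((C₀ : ℝ) + 1) * κ + eA),
    eventually_le_mul_natCast (c := θ / 8) (by positivity) (s : ℝ),
    eventually_le_mul_natCast (c := ξ / 4) (by positivity) (2 * (w * c) + 2 * ℓ),
    eventually_le_mul_natCast (c := θ / 4) (by positivity) (w * (1 + es)),
    eventually_le_mul_natCast (c := θ) (by positivity) (1 : ℝ),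
    eventually_ge_atTop (2 * m + 1)] with T evS hres b1 b2 b3 b4 b5 b6 b7 b8 b9 b10 b11 b12 n M hn
    hM H hH
  have hnT : T ≤ n := by rw [hn]; exact Nat.le_mul_of_pos_left _ hw0
  have hnTR : (T : ℝ) ≤ n := by exact_mod_cast hnT
  have hn0 : (0 : ℝ) < n := by
    have : 0 < n := by omega
    exact_mod_cast this
  have hnw : (n : ℝ) = w * T := by rw [hn, hw]; push_cast; ring
  have hup : ∀ {x y : ℝ}, 0 ≤ x → y ≤ x * T → y ≤ x * n := fun hx h =>
    h.trans (mul_le_mul_of_nonneg_left hnTR hx)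
  replace b1 := hup (by positivity) b1
  replace b2 := hup (by positivity) b2
  replace b3 := hup (by positivity) b3
  replace b4 := hup (by positivity) b4
  replace b5 := hup (by positivity) b5
  replace b7 := hup (by positivity) b7
  replace b8 := hup (by positivity) b8
  replace b9 := hup (by positivity) b9
  replace b10 := hup (by positivity) b10
  replace b11 := hup (by positivity) b11
  have hM0 : 0 < M := by rw [hM]; exact Nat.mul_pos (by omega) hD0
  have hcardn : Fintype.card (Fin n) = n := Fintype.card_fin n
  have hrich : ∀ i, (H i).RichOn d univ ((δ₀ + α) * (Fintype.card (Fin n) : ℝ) ^ (k - d)) :=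
    fun i => by
      rw [hcardn]; exact UniformHypergraph.richOn_univ_of_le_minDegree (hH i)
  have hpow : ∀ {W : Finset (Fin n)} {x y : ℝ}, 0 ≤ x → x ≤ y →
      x * (W.card : ℝ) ^ (k - d) ≤ y * (Fintype.card (Fin n) : ℝ) ^ (k - d) := fun hx hxy =>
    mul_le_mul hxy (pow_le_pow_left₀ (by positivity) (by exact_mod_cast Finset.card_le_univ _) _)
      (by positivity) (hx.trans hxy)
  -- the colour absorber
  obtain ⟨f₀, t₀, ht₀, ht₀T, hf₀, habsorb⟩ := evS n M hn (by rw [hM, hDdef]) H (fun i =>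
    (hrich i).mono (Finset.Subset.refl _)
      (by rw [hcardn]; exact mul_le_mul_of_nonneg_right (by linarith) (by positivity)))
  -- With these sizes `x ≤ γ(l + x)`, so an edge popular in `B₁` is available in at least `x` of its
  -- `l + x` colours and misses at most `l`, the number the colour absorber can take.
  obtain ⟨l, hl1, hl2⟩ : ∃ l : ℕ, (l : ℝ) ≤ ε / 2 * n ∧ ε / 2 * n < l + 1 :=
    ⟨⌊ε / 2 * (n : ℝ)⌋₊, Nat.floor_le (by positivity), Nat.lt_floor_add_one _⟩
  obtain ⟨x, hx1, hx2⟩ : ∃ x : ℕ, (x : ℝ) ≤ γ * ε / 8 * n ∧ γ * ε / 8 * n < x + 1 :=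
    ⟨⌊γ * ε / 8 * (n : ℝ)⌋₊, Nat.floor_le (by positivity), Nat.lt_floor_add_one _⟩
  have hγεn : γ * ε * n ≤ ε * n :=
    mul_le_mul_of_nonneg_right (mul_le_of_le_one_left hε0.le hγ1) hn0.le
  have hlx : ((l + x : ℕ) : ℝ) ≤ ε * n := by push_cast; linarith
  obtain ⟨B₀, B₁, hB01, hB₀, hB₁, habs⟩ := habsorb l (l + x) (by linarith) hlx
  have hxγ : (x : ℝ) ≤ γ * (l + x) := by
    have h1 := mul_le_mul_of_nonneg_left hl2.le hγ0.le
    have h2 : 0 ≤ γ * x := by positivity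
    have h3 : (0 : ℝ) ≤ eA := by positivity
    linarith
  have hx0 : 0 < l + x := by
    have h3 : (0 : ℝ) ≤ eA := by positivity
    have : (0 : ℝ) < l := by linarith
    have : 0 < l := by exact_mod_cast this
    omega
  have hH'rich := UniformHypergraph.richOn_popular (B := B₁)
    (Finset.card_pos.mp (by rw [hB₁]; exact hx0)) hγ0.le fun i _ => hrich i
  rw [← sub_mul] at hH'rich
  set H' := UniformHypergraph.popular H B₁ (γ * B₁.card) with hH'
  have hrest : ∀ B ⊆ B₁, ∀ E ∈ H'.edges,
      B.card ≤ (B.filter fun i => E ∈ (H i).edges).card + l := by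
    intro B hB E hEe
    have h1 := (UniformHypergraph.mem_popular.mp hEe).2
    have h2 : ((x : ℕ) : ℝ) ≤ ((B₁.filter fun i => E ∈ (H i).edges).card : ℝ) := by
      refine hxγ.trans ?_
      rw [hB₁] at h1
      push_cast at h1
      convert h1 using 3
    have h3 : x ≤ (B₁.filter fun i => E ∈ (H i).edges).card := by exact_mod_cast h2
    have h4 := Finset.card_le_card (Finset.filter_subset_filter (fun i => ¬ E ∈ (H i).edges) hB)
    have h5 := Finset.card_filter_add_card_filter_not (s := B₁) (fun i => E ∈ (H i).edges)
    have h6 := Finset.card_filter_add_card_filter_not (s := B) (fun i => E ∈ (H i).edges)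
    omega
  -- the vertex absorber
  set X := A.chainVerts f₀ t₀ with hX
  have hXcard : X.card = (m - ℓ) * t₀ + ℓ := A.card_chainVerts hf₀
  have hXR : (X.card : ℝ) = w * t₀ + ℓ := by rw [hXcard, hw]; push_cast; ring
  have hwt₀ : w * t₀ ≤ ν * n := by
    rw [hnw]
    have := mul_le_mul_of_nonneg_left ht₀T (show 0 ≤ w by linarith)
    linarith
  have hνn : ν * n ≤ α / 32 * n := mul_le_mul_of_nonneg_right hνα hn0.le
  have hνn' : ν * n ≤ 1 / 16 * n := mul_le_mul_of_nonneg_right hν1 hn0.le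
  have hθn : θ * n ≤ 1 / 128 * n := mul_le_mul_of_nonneg_right hθ1 hn0.le
  have hXα : (X.card : ℝ) ≤ α / 16 * n := by linarith
  have hX8 : (X.card : ℝ) ≤ 1 / 8 * n := by linarith
  have hWge : n ≤ (univ \ X : Finset (Fin n)).card + X.card := by
    have := Finset.le_card_sdiff X (univ : Finset (Fin n))
    rw [Finset.card_univ, hcardn] at this
    omega
  have hWgeR : (n : ℝ) ≤ ((univ \ X : Finset (Fin n)).card : ℝ) + X.card := by
    exact_mod_cast hWge
  have hb4 : (0 : ℝ) ≤ n₃ + d + 1 := by positivity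
  obtain ⟨S, hSW, hSτ, a, b, hSabs⟩ := A.exists_vertex_absorber hlm hab (by positivity) hτ0.le H'
    (W := univ \ X) ((hH'rich.sdiff_of_le hdk (by rw [hcardn]; exact hXα)).mono
      (Finset.Subset.refl _) (mul_le_mul_of_nonneg_right (by linarith) (by positivity)))
    (by
      have h1 : ((n₃ + d + 1 : ℕ) : ℝ) ≤ ((univ \ X : Finset (Fin n)).card : ℝ) := by
        have h2 : (0 : ℝ) ≤ N₀ := by positivity
        push_cast; linarith
      exact_mod_cast h1)
  rw [hcardn] at hSτ
  have hXS : Disjoint X S := (Finset.sdiff_disjoint.mono_left hSW).symm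
  have hτn : τ * n ≤ α' * n := mul_le_mul_of_nonneg_right hτα' hn0.le
  have hα'n : α' * n ≤ α / 32 * n := mul_le_mul_of_nonneg_right hα'α hn0.le
  have hα'n' : α' * n ≤ 1 / 16 * n := mul_le_mul_of_nonneg_right hα'1 hn0.le
  have hXScard : (X ∪ S).card = X.card + S.card := Finset.card_union_of_disjoint hXS
  have hXSR : ((X ∪ S).card : ℝ) = X.card + S.card := by exact_mod_cast hXScard
  have hXSα : ((X ∪ S).card : ℝ) ≤ 3 * α / 32 * n := by rw [hXSR]; linarith
  have hXS4 : ((X ∪ S).card : ℝ) ≤ 3 / 16 * n := by rw [hXSR]; linarith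
  -- the reservoir
  have hYge : n ≤ (univ \ (X ∪ S) : Finset (Fin n)).card + (X ∪ S).card := by
    have := Finset.le_card_sdiff (X ∪ S) (univ : Finset (Fin n))
    rw [Finset.card_univ, hcardn] at this
    omega
  have hYgeR : (n : ℝ) ≤ ((univ \ (X ∪ S) : Finset (Fin n)).card : ℝ) + (X ∪ S).card := by
    exact_mod_cast hYge
  -- `Option (Fin M)` adjoins `H'` to the collection, so that one sample serves the connections in
  -- `H'` and the copies of `A` in the `H i`.
  obtain ⟨R, hRY, hRcard, hRrich⟩ : ∃ R ⊆ univ \ (X ∪ S), R.card = ⌊ρ * n⌋₊ ∧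
      ∀ i : Option (Fin M), ((i.elim H' H)).RichOn d R
        ((δ₀ + α / 4) * (R.card : ℝ) ^ (k - d)) := by
    have hres' := hres
    rw [← hn] at hres'
    refine hres' (Option (Fin M)) (fun i => i.elim H' H) (univ \ (X ∪ S)) ?_ ?_ ?_
    · rw [Fintype.card_option, Fintype.card_fin, hM]
      push_cast
      have h1 : (T : ℝ) * D ≤ n * D := mul_le_mul_of_nonneg_right hnTR (by positivity)
      have h2 : (1 : ℝ) ≤ n := by
        have : 1 ≤ n := by omega
        exact_mod_cast this
      linarith
    · have h1 : (n : ℝ) ≤ ((2 * (univ \ (X ∪ S) : Finset (Fin n)).card : ℕ) : ℝ) := by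
        push_cast; linarith
      exact_mod_cast h1
    · rintro (_ | i)
      · exact (hH'rich.sdiff_of_le hdk (by rw [hcardn]; exact hXSα)).mono
          (Finset.Subset.refl _) (hpow (by positivity) (by linarith))
      · exact ((hrich i).sdiff_of_le hdk (by rw [hcardn]; exact hXSα)).mono
          (Finset.Subset.refl _) (hpow (by positivity) (by linarith))
  have hRle : (R.card : ℝ) ≤ ρ * n := by rw [hRcard]; exact Nat.floor_le (by positivity)
  have hRgt : ρ * n < R.card + 1 := by rw [hRcard]; exact Nat.lt_floor_add_one _
  have hRge : ρ / 2 * n ≤ R.card := by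
    have h1 : (0 : ℝ) ≤ n₁ + n₂ + d := by positivity
    linarith
  have hRXS : Disjoint R (X ∪ S) := Finset.sdiff_disjoint.mono_left hRY
  rw [Finset.disjoint_union_right] at hRXS
  -- the blocks
  set V' : Finset (Fin n) := univ \ (X ∪ S ∪ R) with hV'
  have hρn : ρ * n ≤ α / 32 * n := mul_le_mul_of_nonneg_right hρα hn0.le
  have hρn' : ρ * n ≤ θ / 8 * n := mul_le_mul_of_nonneg_right hρθ hn0.le
  have hV'ge : n ≤ V'.card + (X.card + S.card + R.card) := by
    have h1 := Finset.le_card_sdiff (X ∪ S ∪ R) (univ : Finset (Fin n))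
    have h2 := Finset.card_union_le (X ∪ S) R
    rw [Finset.card_univ, hcardn, ← hV'] at h1
    omega
  have hV'geR : (n : ℝ) ≤ V'.card + (X.card + S.card + R.card) := by exact_mod_cast hV'ge
  have hV'le : (V'.card : ℝ) ≤ n := by
    have := Finset.card_le_univ V'
    rw [hcardn] at this
    exact_mod_cast this
  have hV'rich : ∀ i, (H i).RichOn d V' ((δ₀ + α / 2) * (V'.card : ℝ) ^ (k - d)) := by
    intro i
    have h1 : ((X ∪ S ∪ R).card : ℝ) ≤ α / 8 * n := by
      have h2 : ((X ∪ S ∪ R).card : ℝ) ≤ (X ∪ S).card + R.card := by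
        exact_mod_cast Finset.card_union_le (X ∪ S) R
      linarith
    exact ((hrich i).sdiff_of_le hdk (by rw [hcardn]; exact h1)).mono
      (Finset.Subset.refl _) (hpow (by positivity) (by linarith))
  have hσ : (S.card : ℝ) ≤ α' * n := hSτ.trans hτn
  have hθα' : θ * n ≤ α' * n := mul_le_mul_of_nonneg_right (by linarith) hn0.le
  -- `y` counts the flexible colours beyond the `l` of the absorber. At `D` colours per `w` vertices
  -- they correspond to `S` and to a slack of `θn` vertices.
  obtain ⟨y, hy1, hy2, hy3, hy4⟩ : ∃ y : ℕ, D * (S.card + θ * n) ≤ w * y ∧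
      w * y ≤ D * (S.card + θ * n) + w ∧ (y : ℝ) ≤ γ * ε / 32 * n + 1 ∧
      (y : ℝ) ≤ 1 / 8 * (T * D) + 1 := by
    have hw0' : 0 < w := by linarith
    have h0 : 0 ≤ D * (S.card + θ * n) / w := by positivity
    have h1 := Nat.le_ceil (D * (S.card + θ * n) / w)
    have h2 := (Nat.ceil_lt_add_one h0).le
    refine ⟨⌈D * (S.card + θ * n) / w⌉₊, ?_, ?_, h2.trans ?_, h2.trans ?_⟩
    · rwa [← div_le_iff₀' hw0']
    · refine (mul_le_mul_of_nonneg_left h2 hw0'.le).trans (le_of_eq ?_)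
      field_simp
    · have h3 : D * (S.card + θ * n) / w ≤ D * (S.card + θ * n) :=
        div_le_self (by positivity) hw1
      have h4 : D * (S.card + θ * n) ≤ D * (2 * (α' * n)) :=
        mul_le_mul_of_nonneg_left (by linarith) (by positivity)
      have h5 := mul_le_mul_of_nonneg_right hα'γ hn0.le
      linarith
    · have h3 : D * (S.card + θ * n) / w ≤ 1 / 8 * (T * D) := by
        rw [div_le_iff₀ hw0']
        have h4 : D * (S.card + θ * n) ≤ D * (2 * (1 / 16 * n)) :=
          mul_le_mul_of_nonneg_left (by linarith) (by positivity)
        rw [hnw] at h4 ⊢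
        linarith
      linarith
  have hyx : y ≤ x := by
    have h3 : (0 : ℝ) ≤ eA := by positivity
    have : (y : ℝ) ≤ x := by linarith
    exact_mod_cast this
  -- `y` depends on `|S|`, and `S` was found in `H'`, hence after `B₁`. So `B₁` was chosen
  -- generously and is cut down only now; edges of `H'` still miss at most `l` colours of `B`.
  obtain ⟨B, hBB₁, hBcard⟩ := Finset.exists_subset_card_eq (s := B₁) (n := l + y) (by omega)
  have hB0B : Disjoint B₀ B := hB01.mono_right hBB₁
  set C : Finset (Fin M) := univ \ (B₀ ∪ B) with hC
  have hEcard : (A.chainEdges f₀ t₀).card = t₀ * D + es := by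
    rw [hDdef, hesdef]; exact A.card_chainEdges hlm ht₀ hf₀
  have hCcard : C.card + t₀ * D + es + y = T * D := by
    have h1 : C.card = M - (B₀.card + B.card) := by
      rw [hC, Finset.card_sdiff_of_subset (Finset.subset_univ _), Finset.card_univ,
        Fintype.card_fin, Finset.card_union_of_disjoint hB0B]
    have h2 : B₀.card + B.card ≤ M := by
      rw [← Finset.card_union_of_disjoint hB0B]
      exact (Finset.card_le_univ _).trans (by rw [Fintype.card_fin])
    rw [hEcard] at hB₀
    omega
  have hCR : (C.card : ℝ) + t₀ * D + es + y = T * D := by exact_mod_cast hCcard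
  have ht₀D : (t₀ : ℝ) * D ≤ 1 / 16 * (T * D) := by
    have h1 : (t₀ : ℝ) ≤ 1 / 16 * T :=
      ht₀T.trans (mul_le_mul_of_nonneg_right hν1 (by positivity))
    have := mul_le_mul_of_nonneg_right h1 (show (0 : ℝ) ≤ D by positivity)
    linarith
  have hTD : (T : ℝ) ≤ T * D := le_mul_of_one_le_right (by positivity) hD1
  have hC₀κ : 0 ≤ C₀ * κ := by positivity
  have hCge : (T : ℝ) / 2 ≤ C.card := by linarith
  have hTpos : (0 : ℝ) < T := by
    have : 0 < T := by omega
    exact_mod_cast this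
  have hCpos : (0 : ℝ) < C.card := by linarith
  obtain ⟨J, hJ1, hJ2⟩ := exists_chain_number (κ := κ) (c := C.card) (e := e) (C₀ := C₀) hκ0 (by
    have h1 : (1 - 1 / 8) * (C.card : ℝ) ≤ (1 - e) * C.card :=
      mul_le_mul_of_nonneg_right (by linarith) hCpos.le
    have h2 : (0 : ℝ) ≤ es := by positivity
    linarith)
  have heC : e * C.card ≤ e * (D * n) := by
    refine mul_le_mul_of_nonneg_left ?_ he0.le
    have h1 : (T : ℝ) * D ≤ n * D := mul_le_mul_of_nonneg_right hnTR (by positivity)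
    have h2 : (0 : ℝ) ≤ t₀ * D := by positivity
    have h3 : (0 : ℝ) ≤ es := by positivity
    have h4 : (0 : ℝ) ≤ y := by positivity
    linarith
  have heD : e * n ≤ e * (D * n) :=
    mul_le_mul_of_nonneg_left (le_mul_of_one_le_left hn0.le hD1) he0.le
  have hJκ : J * κ ≤ C.card := by
    have h1 : 0 ≤ e * C.card := by positivity
    linarith
  have hJn : J * t₁ * w ≤ n := by
    have h1 : (J * t₁ : ℝ) * D ≤ T * D := by
      have h2 : (0 : ℝ) ≤ t₀ * D := by positivity
      have h3 : (0 : ℝ) ≤ es := by positivity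
      have h4 : (0 : ℝ) ≤ y := by positivity
      have h5 : (0 : ℝ) ≤ J * es := by positivity
      rw [hκ] at hJκ
      linarith
    have h2 : (J * t₁ : ℝ) ≤ T := le_of_mul_le_mul_right h1 (by positivity)
    rw [hnw]
    have := mul_le_mul_of_nonneg_right h2 (show 0 ≤ w by linarith)
    linarith
  have hJblocks : (J : ℝ) ≤ (1 - θ / 8) * ((V'.card / s : ℕ) : ℝ) := by
    refine chain_number_le (w := w) (D := D) (es := es) (T := T) (t₀ := t₀) (t₁ := t₁)
      (σ := S.card) (n := n) (y := y) (c := C.card) (N := V'.card) (r := R.card) (ℓ := ℓ) (s := s)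
      hw1 hD1 (by positivity) hnw hCR hn0.le hy1 (hκ ▸ hJκ) (by positivity) ?_
      (hRle.trans hρn') b2 (by positivity) ?_ ht₁ℓ ht₁1R b8 hV'le hθ0.le (by linarith) ?_
    · linarith
    · rw [hs, hw]; push_cast; ring
    · have := Nat.lt_mul_div_succ V'.card hs0
      have h' : (V'.card : ℝ) < s * ((V'.card / s : ℕ) + 1) := by exact_mod_cast this
      exact h'
  obtain ⟨f, ψ₁, hf, hfdisj, hψ₁, hψ₁H⟩ := hcov n M H V' C
    (by
      have h1 : (N₀ : ℝ) ≤ V'.card := by linarith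
      exact_mod_cast h1)
    (Finset.card_pos.mp (by exact_mod_cast hCpos)) hV'rich J
    (by rwa [mul_div_cancel_left₀ _ he0.ne']) (by rw [← hDdef, ← hesdef, ← hκ]; exact hJ1)
  -- the leftover colours
  set Eb := (range J).biUnion fun j => A.chainEdges (f j) t₁ with hEb
  have hEbcard : (Eb.card : ℝ) = J * κ := by
    have h1 : Eb.card = ∑ j ∈ range J, (A.chainEdges (f j) t₁).card :=
      Finset.card_biUnion fun i hi j hj hij => A.disjoint_chainEdges (by omega)
        (hf i (Finset.mem_range.mp hi)).1
        (hfdisj i (Finset.mem_range.mp hi) j (Finset.mem_range.mp hj) hij)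
    have h2 : Eb.card = J * (t₁ * D + es) := by
      rw [h1, Finset.sum_congr rfl fun j hj => A.card_chainEdges hlm ht₁1
        (hf j (Finset.mem_range.mp hj)).1, Finset.sum_const, Finset.card_range, smul_eq_mul, hDdef,
        hesdef]
    rw [h2, hκ]; push_cast; ring
  have himgC : Eb.image ψ₁ ⊆ C := fun i hi => by
    obtain ⟨E, hEe, rfl⟩ := Finset.mem_image.mp hi
    exact (hψ₁H E hEe).1
  have hC₃card : ((C \ Eb.image ψ₁).card : ℝ) = C.card - J * κ := by
    rw [Finset.card_sdiff_of_subset himgC, Nat.cast_sub (Finset.card_le_card himgC),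
      Finset.card_image_of_injOn hψ₁, hEbcard]
  have hCB : Disjoint C (B₀ ∪ B) := Finset.sdiff_disjoint
  rw [Finset.disjoint_union_right] at hCB
  obtain ⟨C₄, hC₄, hC₄', hC₄dvd, hC₄card⟩ := exists_padding (s := C \ Eb.image ψ₁) (t := B) heA0
    (by
      have h1 : (eA : ℝ) ≤ ((l + y : ℕ) : ℝ) := by
        have h2 : (0 : ℝ) ≤ y := by positivity
        push_cast; linarith
      rw [hBcard]; exact_mod_cast h1)
    (hCB.2.mono_left Finset.sdiff_subset)
  have hC₄le : (C₄.card : ℝ) ≤ 2 * e * D * n := by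
    have h1 : (C₄.card : ℝ) ≤ (C \ Eb.image ψ₁).card + eA := by exact_mod_cast hC₄card
    linarith
  -- the copies of `A` and the connections
  have hC₄ξ : (C₄.card : ℝ) * (m + w * c) ≤ ξ / 4 * n := by
    have h1 := mul_le_mul_of_nonneg_right hC₄le (show 0 ≤ m + w * c by positivity)
    have h2 := mul_le_mul_of_nonneg_right heξ hn0.le
    linarith
  have hJξ : J * (w * c) ≤ ξ / 4 * n := by
    have h1 : J * w * (4 * c) ≤ J * w * (ξ * t₁) :=
      mul_le_mul_of_nonneg_left ht₁c (by positivity)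
    have h2 := mul_le_mul_of_nonneg_left hJn hξ0.le
    linarith
  obtain ⟨z, hz⟩ : ∃ z, z = (J + C₄.card + 2) * ((m - ℓ) * c) := ⟨_, rfl⟩
  have hzR : (z : ℝ) = (J + C₄.card + 2) * (w * c) := by rw [hz, hw]; push_cast; ring
  have hzξ : (C₄.card : ℝ) * m + z + 2 * ℓ ≤ ξ * n := by
    have h1 : 0 ≤ ξ * n := by positivity
    rw [hzR]; linarith
  have hξn : ξ * n ≤ ρ / 4 * n := mul_le_mul_of_nonneg_right hξρ hn0.le
  obtain ⟨P, g, ψ₂, hPz, hg, hgdisj, hψ₂, hψ₂C, hψ₂H, hconn⟩ :=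
    A.exists_copies_and_connector hlm (J := J) (y := z) (β := δ₀ + α / 8) (a := α / 8) hcon hfac
      (by positivity) (by positivity) H (H' := H') (R := R) C₄
      (fun i => by
        have := hRrich (some i)
        rwa [show δ₀ + α / 4 = δ₀ + α / 8 + α / 8 by ring] at this)
      (by
        have := hRrich none
        rwa [show δ₀ + α / 4 = δ₀ + α / 8 + α / 8 by ring] at this)
      (by
        have h1 := mul_le_mul_of_nonneg_right heβ hn0.le
        have h2 := mul_le_mul_of_nonneg_left hRge hβ₀.le
        linarith)
      (heAdef ▸ hC₄dvd) hM0
      (by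
        have h1 : ((n₂ + d + 1 : ℕ) : ℝ) ≤ R.card := by
          have h2 : (0 : ℝ) ≤ n₁ := by positivity
          have h3 : 0 ≤ ρ * n := by positivity
          push_cast; linarith
        exact_mod_cast h1)
      (by
        have h1 : ((n₁ + d + z + 2 * ℓ + C₄.card * m : ℕ) : ℝ) ≤ R.card := by
          have h2 : (0 : ℝ) ≤ n₂ := by positivity
          push_cast; linarith
        exact_mod_cast h1)
      hz.ge
      (by
        rw [hcardn]
        have h1 : (n : ℝ) ^ (k - d) = n * (n : ℝ) ^ (k - d - 1) := by
          rw [← pow_succ']; congr 1; omega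
        calc ((C₄.card : ℝ) * m + z + 2 * ℓ) * (n : ℝ) ^ (k - d - 1)
            ≤ ξ * n * (n : ℝ) ^ (k - d - 1) := mul_le_mul_of_nonneg_right hzξ (by positivity)
          _ = ξ * (n : ℝ) ^ (k - d) := by rw [h1]; ring
          _ ≤ α / 8 * (ρ / 2) ^ (k - d) * (n : ℝ) ^ (k - d) :=
            mul_le_mul_of_nonneg_right hξα (by positivity)
          _ = α / 8 * (ρ / 2 * n) ^ (k - d) := by rw [mul_pow]; ring
          _ ≤ α / 8 * (R.card : ℝ) ^ (k - d) := by gcongr)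
  obtain ⟨Λ, hΛ1, hΛ2⟩ : ∃ Λ : ℕ, (Λ : ℝ) ≤ η * (univ \ X : Finset (Fin n)).card ∧
      η * (univ \ X : Finset (Fin n)).card < Λ + 1 :=
    ⟨⌊η * ((univ \ X : Finset (Fin n)).card : ℝ)⌋₊, Nat.floor_le (by positivity),
      Nat.lt_floor_add_one _⟩
  have huncov : (n : ℝ) ≤ w * t₀ + J * (w * t₁) + S.card + 2 * θ * n :=
    uncovered_le (D := D) (es := es) (T := T) (y := y) (c := C.card) (e := e) hw1 hD1 hnw hCR
      hn0.le hy2 (by rw [← hκ]; linarith) hJn (by positivity) ht₁es heθ b10 hθ0.le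
  have hV'disj : Disjoint V' (X ∪ S ∪ R) := Finset.sdiff_disjoint
  rw [Finset.disjoint_union_right, Finset.disjoint_union_right] at hV'disj
  refine A.exists_transversal_of_blocks hlm (by omega) (T := T) (c := c) (y := z) (Λ := Λ) (l := l)
    (C₄ := C₄) (by rw [hcardn, hn]) ?_ (by rw [hM, hDdef]) hM0 H ht₀ hf₀ ht₁1 hf hfdisj hg hgdisj hXS
    hRXS.1.symm hV'disj.1.1.symm hRXS.2.symm hV'disj.1.2.symm hV'disj.2.symm (H' := H') ?_ hPz
    (a := a) (b := b) ?_ ?_ hB0B hCB.1 hCB.2 ?_ hψ₁ hψ₁H hψ₂ ?_ hψ₂H ?_ ?_ hB₀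
    (fun U hU hUl => ?_) ?_
  · have := Nat.le_mul_of_pos_left T hw0
    omega
  · convert hconn
  · intro L hLS hLX hLΛ hLdvd
    refine hSabs L (fun v hv => Finset.mem_sdiff.mpr ⟨Finset.mem_univ _,
      Finset.disjoint_left.mp hLX hv⟩) hLS ?_ hLdvd
    exact le_trans (by exact_mod_cast hLΛ) hΛ1
  · rw [hcardn]
    have h1 : (n : ℝ) ≤ (((m - ℓ) * t₀ + J * ((m - ℓ) * t₁) + S.card + Λ : ℕ) : ℝ) := by
      push_cast
      rw [← hw]
      have h2 : 8 * θ * (1 / 2 * n) ≤ η * ((univ \ X : Finset (Fin n)).card : ℝ) := by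
        rw [hθη]
        exact mul_le_mul_of_nonneg_left (by linarith) hη0.le
      linarith
    exact_mod_cast h1
  · intro i
    by_cases h : i ∈ B₀ ∪ B
    · rcases Finset.mem_union.mp h with h | h
      · exact Or.inl h
      · exact Or.inr (Or.inl h)
    · exact Or.inr (Or.inr (Finset.mem_sdiff.mpr ⟨Finset.mem_univ _, h⟩))
  · convert hψ₂C
  · convert hC₄
  · convert hC₄'
  · obtain ⟨ψ, hψ, hψ'⟩ := habs U (hU.trans hBB₁) hUl
    exact ⟨ψ, hψ, fun E hEe => ⟨by convert (hψ' E hEe).1, (hψ' E hEe).2⟩⟩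
  · intro E hEe
    convert hrest B hBB₁ E hEe

end Link

theorem theorem2p5 {k ℓ m d : ℕ} (A : Link k ℓ m) (hd : 1 ≤ d) (hdk : d < k)
    (δ δ₀ : ℝ) (hδ : A.IsHamiltonThreshold d δ) (hδ₀ : δ ≤ δ₀) (hgood : A.IsGood δ₀ d) :
    ∀ α : ℝ, 0 < α → ∃ n₀ : ℕ, ∀ n : ℕ, n₀ ≤ n → (m - ℓ) ∣ n →
      ∀ (M : ℕ) (H : Fin M → UniformHypergraph k (Fin n)),
        (M : ℝ) =
          ((A.graph.edges.card : ℝ) - (A.start.edges.card : ℝ)) / ((m : ℝ) - (ℓ : ℝ)) * n →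
        (∀ i, (δ₀ + α) * (n : ℝ) ^ (k - d) ≤ ((H i).minDegree d : ℝ)) →
        ∃ F : UniformHypergraph k (Fin n), A.IsCycle F ∧ F.IsTransversal H := by
  intro α hα
  rcases Nat.eq_or_lt_of_le A.le with hlm | hlm
  -- If `ℓ = m`, the only multiple of `m - ℓ` is `0`, excluded by `n ≥ 1`.
  · refine ⟨1, fun n hn hdvd => ?_⟩
    rw [hlm, Nat.sub_self, zero_dvd_iff] at hdvd
    omega
  have hE := A.nonempty_of_isHamiltonThreshold hlm (by omega) hδ
  obtain ⟨T₀, hT₀⟩ := Filter.eventually_atTop.mp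
    (A.eventually_exists_transversal_cycle hlm hd hdk hδ.1 hE hδ₀ hgood hα)
  refine ⟨(m - ℓ) * T₀, fun n hn hdvd M H hM hH => ?_⟩
  obtain ⟨T, rfl⟩ := hdvd
  refine hT₀ T (Nat.le_of_mul_le_mul_left hn (by omega)) _ M rfl ?_ H hH
  have h1 : (A.graph.edges.card : ℝ) = A.newEdges.card + A.start.edges.card := by
    exact_mod_cast A.card_newEdges.symm
  have h2 : (m : ℝ) - ℓ ≠ 0 := by
    have : (ℓ : ℝ) < m := by exact_mod_cast hlm
    linarith
  have h3 : (M : ℝ) = T * A.newEdges.card := by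
    rw [hM, h1, Nat.cast_mul, Nat.cast_sub A.le]
    field_simp
    ring
  exact_mod_cast h3
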